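/- Let $L\ge 2$. Write $\mathcal V_n=\pi^{n/2}/\Gamma(n/2+1)$ for the volume of the unit ball of $\mathbb R^n$, $\mathcal S_n=n\mathcal V_n$ for the area of the unit sphere $S^{n-1}\subset\mathbb R^n$, and $\mathrm{cap}_n(d)=\mathcal S_{n-1}\int_0^{\arcsin(d/2)}\sin^{n-2}x\,dx$ for the area of a spherical cap of angular radius $\arcsin(d/2)$ on $S^{n-1}$. The density of a code $X\subset S^{n-1}$ of minimum distance $d$ is $\Delta(X)=\mathrm{cap}_n(d)\,|X|/\mathcal S_n$. The density of a full-rank lattice $\Lambda\subset\mathbb R^n$ with minimum distance $m$ is $\Delta_\Lambda=\mathcal V_n(m/2)^n/\det\Lambda$, where $\det\Lambda$ is the covolume. For a unit vector $c\in\mathbb R^L$ with $c_i\ge 0$, let $\Phi_c(u)=\big(c_i\cos(u_i/c_i),\,c_i\sin(u_i/c_i)\big)_{1\le i\le L}\in\mathbb R^{2L}$ and $P_c=\prod_{i}[0,2\pi c_i)$; if $c_i=0$, the $i$-th pair of coordinates of $\Phi_c$ is $(0,0)$ and the $i$-th side of $P_c$ is $\{0\}$. For $d\in(0,\sqrt2]$,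 a (lattice) torus layer spherical code in $\mathbb R^{2L}$ is obtained from a finite set $C\subset S^{L-1}$ of minimum distance greater than $d$ as $X=\bigcup_{c}\Phi_c(Y_c)$, the union over all $c\in C$ with nonnegative coordinates, where each layer $Y_c$ is the set of points in $P_c$ of some full-rank lattice of $\mathbb R^L$ (which may depend on $c$ and $d$) and $\|\Phi_c(x)-\Phi_c(y)\|\ge d$ for all distinct $x,y\in Y_c$. We say that $X$ has largest layers if each $Y_c$ has the maximal number of points among all such sets. A family $(C_d)_{d\in(0,\sqrt2]}$ of codes on $S^{L-1}$ is said to have asymptotic density $\delta$ (respectively, at most $\delta$) if for every subset $A$ of $S^{L-1}\cap[0,\infty)^L$ whose boundary in $S^{L-1}$ has area zero, $\mathrm{cap}_L(d)\,|C_d\cap A|$ tends to $\delta\cdot\mathrm{area}(A)$ (respectively, has limit superior at most $\delta\cdot\mathrm{area}(A)$) as $d\to0^+$. Let $\Lambda_L\subset\mathbb R^L$ and $\Lambda_{L-1}\subset\mathbb R^{L-1}$ be densest lattices in their dimensions, both scaled to have minimum distance $2$. Then: 1. The Cartesian product lattice $\Lambda_L\times\Lambda_{L-1}\subset\mathbb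 R^{2L-1}$ has density $\Delta_{\Lambda_L\times\Lambda_{L-1}}=\dfrac{\mathcal V_{2L-1}}{\det\Lambda_L\,\det\Lambda_{L-1}}$. 2. (Upper bound) If $(X_d)_{d\in(0,\sqrt2]}$ are torus layer spherical codes built from codes $C_d$ of asymptotic density at most $\Delta_{\Lambda_{L-1}}$, then $\limsup_{d\to0^+}\Delta(X_d)\le\Delta_{\Lambda_L\times\Lambda_{L-1}}$. 3. (Limit) If $(X_d)_{d\in(0,\sqrt2]}$ are torus layer spherical codes with largest layers, built from codes $C_d$ of asymptotic density $\Delta_{\Lambda_{L-1}}$, then $\lim_{d\to0^+}\Delta(X_d)=\Delta_{\Lambda_L\times\Lambda_{L-1}}$. 4. Families $(C_d)$, $(X_d)$ as in 3 exist. -/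

import Mathlib

open Set Filter Topology MeasureTheory

noncomputable section

namespace TorusLayer

/-- `V_n = π^(n/2) / Γ(n/2 + 1)`, the volume of the unit ball of `ℝⁿ`. -/
def ballVol (n : ℕ) : ℝ :=
  Real.pi ^ ((n : ℝ) / 2) / Real.Gamma ((n : ℝ) / 2 + 1)

/-- `S_n = n π^(n/2) / Γ(n/2 + 1)`, the `(n-1)`-dimensional area of the unit sphere of `ℝⁿ`. -/
def sphereArea (n : ℕ) : ℝ :=
  n * Real.pi ^ ((n : ℝ) / 2) / Real.Gamma ((n : ℝ) / 2 + 1)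

/-- Area of a cap of angular radius `θ / 2 = arcsin (d / 2)` on the unit sphere of `ℝⁿ`
(`n ≥ 2`); caps of this radius around points at mutual distance `≥ d` do not overlap. -/
def capArea (n : ℕ) (d : ℝ) : ℝ :=
  sphereArea (n - 1) * ∫ x in (0 : ℝ)..Real.arcsin (d / 2), Real.sin x ^ (n - 2)

/-- Density of a code `X` of minimum distance `d` on the unit sphere of `ℝⁿ`: the proportion of
the sphere covered by the caps of angular radius `arcsin (d / 2)` around the codewords. -/
def sphericalDensity (n : ℕ) (d : ℝ) {α : Type*} (X : Set α) : ℝ :=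
  capArea n d * (X.ncard : ℝ) / sphereArea n

/-- The torus map `Φ_c : ℝᴸ → ℝ²ᴸ`, with `(i, 0)` and `(i, 1)` indexing the two coordinates
`c_i (cos (u_i / c_i), sin (u_i / c_i))`. If `c_i = 0` these two coordinates are `0`. -/
def torusMap {L : ℕ} (c u : EuclideanSpace ℝ (Fin L)) : EuclideanSpace ℝ (Fin L × Fin 2) :=
  WithLp.toLp 2 fun p =>
    if p.2 = 0 then c p.1 * Real.cos (u p.1 / c p.1) else c p.1 * Real.sin (u p.1 / c p.1)

/-- The box `P_c = ∏ [0, 2 π c_i)`; a side with `c_i = 0` (degenerate torus) is the point `0`. -/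
def torusBox {L : ℕ} (c : EuclideanSpace ℝ (Fin L)) : Set (EuclideanSpace ℝ (Fin L)) :=
  {u | ∀ i, (0 ≤ u i ∧ u i < 2 * Real.pi * c i) ∨ (c i = 0 ∧ u i = 0)}

/-- A finite set of unit vectors of `ℝᴸ` with minimum distance greater than `d`. -/
structure IsSphericalCode {L : ℕ} (d : ℝ) (C : Set (EuclideanSpace ℝ (Fin L))) : Prop where
  finite : C.Finite
  norm_eq : ∀ c ∈ C, ‖c‖ = 1
  lt_dist : C.Pairwise fun b c => d < dist b c

/-- `SC(L,d)₊`: the codewords with nonnegative coordinates. -/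
def posPart {L : ℕ} (C : Set (EuclideanSpace ℝ (Fin L))) : Set (EuclideanSpace ℝ (Fin L)) :=
  {c ∈ C | ∀ i, 0 ≤ c i}

/-- `Y` is the set of points in the box `P_c` of some full-rank lattice of `ℝᴸ`, and the images
of distinct points of `Y` on the torus `T_c` are at distance at least `d`. -/
def IsLatticeLayer {L : ℕ} (d : ℝ) (c : EuclideanSpace ℝ (Fin L))
    (Y : Set (EuclideanSpace ℝ (Fin L))) : Prop :=
  (∃ Λ : Submodule ℤ (EuclideanSpace ℝ (Fin L)), ∃ _ : DiscreteTopology Λ,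
    IsZLattice ℝ Λ ∧ Y = (Λ : Set (EuclideanSpace ℝ (Fin L))) ∩ torusBox c) ∧
  Y.Pairwise fun x y => d ≤ dist (torusMap c x) (torusMap c y)

/-- A lattice layer with the largest possible number of points. -/
def IsLargestLatticeLayer {L : ℕ} (d : ℝ) (c : EuclideanSpace ℝ (Fin L))
    (Y : Set (EuclideanSpace ℝ (Fin L))) : Prop :=
  IsLatticeLayer d c Y ∧ ∀ Y', IsLatticeLayer d c Y' → Y'.ncard ≤ Y.ncard

/-- The union of the torus layers `Φ_c(Y_c)`, `c ∈ SC(L,d)₊`. -/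
def layeredCode {L : ℕ} (C : Set (EuclideanSpace ℝ (Fin L)))
    (Y : EuclideanSpace ℝ (Fin L) → Set (EuclideanSpace ℝ (Fin L))) :
    Set (EuclideanSpace ℝ (Fin L × Fin 2)) :=
  ⋃ c ∈ posPart C, torusMap c '' Y c

/-- `X` is a torus layer spherical code of distance `d` built from the spherical code `C` and
some lattice layer on each torus. -/
def IsLatticeTLSC {L : ℕ} (d : ℝ) (C : Set (EuclideanSpace ℝ (Fin L)))
    (X : Set (EuclideanSpace ℝ (Fin L × Fin 2))) : Prop :=
  IsSphericalCode d C ∧ ∃ Y : EuclideanSpace ℝ (Fin L) → Set (EuclideanSpace ℝ (Fin L)),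
    (∀ c ∈ posPart C, IsLatticeLayer d c (Y c)) ∧ X = layeredCode C Y

/-- The same with a largest lattice layer on each torus. -/
def IsLargestLatticeTLSC {L : ℕ} (d : ℝ) (C : Set (EuclideanSpace ℝ (Fin L)))
    (X : Set (EuclideanSpace ℝ (Fin L × Fin 2))) : Prop :=
  IsSphericalCode d C ∧ ∃ Y : EuclideanSpace ℝ (Fin L) → Set (EuclideanSpace ℝ (Fin L)),
    (∀ c ∈ posPart C, IsLargestLatticeLayer d c (Y c)) ∧ X = layeredCode C Y

/-- The area measure of the unit sphere of `ℝᴸ` (total mass `S_L`). -/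
def sphereMeasure (L : ℕ) : Measure (Metric.sphere (0 : EuclideanSpace ℝ (Fin L)) 1) :=
  (volume : Measure (EuclideanSpace ℝ (Fin L))).toSphere

/-- Regions of the nonnegative part of the unit sphere with boundary of area zero. -/
def IsPosRegion {L : ℕ} (A : Set (Metric.sphere (0 : EuclideanSpace ℝ (Fin L)) 1)) : Prop :=
  (∀ a ∈ A, ∀ i, 0 ≤ (a : EuclideanSpace ℝ (Fin L)) i) ∧ sphereMeasure L (frontier A) = 0

/-- Total area of the caps of angular radius `arcsin (d / 2)` around the codewords in `A`. -/
def capAreaIn {L : ℕ} (d : ℝ) (C : Set (EuclideanSpace ℝ (Fin L)))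
    (A : Set (Metric.sphere (0 : EuclideanSpace ℝ (Fin L)) 1)) : ℝ :=
  capArea L d * ((C ∩ (Subtype.val '' A)).ncard : ℝ)

/-- As `d → 0`, the family `C d` has density at most `δ` in every region of the nonnegative part
of the sphere. -/
def HasDensityAtMost {L : ℕ} (C : ℝ → Set (EuclideanSpace ℝ (Fin L))) (δ : ℝ) : Prop :=
  ∀ A : Set (Metric.sphere (0 : EuclideanSpace ℝ (Fin L)) 1), IsPosRegion A →
    ∀ ε > 0, ∀ᶠ d in 𝓝[>] (0 : ℝ), capAreaIn d (C d) A ≤ δ * (sphereMeasure L A).toReal + ε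

/-- As `d → 0`, the family `C d` has density tending to `δ` in every region of the nonnegative
part of the sphere. -/
def HasDensity {L : ℕ} (C : ℝ → Set (EuclideanSpace ℝ (Fin L))) (δ : ℝ) : Prop :=
  ∀ A : Set (Metric.sphere (0 : EuclideanSpace ℝ (Fin L)) 1), IsPosRegion A →
    Tendsto (fun d => capAreaIn d (C d) A) (𝓝[>] (0 : ℝ)) (𝓝 (δ * (sphereMeasure L A).toReal))

/-- Minimum distance of a lattice. -/
def minDist {ι : Type*} [Fintype ι] (Λ : Submodule ℤ (EuclideanSpace ℝ ι)) : ℝ :=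
  sInf {r | ∃ x ∈ Λ, x ≠ 0 ∧ r = ‖x‖}

/-- Packing density of a lattice: `V_n (minDist / 2)ⁿ / det Λ`, where `det Λ` is the covolume. -/
def latticeDensity {ι : Type*} [Fintype ι] (Λ : Submodule ℤ (EuclideanSpace ℝ ι)) : ℝ :=
  ballVol (Fintype.card ι) * (minDist Λ / 2) ^ Fintype.card ι / ZLattice.covolume Λ

/-- `Λ` has the largest packing density among all full-rank lattices of the same space. -/
def IsDensest {ι : Type*} [Fintype ι] (Λ : Submodule ℤ (EuclideanSpace ℝ ι)) : Prop :=
  ∀ (Λ' : Submodule ℤ (EuclideanSpace ℝ ι)) (_ : DiscreteTopology Λ'), IsZLattice ℝ Λ' →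
    latticeDensity Λ' ≤ latticeDensity Λ

/-- The Cartesian product lattice `Λ × Λ'` in `ℝᵐ⁺ⁿ`. -/
def prodLattice {ι κ : Type*} (Λ : Submodule ℤ (EuclideanSpace ℝ ι))
    (Λ' : Submodule ℤ (EuclideanSpace ℝ κ)) : Submodule ℤ (EuclideanSpace ℝ (ι ⊕ κ)) where
  carrier := {x | WithLp.toLp 2 (fun i => x (Sum.inl i)) ∈ Λ ∧
    WithLp.toLp 2 (fun j => x (Sum.inr j)) ∈ Λ'}
  add_mem' hx hy := ⟨Λ.add_mem hx.1 hy.1, Λ'.add_mem hx.2 hy.2⟩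
  zero_mem' := ⟨Λ.zero_mem, Λ'.zero_mem⟩
  smul_mem' n _ hx := ⟨Λ.smul_mem n hx.1, Λ'.smul_mem n hx.2⟩

end TorusLayer

end

/-!
# Asymptotic density of torus layer spherical codes

The sphere `S^(2L-1)` is foliated by the flat tori `T_c = Φ_c(ℝᴸ)`, where `c` runs through the
nonnegative part of `S^(L-1)`, and a torus layer code places a layer `Y_c` on each torus with
`c ∈ C_d`. For small `d` the code looks locally like a product of a lattice along the tori and of
`C_d` across them, so its density is governed by the number of points in each layer.

*Layers.* Uniformly in `c`, a layer has at most `d^(-L) (2^L vol(P_c) / det Λ_L + o(1))` points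
(`layer_upper_bound`), and a largest layer has at least `d^(-L) (2^L vol(P_c) / det Λ_L - o(1))`
points (`layer_lower_bound`). The torus map does not increase distances, so for the upper bound one compares volumes whenever the lattice of
the layer has minimum distance at least `d` and contains a basis of vectors of length `O(d)`; a
lattice with a vector shorter than `d` has layer points only near the boundary of `P_c`, and a
lattice whose short vectors lie in a hyperplane has few points. For the lower bound, `Λ_L` is
scaled to minimum distance slightly above `d` and deformed slightly so that it contains the periods
`2 π c_i e_i` of the torus (`exists_large_layer`); then there is no loss where
opposite faces of `P_c` meet.

*Summation.* A code of density `δ` is equidistributed (`HasDensityAtMost.sum_le`,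
`HasDensity.tendsto_sum`), so summing `vol(P_c) = ∏ 2 π c_i` over the codewords produces the
integral `∫ ∏ 2 π c_i` over the nonnegative part of `S^(L-1)`. It equals the area of `S^(2L-1)`
(`two_pi_pow_mul_integral_posSphere`), and with `cap_n(d) ~ V_(n-1) (d/2)^(n-1)`
(`tendsto_capArea_div`) all constants combine to `V_(2L-1) / (det Λ_L det Λ_(L-1))`, which is the
density of the product lattice (`latticeDensity_prodLattice`).

*Existence.* Codes of density `Δ_{Λ_(L-1)}` are built by cutting the sphere into small cells and
transporting scaled copies of `Λ_(L-1)` into the interior of the cells by gnomonic charts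
(`exists_gnomonic_chart`, `eventually_exists_isAlmostUniform`). The error tends to zero along a
diagonal choice (`exists_hasDensity`).
-/

noncomputable section

namespace TorusLayer

open scoped Pointwise

/-! ### Counting points of lattices and boxes -/

/-- If translates by lattice vectors of balls of radius `ρ` cover the space, then a set `S`
containing the `ρ`-balls around finitely many lattice points has volume at least the number of
these points times the covolume. -/
lemma card_mul_covolume_le {E : Type*} [NormedAddCommGroup E] [NormedSpace ℝ E]
    [FiniteDimensional ℝ E] [MeasurableSpace E] [BorelSpace E] (μ : Measure E)
    [μ.IsAddHaarMeasure] (Λ : Submodule ℤ E) [DiscreteTopology Λ] [IsZLattice ℝ Λ] {ρ : ℝ}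
    (hρ : ∀ x : E, ∃ l ∈ Λ, ‖x - l‖ ≤ ρ) (Y : Finset E) (hY : ∀ y ∈ Y, y ∈ Λ) {S : Set E}
    (hS : MeasurableSet S) (hYS : ∀ y ∈ Y, Metric.closedBall y ρ ⊆ S) (hfin : μ S ≠ ⊤) :
    (Y.card : ℝ) * ZLattice.covolume Λ μ ≤ μ.real S := by
  classical
  set D := ZSpan.fundamentalDomain ((Module.Free.chooseBasis ℤ Λ).ofZLatticeBasis ℝ)
  have hD : IsAddFundamentalDomain Λ D μ :=
    ZLattice.isAddFundamentalDomain (Module.Free.chooseBasis ℤ Λ) μ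
  rw [ZLattice.covolume_eq_measure_fundamentalDomain Λ μ hD]
  have hinv : VAddInvariantMeasure Λ E μ :=
    (inferInstance : VAddInvariantMeasure Λ.toAddSubgroup E μ)
  have hmv : MeasurableVAdd Λ E := (inferInstance : MeasurableVAdd Λ.toAddSubgroup E)
  have key : (Y.card : ENNReal) * μ D ≤ μ S := by
    have h2 : μ S = ∑' g : Λ, μ ((g +ᵥ S) ∩ D) := hD.measure_eq_tsum S
    have h3 : ∀ g : Λ, μ ((g +ᵥ S) ∩ D) = ∫⁻ x in D, (g +ᵥ S).indicator 1 x ∂μ := by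
      intro g
      rw [lintegral_indicator_one (hS.const_vadd _), Measure.restrict_apply (hS.const_vadd _)]
    rw [h2]
    simp_rw [h3]
    -- every point `x` lies in at least `|Y|` lattice translates of `S`
    rw [← lintegral_tsum]
    · calc (Y.card : ENNReal) * μ D = ∫⁻ _ in D, (Y.card : ENNReal) ∂μ := by simp
        _ ≤ _ := by
          refine lintegral_mono fun x => ?_
          obtain ⟨l, hl, hxl⟩ := hρ x
          let T : Finset Λ :=
            Y.attach.image fun y : Y => (⟨l - y.1, Λ.sub_mem hl (hY y.1 y.2)⟩ : Λ)
          have hT : T.card = Y.card := by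
            rw [Finset.card_image_of_injective, Finset.card_attach]
            intro a b hab
            exact Subtype.ext (sub_right_injective (congrArg Subtype.val hab))
          calc (Y.card : ENNReal) = ∑ g ∈ T, 1 := by simp [hT]
            _ = ∑ g ∈ T, (g +ᵥ S).indicator (1 : E → ENNReal) x := by
              refine Finset.sum_congr rfl fun g hg => ?_
              obtain ⟨y, -, rfl⟩ := Finset.mem_image.1 hg
              rw [indicator_of_mem]
              · rfl
              rw [Set.mem_vadd_set_iff_neg_vadd_mem]
              apply hYS y.1 y.2
              rw [Submodule.vadd_def, vadd_eq_add, Metric.mem_closedBall, dist_eq_norm]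
              convert! hxl using 2
              simp only [Submodule.coe_neg, neg_sub]
              abel
            _ ≤ _ := ENNReal.sum_le_tsum T
    · intro g
      exact (measurable_one.indicator (hS.const_vadd _)).aemeasurable
  have := ENNReal.toReal_mono hfin key
  simpa [measureReal_def, ENNReal.toReal_mul] using this

/-- If the translates of `Y + D` by the vectors of a countable group `G` cover the space, then a
fundamental domain of `G` has measure at most `|Y|` times the measure of `D`. -/
lemma measure_fundamentalDomain_le_card_mul {E G : Type*} [AddCommGroup E] [MeasurableSpace E]
    (μ : Measure E) [AddGroup G] [Countable G] [AddAction G E] [MeasurableSpace G]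
    [MeasurableVAdd G E] [VAddInvariantMeasure G E μ] [VAddInvariantMeasure E E μ] {P : Set E}
    (hP : IsAddFundamentalDomain G P μ) (Y : Finset E) (D : Set E)
    (hcov : ∀ z : E, ∃ g : G, ∃ y ∈ Y, ∃ x ∈ D, g +ᵥ (y + x) = z) :
    μ P ≤ Y.card * μ D := by
  have h1 : P ⊆ ⋃ y ∈ Y, ⋃ g : G, (g +ᵥ (y +ᵥ D)) ∩ P := by
    intro z hz
    obtain ⟨g, y, hy, x, hx, h⟩ := hcov z
    simp only [mem_iUnion]
    exact ⟨y, hy, g, h ▸ vadd_mem_vadd_set (vadd_mem_vadd_set hx), hz⟩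
  calc μ P ≤ ∑ y ∈ Y, μ (⋃ g : G, (g +ᵥ (y +ᵥ D)) ∩ P) :=
        (measure_mono h1).trans (measure_biUnion_finset_le _ _)
    _ ≤ ∑ y ∈ Y, ∑' g : G, μ ((g +ᵥ (y +ᵥ D)) ∩ P) :=
        Finset.sum_le_sum fun y _ => measure_iUnion_le _
    _ = ∑ y ∈ Y, μ D := by
        refine Finset.sum_congr rfl fun y _ => ?_
        rw [← hP.measure_eq_tsum, measure_vadd]
    _ = _ := by simp

/-- Counting by grid cells: a set contained in a box and having at most one point in each cell of
a grid has at most as many points as there are cells. -/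
lemma finite_and_ncard_le_prod {L : ℕ} (Y : Set (EuclideanSpace ℝ (Fin L))) (a l g : Fin L → ℝ)
    (hg : ∀ i, 0 < g i) (hl : ∀ i, 0 ≤ l i) (hY : ∀ y ∈ Y, ∀ i, a i ≤ y i ∧ y i ≤ a i + l i)
    (hinj : ∀ x ∈ Y, ∀ y ∈ Y, (∀ i, |x i - y i| < g i) → x = y) :
    Y.Finite ∧ (Y.ncard : ℝ) ≤ ∏ i, (l i / g i + 1) := by
  classical
  let T : Finset (Fin L → ℕ) := Fintype.piFinset fun i => Finset.range (⌊l i / g i⌋₊ + 1)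
  let F : EuclideanSpace ℝ (Fin L) → (Fin L → ℕ) := fun y i => ⌊(y i - a i) / g i⌋₊
  have hmaps : ∀ y ∈ Y, F y ∈ (T : Set (Fin L → ℕ)) := by
    intro y hy
    simp only [T, F, Finset.mem_coe, Fintype.mem_piFinset, Finset.mem_range, Nat.lt_succ_iff]
    intro i
    apply Nat.floor_le_floor
    have := hY y hy i
    exact div_le_div_of_nonneg_right (by linarith) (hg i).le
  have hinj' : InjOn F Y := by
    intro x hx y hy hxy
    apply hinj x hx y hy
    intro i
    have h := congrFun hxy i
    simp only [F] at h
    have hx0 : 0 ≤ (x i - a i) / g i := div_nonneg (by linarith [(hY x hx i).1]) (hg i).le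
    have hy0 : 0 ≤ (y i - a i) / g i := div_nonneg (by linarith [(hY y hy i).1]) (hg i).le
    have h1 := Nat.floor_le hx0
    have h2 := Nat.lt_floor_add_one ((x i - a i) / g i)
    have h3 := Nat.floor_le hy0
    have h4 := Nat.lt_floor_add_one ((y i - a i) / g i)
    rw [h] at h1 h2
    have h5 : |(x i - a i) / g i - (y i - a i) / g i| < 1 := by
      rw [abs_lt]; constructor <;> linarith
    rw [← sub_div, abs_div, abs_of_pos (hg i), div_lt_one (hg i)] at h5
    simpa using h5
  have hfin : Y.Finite := Set.Finite.of_injOn hmaps hinj' T.finite_toSet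
  refine ⟨hfin, ?_⟩
  have h1 : Y.ncard ≤ (T : Set (Fin L → ℕ)).ncard :=
    ncard_le_ncard_of_injOn F hmaps hinj' T.finite_toSet
  rw [ncard_coe_finset] at h1
  calc (Y.ncard : ℝ) ≤ (T.card : ℝ) := by exact_mod_cast h1
    _ = ∏ i, ((⌊l i / g i⌋₊ : ℝ) + 1) := by simp [T, Fintype.card_piFinset]
    _ ≤ _ := by
      refine Finset.prod_le_prod (fun i _ => by positivity) fun i _ => ?_
      gcongr
      exact Nat.floor_le (div_nonneg (hl i) (hg i).le)

/-! ### The torus map -/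

/-- Distances on the torus are chords `2 c_i |sin ((x_i - y_i) / (2 c_i))|`; the coordinates with
`c_i = 0` contribute `0` on both sides. -/
lemma torusMap_dist_sq {L : ℕ} (c x y : EuclideanSpace ℝ (Fin L)) :
    dist (torusMap c x) (torusMap c y) ^ 2 =
      ∑ i, 4 * c i ^ 2 * Real.sin ((x i - y i) / (2 * c i)) ^ 2 := by
  rw [EuclideanSpace.dist_eq, Real.sq_sqrt (Finset.sum_nonneg fun _ _ => sq_nonneg _),
    Fintype.sum_prod_type]
  refine Finset.sum_congr rfl fun i _ => ?_
  simp only [torusMap, Fin.sum_univ_two, Real.dist_eq, sq_abs]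
  simp only [if_true, Fin.one_eq_zero_iff, if_false, OfNat.ofNat_ne_one]
  have h : (x i - y i) / (2 * c i) = (x i / c i - y i / c i) / 2 := by
    rcases eq_or_ne (c i) 0 with h | h
    · simp [h]
    · field_simp
  rw [h]
  set a := x i / c i
  set b := y i / c i
  have h2 := Real.cos_sq' ((a - b) / 2)
  have h3 := Real.cos_sq ((a - b) / 2)
  rw [mul_div_cancel₀ _ two_ne_zero, Real.cos_sub] at h3
  have h5 := Real.sin_sq_add_cos_sq a
  have h6 := Real.sin_sq_add_cos_sq b
  have : Real.sin ((a - b) / 2) ^ 2 = 1 / 2 -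
      (Real.cos a * Real.cos b + Real.sin a * Real.sin b) / 2 := by linarith
  rw [this]
  simp
  linear_combination (c i) ^ 2 * h5 + (c i) ^ 2 * h6

lemma torusMap_dist_le {L : ℕ} (c x y : EuclideanSpace ℝ (Fin L)) :
    dist (torusMap c x) (torusMap c y) ≤ dist x y := by
  rw [← sq_le_sq₀ dist_nonneg dist_nonneg, torusMap_dist_sq, EuclideanSpace.dist_eq,
    Real.sq_sqrt (Finset.sum_nonneg fun _ _ => sq_nonneg _)]
  refine Finset.sum_le_sum fun i _ => ?_
  rw [Real.dist_eq, sq_abs]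
  rcases eq_or_ne (c i) 0 with h | h
  · rw [h]; simpa using sq_nonneg _
  · have h1 := sq_le_sq.2 (by simpa using Real.abs_sin_le_abs (x := (x i - y i) / (2 * c i)))
    calc 4 * c i ^ 2 * Real.sin ((x i - y i) / (2 * c i)) ^ 2
        ≤ 4 * c i ^ 2 * ((x i - y i) / (2 * c i)) ^ 2 := by gcongr
      _ = _ := by field_simp; ring

/-! ### Upper bound for the number of points of a layer -/

lemma euclidean_norm_le_sum {ι : Type*} [Fintype ι] (x : EuclideanSpace ℝ ι) :
    ‖x‖ ≤ ∑ i, |x i| := by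
  rw [EuclideanSpace.norm_eq, Real.sqrt_le_left (Finset.sum_nonneg fun _ _ => abs_nonneg _)]
  simp only [Real.norm_eq_abs]
  exact Finset.sum_sq_le_sq_sum_of_nonneg fun _ _ => abs_nonneg _

lemma euclidean_abs_le_norm {ι : Type*} [Fintype ι] (x : EuclideanSpace ℝ ι) (i : ι) :
    |x i| ≤ ‖x‖ := by
  simpa using PiLp.norm_apply_le x i

lemma euclidean_volume_Icc {ι : Type*} [Fintype ι] (a b : ι → ℝ) :
    volume {x : EuclideanSpace ℝ ι | ∀ i, a i ≤ x i ∧ x i ≤ b i} =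
      ∏ i, ENNReal.ofReal (b i - a i) := by
  have h := (EuclideanSpace.volume_preserving_symm_measurableEquiv_toLp ι).measure_preimage
    (measurableSet_Icc (a := a) (b := b)).nullMeasurableSet
  rw [Real.volume_Icc_pi] at h
  rw [← h]
  congr 1
  ext x
  simp [Pi.le_def, forall_and]

/-- Enlarging bounded factors by `h ≤ 1` enlarges a product by `O(h)`. -/
lemma prod_add_le {ι : Type*} (s : Finset ι) (a : ι → ℝ) {A h : ℝ} (ha : ∀ i, 0 ≤ a i)
    (hA : ∀ i, a i ≤ A) (hA0 : 0 ≤ A) (h0 : 0 ≤ h) (h1 : h ≤ 1) :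
    ∏ i ∈ s, (a i + h) ≤ ∏ i ∈ s, a i + h * (s.card * (A + 1) ^ s.card) := by
  classical
  induction s using Finset.induction_on with
  | empty => simp
  | insert i s hi ih =>
    rw [Finset.prod_insert hi, Finset.prod_insert hi, Finset.card_insert_of_notMem hi]
    have hP : ∏ j ∈ s, (a j + h) ≤ (A + 1) ^ s.card := by
      rw [← Finset.prod_const]
      exact Finset.prod_le_prod (fun j _ => by linarith [ha j]) fun j _ => by linarith [hA j]
    have hB : (0 : ℝ) ≤ (A + 1) ^ s.card := by positivity
    have e1 := mul_le_mul_of_nonneg_left ih (ha i)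
    have e2 := mul_le_mul_of_nonneg_left hP h0
    have e3 : a i * (h * (s.card * (A + 1) ^ s.card)) ≤ A * (h * (s.card * (A + 1) ^ s.card)) :=
      mul_le_mul_of_nonneg_right (hA i) (by positivity)
    have e4 : 0 ≤ h * (s.card * (A + 1) ^ s.card) := by positivity
    have e5 : 0 ≤ h * (A * (A + 1) ^ s.card) := by positivity
    push_cast
    rw [pow_succ]
    nlinarith

/-- A product of bounded factors is small if one of them is small. -/
lemma prod_le_mul_pow {L : ℕ} (f : Fin L → ℝ) (i : Fin L) {A K : ℝ} (hf : ∀ j, 0 ≤ f j)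
    (hi : f i ≤ A) (hK : ∀ j, j ≠ i → f j ≤ K) (hK1 : 1 ≤ K) : ∏ j, f j ≤ A * K ^ L := by
  classical
  have hA : 0 ≤ A := (hf i).trans hi
  rw [← Finset.mul_prod_erase _ _ (Finset.mem_univ i)]
  refine mul_le_mul hi ?_ (Finset.prod_nonneg fun j _ => hf j) hA
  calc ∏ j ∈ Finset.univ.erase i, f j ≤ ∏ j ∈ Finset.univ.erase i, K :=
        Finset.prod_le_prod (fun j _ => hf j) fun j hj => hK j (Finset.ne_of_mem_erase hj)
    _ = K ^ (Finset.univ.erase i).card := by simp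
    _ ≤ K ^ L := pow_le_pow_right₀ hK1 (by simp)

lemma ballVol_pos (n : ℕ) : 0 < ballVol n :=
  div_pos (Real.rpow_pos_of_pos Real.pi_pos _) (Real.Gamma_pos_of_pos (by positivity))

lemma minDist_le {ι : Type*} [Fintype ι] (Λ : Submodule ℤ (EuclideanSpace ℝ ι))
    {x : EuclideanSpace ℝ ι} (hx : x ∈ Λ) (h0 : x ≠ 0) : minDist Λ ≤ ‖x‖ :=
  csInf_le ⟨0, by rintro r ⟨x, -, -, rfl⟩; exact norm_nonneg _⟩ ⟨x, hx, h0, rfl⟩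

lemma exists_ne_zero_mem {ι : Type*} [Fintype ι] [Nonempty ι]
    (Λ : Submodule ℤ (EuclideanSpace ℝ ι)) [DiscreteTopology Λ] [IsZLattice ℝ Λ] :
    ∃ x ∈ Λ, x ≠ 0 := by
  by_contra! h
  have h1 : (Λ : Set (EuclideanSpace ℝ ι)) ⊆ {0} := fun x hx => h x hx
  have h2 := Submodule.span_mono (R := ℝ) h1
  rw [IsZLattice.span_top, Submodule.span_zero_singleton, top_le_iff] at h2
  exact bot_ne_top h2

/-- A lattice of minimum distance at least `d` has covolume at least that of the densest lattice
scaled to minimum distance `d`. -/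
lemma covolume_ge_of_isDensest {ι : Type*} [Fintype ι] [Nonempty ι]
    (Λ : Submodule ℤ (EuclideanSpace ℝ ι)) [DiscreteTopology Λ] [IsZLattice ℝ Λ]
    (hΛ : IsDensest Λ) (h2 : minDist Λ = 2) (Λ' : Submodule ℤ (EuclideanSpace ℝ ι))
    [hd' : DiscreteTopology Λ'] [hz : IsZLattice ℝ Λ'] {d : ℝ} (hd : 0 ≤ d)
    (hmin : ∀ x ∈ Λ', x ≠ 0 → d ≤ ‖x‖) :
    (d / 2) ^ Fintype.card ι * ZLattice.covolume Λ ≤ ZLattice.covolume Λ' := by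
  have h := hΛ Λ' hd' hz
  have h1 : d ≤ minDist Λ' := by
    obtain ⟨x, hx, h0⟩ := exists_ne_zero_mem Λ'
    refine le_csInf ⟨_, x, hx, h0, rfl⟩ ?_
    rintro r ⟨x, hx, h0, rfl⟩
    exact hmin x hx h0
  rw [latticeDensity, latticeDensity, h2, div_le_div_iff₀ (ZLattice.covolume_pos Λ' _)
    (ZLattice.covolume_pos Λ _)] at h
  have hb := ballVol_pos (Fintype.card ι)
  simp only [ne_eq, OfNat.ofNat_ne_zero, not_false_eq_true, div_self, one_pow, mul_one] at h
  rw [mul_assoc] at h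
  have h3 := le_of_mul_le_mul_left h hb
  refine le_trans ?_ h3
  have := (ZLattice.covolume_pos Λ volume).le
  gcongr

lemma eventually_mul_lt (k : ℝ) {η : ℝ} (hη : 0 < η) : ∀ᶠ d in 𝓝[>] (0 : ℝ), d * k < η := by
  have h : Tendsto (fun d : ℝ => d * k) (𝓝 0) (𝓝 (0 * k)) :=
    (continuous_id.mul continuous_const).tendsto 0
  rw [zero_mul] at h
  exact (h.mono_left nhdsWithin_le_nhds).eventually_lt_const hη

section Layer

variable {L : ℕ} {d : ℝ} {c : EuclideanSpace ℝ (Fin L)} {Y : Set (EuclideanSpace ℝ (Fin L))}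

lemma coord_le_one (hc : ‖c‖ = 1) (i : Fin L) : c i ≤ 1 :=
  (le_abs_self _).trans (hc ▸ euclidean_abs_le_norm c i)

lemma IsLatticeLayer.subset_box (hY : IsLatticeLayer d c Y) : Y ⊆ torusBox c := by
  obtain ⟨⟨Λ, _, _, rfl⟩, _⟩ := hY
  exact inter_subset_right

lemma mem_torusBox_bounds (hc0 : ∀ i, 0 ≤ c i) {u : EuclideanSpace ℝ (Fin L)}
    (hu : u ∈ torusBox c) (i : Fin L) : 0 ≤ u i ∧ u i ≤ 2 * Real.pi * c i := by
  have := mul_nonneg (mul_nonneg zero_le_two Real.pi_pos.le) (hc0 i)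
  rcases hu i with h | ⟨h, h'⟩
  · exact ⟨h.1, h.2.le⟩
  · rw [h']; exact ⟨le_rfl, this⟩

lemma IsLatticeLayer.le_norm_sub (hY : IsLatticeLayer d c Y) {x y : EuclideanSpace ℝ (Fin L)}
    (hx : x ∈ Y) (hy : y ∈ Y) (hne : x ≠ y) : d ≤ ‖x - y‖ := by
  rw [← dist_eq_norm]
  exact (hY.2 hx hy hne).trans (torusMap_dist_le c x y)

lemma IsLatticeLayer.eq_of_abs_sub_lt (hY : IsLatticeLayer d c Y) (hd : 0 < d) (hL : 0 < L)
    {x y : EuclideanSpace ℝ (Fin L)} (hx : x ∈ Y) (hy : y ∈ Y)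
    (h : ∀ i, |x i - y i| < d / (2 * L)) : x = y := by
  by_contra hne
  have h1 := hY.le_norm_sub hx hy hne
  have h2 := euclidean_norm_le_sum (x - y)
  have h3 : ∑ i, |(x - y) i| ≤ ∑ _i : Fin L, d / (2 * L) :=
    Finset.sum_le_sum fun i _ => (by simpa using (h i).le)
  have hL' : (0 : ℝ) < L := by exact_mod_cast hL
  have h4 : ∑ _i : Fin L, d / (2 * L) = d / 2 := by
    simp; field_simp
  linarith

/-- The crude bound `O(d^(-L))` on a layer, uniform in the torus and in the lattice. -/
lemma IsLatticeLayer.finite_and_ncard_le (hY : IsLatticeLayer d c Y) (hd : 0 < d) (hL : 0 < L)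
    (hc : ‖c‖ = 1) (hc0 : ∀ i, 0 ≤ c i) :
    Y.Finite ∧ (Y.ncard : ℝ) ≤ (2 * Real.pi / (d / (2 * L)) + 1) ^ L := by
  have hL' : (0 : ℝ) < L := by exact_mod_cast hL
  have := finite_and_ncard_le_prod Y 0 (fun _ => 2 * Real.pi) (fun _ => d / (2 * L))
    (fun i => by positivity) (fun i => by positivity) (fun y hy i => ?_)
    (fun x hx y hy h => hY.eq_of_abs_sub_lt hd hL hx hy h)
  · simpa using this
  · have h1 := mem_torusBox_bounds hc0 (hY.subset_box hy) i
    have h2 := coord_le_one hc i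
    have h3 := mul_le_mul_of_nonneg_left h2 (mul_nonneg zero_le_two Real.pi_pos.le)
    simp only [Pi.zero_apply, zero_add]
    exact ⟨h1.1, by linarith⟩

/-- If the lattice of a layer has a nonzero vector shorter than `d`, then all points of the layer
are close to the boundary of the box, and there are only `O(d^(1-L))` of them. -/
lemma layer_bound_of_short_vector (hd : 0 < d) (hd1 : d ≤ 1) (hL : 0 < L)
    (hc : ‖c‖ = 1) (hc0 : ∀ i, 0 ≤ c i) (Λ : Submodule ℤ (EuclideanSpace ℝ (Fin L)))
    (hYΛ : Y = (Λ : Set (EuclideanSpace ℝ (Fin L))) ∩ torusBox c) (hY : IsLatticeLayer d c Y)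
    {v : EuclideanSpace ℝ (Fin L)} (hv : v ∈ Λ) (hv0 : v ≠ 0) (hvd : ‖v‖ < d) :
    d ^ L * Y.ncard ≤ d * (2 * L * ((2 * L + 1) * (4 * Real.pi * L + 1) ^ L)) := by
  have hL' : (0 : ℝ) < L := by exact_mod_cast hL
  -- a point `x` away from the boundary would have `x + v` as a neighbour closer than `d`
  have hcoord : ∀ x ∈ Y, ∃ i, x i ≤ d ∨ 2 * Real.pi * c i - d ≤ x i := by
    intro x hx
    by_contra! hcon
    have hxΛ : x ∈ Λ := by rw [hYΛ] at hx; exact hx.1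
    have hxv : x + v ∈ Y := by
      rw [hYΛ]
      refine ⟨Λ.add_mem hxΛ hv, fun i => ?_⟩
      have hvi := abs_lt.1 ((euclidean_abs_le_norm v i).trans_lt hvd)
      have := hcon i
      left
      rw [PiLp.add_apply]
      constructor <;> linarith
    have h := hY.le_norm_sub hxv hx (by simpa using hv0)
    rw [add_sub_cancel_left] at h
    linarith
  have hfin := (hY.finite_and_ncard_le hd hL hc hc0).1
  -- the points in the slabs of thickness `d` along the `2 L` faces are counted separately
  let lo : Fin L → Bool → Fin L → ℝ := fun i b =>
    Function.update 0 i (if b then 0 else 2 * Real.pi * c i - d)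
  let Z : Fin L × Bool → Set (EuclideanSpace ℝ (Fin L)) := fun p =>
    {x ∈ Y | if p.2 then x p.1 ≤ d else 2 * Real.pi * c p.1 - d ≤ x p.1}
  have hcover : Y ⊆ ⋃ p ∈ (Finset.univ : Finset (Fin L × Bool)), Z p := by
    intro x hx
    obtain ⟨i, h | h⟩ := hcoord x hx
    · simp only [Finset.mem_univ, iUnion_true, mem_iUnion]
      exact ⟨(i, true), hx, by simpa using h⟩
    · simp only [Finset.mem_univ, iUnion_true, mem_iUnion]
      exact ⟨(i, false), hx, by simpa using h⟩
  have hZ : ∀ p, d ^ L * (Z p).ncard ≤ d * ((2 * L + 1) * (4 * Real.pi * L + 1) ^ L) := by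
    rintro ⟨i, b⟩
    have h := (finite_and_ncard_le_prod (Z (i, b)) (lo i b)
      (Function.update (fun _ => 2 * Real.pi) i d) (fun _ => d / (2 * L))
      (fun i => by positivity) (fun j => ?_) (fun y hy j => ?_)
      (fun x hx y hy h => hY.eq_of_abs_sub_lt hd hL hx.1 hy.1 h)).2
    · calc d ^ L * ((Z (i, b)).ncard : ℝ) ≤ d ^ L * _ :=
          mul_le_mul_of_nonneg_left h (by positivity)
        _ = ∏ j, (d * ((Function.update (fun _ => 2 * Real.pi) i d : Fin L → ℝ) j /
            (d / (2 * L)) + 1)) := by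
          rw [Finset.prod_mul_distrib]; simp
        _ ≤ (d * (2 * L + 1)) * (4 * Real.pi * L + 1) ^ L := by
          refine prod_le_mul_pow _ i (fun j => ?_) ?_ (fun j hj => ?_) ?_
          · rcases eq_or_ne j i with rfl | hj
            · simp; positivity
            · simp [hj]; positivity
          · simp only [Function.update_self]
            apply le_of_eq
            field_simp
          · simp only [Function.update_of_ne hj]
            have : d * (2 * Real.pi / (d / (2 * L)) + 1) = 4 * Real.pi * L + d := by
              field_simp; ring
            rw [this]; linarith
          · have := Real.pi_pos
            have : 0 < 4 * Real.pi * L := by positivity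
            linarith
        _ = _ := by ring
    · rcases eq_or_ne j i with rfl | hj
      · simp [hd.le]
      · simp [hj, Real.pi_pos.le]
    · have h1 := mem_torusBox_bounds hc0 (hY.subset_box hy.1) j
      have h2 := coord_le_one hc j
      have h3 := mul_le_mul_of_nonneg_left h2 (mul_nonneg zero_le_two Real.pi_pos.le)
      rcases eq_or_ne j i with rfl | hj
      · have h4 := hy.2
        cases b <;> simp [lo] at h4 ⊢ <;> constructor <;> linarith
      · simp [lo, hj]; constructor <;> linarith
  have h1 : (Y.ncard : ℝ) ≤ ∑ p : Fin L × Bool, ((Z p).ncard : ℝ) := by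
    have : Y.ncard ≤ ∑ p : Fin L × Bool, (Z p).ncard :=
      (ncard_le_ncard hcover (Set.Finite.biUnion (Finset.finite_toSet _)
        fun p _ => hfin.subset fun x hx => hx.1)).trans (Finset.set_ncard_biUnion_le _ _)
    exact_mod_cast this
  calc d ^ L * (Y.ncard : ℝ) ≤ d ^ L * ∑ p : Fin L × Bool, ((Z p).ncard : ℝ) := by gcongr
    _ = ∑ p : Fin L × Bool, d ^ L * ((Z p).ncard : ℝ) := Finset.mul_sum _ _ _
    _ ≤ ∑ p : Fin L × Bool, d * ((2 * L + 1) * (4 * Real.pi * L + 1) ^ L) :=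
        Finset.sum_le_sum fun p _ => hZ p
    _ = _ := by simp; ring

/-- If the lattice of a layer contains a basis of short vectors, then the number of points of the
layer is at most the volume of a slightly larger box divided by the covolume. -/
lemma layer_bound_of_short_basis (hd : 0 < d) {h : ℝ} (hL : 0 < L) (hc : ‖c‖ = 1)
    (hc0 : ∀ i, 0 ≤ c i) (Λ : Submodule ℤ (EuclideanSpace ℝ (Fin L))) [DiscreteTopology Λ]
    [IsZLattice ℝ Λ]
    (hYΛ : Y = (Λ : Set (EuclideanSpace ℝ (Fin L))) ∩ torusBox c) (hY : IsLatticeLayer d c Y)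
    (b : Module.Basis (Fin L) ℝ (EuclideanSpace ℝ (Fin L))) (hb : ∀ i, b i ∈ Λ)
    (hbn : ∀ i, ‖b i‖ ≤ h) :
    Y.ncard * ZLattice.covolume Λ ≤ ∏ i, (2 * Real.pi * c i + 2 * (L * h)) := by
  have hfin := (hY.finite_and_ncard_le hd hL hc hc0).1
  have h0 : 0 ≤ h := (norm_nonneg _).trans (hbn ⟨0, hL⟩)
  -- a translate of the fundamental parallelepiped of `b` has radius at most `L h`, so the box is
  -- enlarged by this much on each side
  set S : Set (EuclideanSpace ℝ (Fin L)) :=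
    {x | ∀ i, -(L * h) ≤ x i ∧ x i ≤ 2 * Real.pi * c i + L * h}
  have hvol : volume S = ENNReal.ofReal (∏ i, (2 * Real.pi * c i + 2 * (L * h))) := by
    rw [euclidean_volume_Icc, ENNReal.ofReal_prod_of_nonneg]
    · exact Finset.prod_congr rfl fun i _ => by congr 1; ring
    · intro i _
      have := hc0 i
      positivity
  have hclosed : IsClosed S := by
    have : S = ⋂ i, {x | -(L * h) ≤ x i} ∩ {x | x i ≤ 2 * Real.pi * c i + L * h} := by
      ext x; simp [S]
    rw [this]
    exact isClosed_iInter fun i => (isClosed_le (by fun_prop) (by fun_prop)).inter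
      (isClosed_le (by fun_prop) (by fun_prop))
  have key := card_mul_covolume_le volume Λ (ρ := L * h) (fun x => ?_) hfin.toFinset
    (fun y hy => ?_) hclosed.measurableSet (fun y hy x hx i => ?_) ?_
  · rw [measureReal_def, hvol, ENNReal.toReal_ofReal, ← ncard_eq_toFinset_card _ hfin] at key
    · exact key
    · refine Finset.prod_nonneg fun i _ => ?_
      have := hc0 i
      positivity
  · refine ⟨ZSpan.floor b x, ?_, ?_⟩
    · have : Submodule.span ℤ (Set.range b) ≤ Λ :=
        Submodule.span_le.2 (by rintro _ ⟨i, rfl⟩; exact hb i)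
      exact this (ZSpan.floor b x).2
    · calc ‖x - ZSpan.floor b x‖ = ‖ZSpan.fract b x‖ := rfl
        _ ≤ ∑ i, ‖b i‖ := ZSpan.norm_fract_le b x
        _ ≤ ∑ _i : Fin L, h := Finset.sum_le_sum fun i _ => hbn i
        _ = L * h := by simp
  · rw [Finite.mem_toFinset, hYΛ] at hy
    exact hy.1
  · rw [Finite.mem_toFinset] at hy
    have h1 := mem_torusBox_bounds hc0 (hY.subset_box hy) i
    rw [Metric.mem_closedBall, dist_eq_norm] at hx
    have h2 := abs_le.1 ((euclidean_abs_le_norm (x - y) i).trans hx)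
    rw [PiLp.sub_apply] at h2
    constructor <;> linarith
  · rw [hvol]; exact ENNReal.ofReal_ne_top

/-- If all lattice vectors of norm at most `R d` lie in a hyperplane, then the layer has few
points: along the coordinate axis that is most transversal to the hyperplane, points that agree
up to `O(d)` in the other coordinates are at distance at least `R d / 2`. -/
lemma layer_bound_of_hyperplane (hd : 0 < d) (hd1 : d ≤ 1) {R : ℝ} (hR : 1 ≤ R) (hL : 0 < L)
    (hc : ‖c‖ = 1) (hc0 : ∀ i, 0 ≤ c i) (Λ : Submodule ℤ (EuclideanSpace ℝ (Fin L)))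
    (hYΛ : Y = (Λ : Set (EuclideanSpace ℝ (Fin L))) ∩ torusBox c) (hY : IsLatticeLayer d c Y)
    {n : EuclideanSpace ℝ (Fin L)} (hn : n ≠ 0)
    (hhyp : ∀ v ∈ Λ, ‖v‖ ≤ R * d → ∑ i, n i * v i = 0) :
    d ^ L * Y.ncard ≤ (4 * Real.pi / R + d) * (4 * Real.pi * L + 1) ^ L := by
  have hL' : (0 : ℝ) < L := by exact_mod_cast hL
  have hne : Nonempty (Fin L) := ⟨⟨0, hL⟩⟩
  obtain ⟨i, -, hi⟩ := Finset.exists_max_image Finset.univ (fun i => |n i|) Finset.univ_nonempty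
  have hni : 0 < |n i| := by
    by_contra hcon
    apply hn
    ext j
    have h1 := hi j (Finset.mem_univ j)
    have h2 := abs_nonneg (n j)
    simpa using abs_eq_zero.1 (le_antisymm (by linarith) h2)
  -- grid cells that are long in the transversal direction `i` still contain at most one point
  let g : Fin L → ℝ := Function.update (fun _ => d / (2 * L)) i (R * d / 2)
  have hg : ∀ j, 0 < g j := by
    intro j
    rcases eq_or_ne j i with rfl | hj
    · simp [g]; positivity
    · simp [g, hj]; positivity
  have key := (finite_and_ncard_le_prod Y 0 (fun _ => 2 * Real.pi) g hg
    (fun i => by positivity) (fun y hy j => ?_) (fun x hx y hy hxy => ?_)).2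
  · calc d ^ L * (Y.ncard : ℝ) ≤ d ^ L * _ := mul_le_mul_of_nonneg_left key (by positivity)
      _ = ∏ j, (d * (2 * Real.pi / g j + 1)) := by
          rw [Finset.prod_mul_distrib]; simp
      _ ≤ _ := by
        refine prod_le_mul_pow _ i (fun j => ?_) ?_ (fun j hj => ?_) ?_
        · have := hg j; positivity
        · simp only [g, Function.update_self]
          apply le_of_eq
          field_simp
          ring
        · simp only [g, Function.update_of_ne hj]
          have : d * (2 * Real.pi / (d / (2 * L)) + 1) = 4 * Real.pi * L + d := by
            field_simp; ring
          rw [this]; linarith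
        · have := Real.pi_pos
          have : 0 < 4 * Real.pi * L := by positivity
          linarith
  · have h1 := mem_torusBox_bounds hc0 (hY.subset_box hy) j
    have h2 := coord_le_one hc j
    have h3 := mul_le_mul_of_nonneg_left h2 (mul_nonneg zero_le_two Real.pi_pos.le)
    simp only [Pi.zero_apply, zero_add]
    exact ⟨h1.1, by linarith⟩
  · have hother : ∀ j ∈ Finset.univ.erase i, |(x - y) j| ≤ d / (2 * L) := by
      intro j hj
      have := hxy j
      simp only [g, Function.update_of_ne (Finset.ne_of_mem_erase hj)] at this
      simpa using this.le
    have hcard : ((Finset.univ.erase i).card : ℝ) = L - 1 := by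
      rw [Finset.card_erase_of_mem (Finset.mem_univ i), Finset.card_univ, Fintype.card_fin,
        Nat.cast_sub hL]; simp
    have hsum : ∑ j ∈ Finset.univ.erase i, |(x - y) j| ≤ (L - 1) * (d / (2 * L)) := by
      refine (Finset.sum_le_sum hother).trans (le_of_eq ?_)
      simp only [Finset.sum_const, nsmul_eq_mul, hcard]
    have hid : (L - 1) * (d / (2 * L)) = d / 2 - d / (2 * L) := by field_simp
    have hdL : 0 < d / (2 * L) := by positivity
    have hxi : |(x - y) i| < R * d / 2 := by simpa [g] using hxy i
    have hnorm := euclidean_norm_le_sum (x - y)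
    rw [← Finset.add_sum_erase _ _ (Finset.mem_univ i)] at hnorm
    have hRd : d ≤ R * d := by nlinarith
    have hz := hhyp (x - y) (by
      rw [hYΛ] at hx hy; exact Λ.sub_mem hx.1 hy.1) (by linarith)
    rw [← Finset.add_sum_erase _ _ (Finset.mem_univ i)] at hz
    have h1 : |n i| * |(x - y) i| ≤ |n i| * ((L - 1) * (d / (2 * L))) := by
      calc |n i| * |(x - y) i| = |∑ j ∈ Finset.univ.erase i, n j * (x - y) j| := by
            rw [← abs_mul, eq_neg_of_add_eq_zero_left hz, abs_neg]
        _ ≤ ∑ j ∈ Finset.univ.erase i, |n i| * |(x - y) j| := by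
            refine (Finset.abs_sum_le_sum_abs _ _).trans (Finset.sum_le_sum fun j _ => ?_)
            rw [abs_mul]
            exact mul_le_mul_of_nonneg_right (hi j (Finset.mem_univ j)) (abs_nonneg _)
        _ ≤ _ := by
            rw [← Finset.mul_sum]
            exact mul_le_mul_of_nonneg_left hsum hni.le
    have h2 := le_of_mul_le_mul_left h1 hni
    by_contra hcon
    have h3 := hY.le_norm_sub hx hy hcon
    linarith

/-- Either the short vectors of a lattice span the space, or they lie in a hyperplane. -/
lemma exists_basis_or_hyperplane (Λ : Submodule ℤ (EuclideanSpace ℝ (Fin L))) (h : ℝ) :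
    (∃ b : Module.Basis (Fin L) ℝ (EuclideanSpace ℝ (Fin L)), (∀ i, b i ∈ Λ) ∧ ∀ i, ‖b i‖ ≤ h) ∨
    ∃ n : EuclideanSpace ℝ (Fin L), n ≠ 0 ∧ ∀ v ∈ Λ, ‖v‖ ≤ h → ∑ i, n i * v i = 0 := by
  let s : Set (EuclideanSpace ℝ (Fin L)) := {v | v ∈ Λ ∧ ‖v‖ ≤ h}
  by_cases hs : Submodule.span ℝ s = ⊤
  · left
    obtain ⟨f, hf, hsp, hli⟩ := Submodule.exists_fun_fin_finrank_span_eq ℝ s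
    have hfr : Module.finrank ℝ (Submodule.span ℝ s) = L := by
      rw [hs, finrank_top, finrank_euclideanSpace_fin]
    let e : Fin L ≃ Fin (Module.finrank ℝ (Submodule.span ℝ s)) := finCongr hfr.symm
    have hli' : LinearIndependent ℝ (f ∘ e) := hli.comp _ e.injective
    refine ⟨Module.Basis.mk hli' ?_, fun i => ?_, fun i => ?_⟩
    · rw [Set.range_comp, e.range_eq_univ, Set.image_univ, hsp, hs]
    · rw [Module.Basis.mk_apply]; exact (hf (e i)).1
    · rw [Module.Basis.mk_apply]; exact (hf (e i)).2
  · right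
    have h1 : (Submodule.span ℝ s)ᗮ ≠ ⊥ := by
      rwa [ne_eq, Submodule.orthogonal_eq_bot_iff]
    obtain ⟨n, hn, hn0⟩ := Submodule.exists_mem_ne_zero_of_ne_bot h1
    refine ⟨n, hn0, fun v hv hvh => ?_⟩
    have h2 := (Submodule.mem_orthogonal _ n).1 hn v (Submodule.subset_span ⟨hv, hvh⟩)
    simpa [PiLp.inner_apply] using h2

/-- Uniformly in the torus `c`, a lattice layer at distance `d → 0` has at most asymptotically
`vol (P_c)` times the number of points per unit volume of the densest lattice. If the lattice of the
layer has short vectors spanning the space and minimum distance at least `d`, this is a volume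
comparison; in all other cases the layer has at most
`ε d^(-L)` points. -/
theorem layer_upper_bound (hL : 0 < L) (Λ : Submodule ℤ (EuclideanSpace ℝ (Fin L)))
    [DiscreteTopology Λ] [IsZLattice ℝ Λ] (hΛ : IsDensest Λ) (h2 : minDist Λ = 2) {ε : ℝ}
    (hε : 0 < ε) : ∀ᶠ d in 𝓝[>] (0 : ℝ), ∀ c : EuclideanSpace ℝ (Fin L), ‖c‖ = 1 →
      (∀ i, 0 ≤ c i) → ∀ Y, IsLatticeLayer d c Y →
      d ^ L * Y.ncard ≤ 2 ^ L / ZLattice.covolume Λ * ∏ i, (2 * Real.pi * c i) + ε := by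
  have hL' : (0 : ℝ) < L := by exact_mod_cast hL
  have hne : Nonempty (Fin L) := ⟨⟨0, hL⟩⟩
  have hpi := Real.pi_pos
  set V := ZLattice.covolume Λ
  have hV : 0 < V := ZLattice.covolume_pos Λ _
  set K : ℝ := (4 * Real.pi * L + 1) ^ L
  have hK : 0 < K := by positivity
  -- lattice vectors are called short if their norm is at most `R d`; this `R` makes the bound of
  -- `layer_bound_of_hyperplane` smaller than `ε`
  set R : ℝ := max 1 (8 * Real.pi * K / ε)
  have hR : 1 ≤ R := le_max_left _ _
  have hRK : 4 * Real.pi / R * K ≤ ε / 2 := by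
    have : 8 * Real.pi * K / ε ≤ R := le_max_right _ _
    rw [div_le_iff₀ hε] at this
    rw [div_mul_eq_mul_div, div_le_iff₀ (by linarith)]
    linarith
  filter_upwards [self_mem_nhdsWithin, eventually_mul_lt 1 one_pos,
    eventually_mul_lt (2 * L * ((2 * L + 1) * K)) hε, eventually_mul_lt K (half_pos hε),
    eventually_mul_lt (2 * (L * R)) one_pos,
    eventually_mul_lt (2 ^ L / V * (2 * (L * R) * (L * (2 * Real.pi + 1) ^ L))) hε]
    with d hd0 hd1 hd2 hd3 hd4 hd5 c hc hc0 Y hY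
  have hd : 0 < d := hd0
  rw [mul_one] at hd1
  have hmain : 0 ≤ 2 ^ L / V * ∏ i, (2 * Real.pi * c i) :=
    mul_nonneg (by positivity) (Finset.prod_nonneg fun i _ => mul_nonneg (by positivity) (hc0 i))
  obtain ⟨Λ', hdisc, hzl, hYΛ⟩ := hY.1
  by_cases hshort : ∃ v ∈ Λ', v ≠ 0 ∧ ‖v‖ < d
  · obtain ⟨v, hv, hv0, hvd⟩ := hshort
    have := layer_bound_of_short_vector hd hd1.le hL hc hc0 Λ' hYΛ hY hv hv0 hvd
    linarith
  push Not at hshort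
  rcases exists_basis_or_hyperplane Λ' (R * d) with ⟨b, hb, hbn⟩ | ⟨n, hn, hhyp⟩
  · have h1 := layer_bound_of_short_basis hd hL hc hc0 Λ' hYΛ hY b hb hbn
    have h3 := covolume_ge_of_isDensest Λ hΛ h2 Λ' hd.le hshort
    rw [Fintype.card_fin] at h3
    have h4 : d ^ L * Y.ncard ≤ 2 ^ L / V * ∏ i, (2 * Real.pi * c i + 2 * (L * (R * d))) := by
      rw [div_mul_eq_mul_div, le_div_iff₀ hV]
      calc d ^ L * Y.ncard * V = 2 ^ L * (Y.ncard * ((d / 2) ^ L * V)) := by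
            rw [div_pow]; field_simp
        _ ≤ 2 ^ L * (Y.ncard * ZLattice.covolume Λ') := by gcongr
        _ ≤ _ := by gcongr
    have h5 := prod_add_le Finset.univ (fun i => 2 * Real.pi * c i) (A := 2 * Real.pi)
      (h := 2 * (L * (R * d)))
      (fun i => mul_nonneg (by positivity) (hc0 i))
      (fun i => by nlinarith [coord_le_one hc i]) (by positivity) (by positivity) (by linarith)
    simp only [Finset.card_univ, Fintype.card_fin] at h5
    have h6 := mul_le_mul_of_nonneg_left h5 (by positivity : 0 ≤ 2 ^ L / V)
    have h7 : 2 ^ L / V * (2 * (L * (R * d)) * (L * (2 * Real.pi + 1) ^ L)) =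
      d * (2 ^ L / V * (2 * (L * R) * (L * (2 * Real.pi + 1) ^ L))) := by ring
    rw [mul_add, h7] at h6
    linarith
  · have := layer_bound_of_hyperplane hd hd1.le hR hL hc hc0 Λ' hYΛ hY hn hhyp
    rw [add_mul] at this
    linarith

end Layer

/-! ### Lower bound for the number of points of a largest layer -/

lemma mul_one_sub_le_abs_sin {t s : ℝ} (h : t ^ 2 ≤ s) : |t| * (1 - s) ≤ |Real.sin t| := by
  have h1 := Real.abs_sub_sin_le t
  have h2 : |t| - |Real.sin t| ≤ |t - Real.sin t| := abs_sub_abs_le_abs_sub _ _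
  have h3 : |t| ^ 3 = |t| * t ^ 2 := by rw [pow_succ', sq_abs]
  have h4 : |t| * t ^ 2 ≤ |t| * s := mul_le_mul_of_nonneg_left h (abs_nonneg t)
  have h5 : 0 ≤ |t| * t ^ 2 := by positivity
  nlinarith

/-- On a torus with radii at least `η`, chords are nearly as long as short flat vectors. -/
lemma le_sum_chord_sq {L : ℕ} {c u : EuclideanSpace ℝ (Fin L)} {η θ d : ℝ} (hη : 0 < η)
    (hθ : 0 < θ) (hd : 0 < d) (hc : ∀ i, η ≤ c i) (hu : ∀ i, |u i| ≤ Real.pi * c i)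
    (hnorm : (1 + θ) * d ≤ ‖u‖) (hsmall : d ≤ 4 / Real.pi * η * √(θ / (1 + θ))) :
    d ^ 2 ≤ ∑ i, 4 * c i ^ 2 * Real.sin (u i / (2 * c i)) ^ 2 := by
  have hpi := Real.pi_pos
  set t0 := √(θ / (1 + θ))
  have ht0 : t0 ^ 2 = θ / (1 + θ) := Real.sq_sqrt (by positivity)
  have ht00 : 0 ≤ t0 := Real.sqrt_nonneg _
  -- either all angles are small and `sin t` is close to `t`, or one chord alone is long enough
  by_cases hall : ∀ i, |u i / (2 * c i)| ≤ t0
  · have h1 : ∀ i, (u i) ^ 2 / (1 + θ) ^ 2 ≤ 4 * c i ^ 2 * Real.sin (u i / (2 * c i)) ^ 2 := by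
      intro i
      have hci : 0 < c i := hη.trans_le (hc i)
      have h2 : (u i / (2 * c i)) ^ 2 ≤ θ / (1 + θ) := by
        rw [← ht0]; exact sq_le_sq' (by linarith [abs_le.1 (hall i)]) (abs_le.1 (hall i)).2
      have h3 := mul_one_sub_le_abs_sin h2
      have h4 : 1 - θ / (1 + θ) = 1 / (1 + θ) := by field_simp; ring
      rw [h4] at h3
      have h5 := pow_le_pow_left₀ (by positivity) h3 2
      rw [mul_pow, sq_abs, sq_abs] at h5
      calc (u i) ^ 2 / (1 + θ) ^ 2
          = 4 * c i ^ 2 * ((u i / (2 * c i)) ^ 2 * (1 / (1 + θ)) ^ 2) := by field_simp; ring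
        _ ≤ _ := by gcongr
    calc d ^ 2 ≤ ‖u‖ ^ 2 / (1 + θ) ^ 2 := by
          rw [le_div_iff₀ (by positivity), ← mul_pow, mul_comm]
          exact pow_le_pow_left₀ (by positivity) hnorm 2
      _ = ∑ i, (u i) ^ 2 / (1 + θ) ^ 2 := by
          rw [EuclideanSpace.norm_sq_eq, Finset.sum_div]; simp
      _ ≤ _ := Finset.sum_le_sum fun i _ => h1 i
  · push Not at hall
    obtain ⟨i, hi⟩ := hall
    have hci : 0 < c i := hη.trans_le (hc i)
    have h1 : |u i / (2 * c i)| ≤ Real.pi / 2 := by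
      rw [abs_div, abs_of_pos (by positivity : 0 < 2 * c i), div_le_iff₀ (by positivity)]
      linarith [hu i]
    have h2 := Real.mul_abs_le_abs_sin h1
    have h3 : d ≤ 2 * c i * |Real.sin (u i / (2 * c i))| := by
      calc d ≤ 4 / Real.pi * η * t0 := hsmall
        _ = 2 * η * (2 / Real.pi * t0) := by ring
        _ ≤ 2 * c i * (2 / Real.pi * |u i / (2 * c i)|) := by
          have := hc i
          gcongr
        _ ≤ _ := by gcongr
    have h4 := pow_le_pow_left₀ hd.le h3 2
    rw [mul_pow, sq_abs] at h4
    calc d ^ 2 ≤ 4 * c i ^ 2 * Real.sin (u i / (2 * c i)) ^ 2 := by linarith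
      _ ≤ _ := Finset.single_le_sum (f := fun i => 4 * c i ^ 2 * Real.sin (u i / (2 * c i)) ^ 2)
          (fun j _ => by positivity) (Finset.mem_univ i)

/-- The basis `2 π c_i e_i` of the period lattice of the torus map. -/
def periodBasis {L : ℕ} (c : EuclideanSpace ℝ (Fin L)) (hc : ∀ i, 0 < c i) :
    Module.Basis (Fin L) ℝ (EuclideanSpace ℝ (Fin L)) :=
  (EuclideanSpace.basisFun (Fin L) ℝ).toBasis.isUnitSMul (w := fun i => 2 * Real.pi * c i)
    fun i => (mul_pos (mul_pos two_pos Real.pi_pos) (hc i)).ne'.isUnit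

section Period

variable {L : ℕ} {c : EuclideanSpace ℝ (Fin L)} (hc : ∀ i, 0 < c i)

lemma periodBasis_apply (i : Fin L) :
    periodBasis c hc i = (2 * Real.pi * c i) • EuclideanSpace.single i (1 : ℝ) := by
  simp [periodBasis, Module.Basis.isUnitSMul_apply]

lemma periodBasis_repr (x : EuclideanSpace ℝ (Fin L)) (i : Fin L) :
    (periodBasis c hc).repr x i = x i / (2 * Real.pi * c i) := by
  have h := (mul_pos (mul_pos two_pos Real.pi_pos) (hc i)).ne'
  have h1 : x = ∑ j, (x j / (2 * Real.pi * c j)) • periodBasis c hc j := by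
    ext k
    have h := (mul_pos (mul_pos two_pos Real.pi_pos) (hc k)).ne'
    simp only [periodBasis_apply, WithLp.ofLp_sum, Finset.sum_apply, WithLp.ofLp_smul,
      Pi.smul_apply, smul_eq_mul, PiLp.single_apply]
    rw [Finset.sum_eq_single k]
    · simp only [if_true, mul_one]; rw [div_mul_cancel₀ _ h]
    · intro j _ hj; simp [hj.symm]
    · simp
  conv_lhs => rw [h1]
  rw [Module.Basis.repr_sum_self]

lemma fundamentalDomain_periodBasis :
    ZSpan.fundamentalDomain (periodBasis c hc) = torusBox c := by
  ext x
  simp only [ZSpan.mem_fundamentalDomain, periodBasis_repr, torusBox, mem_ofPred_eq, mem_Ico]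
  refine forall_congr' fun i => ?_
  have h : 0 < 2 * Real.pi * c i := mul_pos (mul_pos two_pos Real.pi_pos) (hc i)
  rw [div_lt_one h, le_div_iff₀ h, zero_mul]
  simp [(hc i).ne']

lemma volume_torusBox (hc : ∀ i, 0 < c i) :
    volume (torusBox c) = ∏ i, ENNReal.ofReal (2 * Real.pi * c i) := by
  have h := (EuclideanSpace.volume_preserving_symm_measurableEquiv_toLp (Fin L)).measure_preimage
    (MeasurableSet.univ_pi (t := fun i => Ico 0 (2 * Real.pi * c i))
      fun i => measurableSet_Ico).nullMeasurableSet
  rw [Real.volume_pi_Ico] at h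
  simp only [sub_zero] at h
  rw [← h]
  congr 1
  ext x
  simp only [torusBox, mem_ofPred_eq, mem_preimage, mem_univ_pi, mem_Ico]
  refine forall_congr' fun i => ?_
  simp [(hc i).ne']

end Period

lemma IsZLattice.exists_norm_sub_le {E : Type*} [NormedAddCommGroup E] [NormedSpace ℝ E]
    [FiniteDimensional ℝ E] (Λ : Submodule ℤ E) [DiscreteTopology Λ] [IsZLattice ℝ Λ] :
    ∃ ρ : ℝ, 0 ≤ ρ ∧ ∀ x : E, ∃ l ∈ Λ, ‖l - x‖ ≤ ρ := by
  let b := (Module.Free.chooseBasis ℤ Λ).ofZLatticeBasis ℝ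
  refine ⟨∑ i, ‖b i‖, Finset.sum_nonneg fun _ _ => norm_nonneg _, fun x =>
    ⟨ZSpan.floor b x, ?_, ?_⟩⟩
  · exact (Module.Basis.ofZLatticeBasis_span ℝ Λ (Module.Free.chooseBasis ℤ Λ)).le
      (ZSpan.floor b x).2
  · rw [norm_sub_rev]; exact ZSpan.norm_fract_le b x

/-- A lattice of minimum distance `2 τ` slightly larger than `d` is deformed slightly into one that
contains the period lattice of the torus. Its points in the box then form a layer that has as many
points as the covolume predicts. -/
lemma exists_large_layer {L : ℕ} (hL : 0 < L) (Λ : Submodule ℤ (EuclideanSpace ℝ (Fin L)))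
    [DiscreteTopology Λ] [IsZLattice ℝ Λ] (h2 : minDist Λ = 2) {η θ : ℝ} (hη : 0 < η)
    (hθ : 0 < θ) (hθ1 : θ < 1) : ∀ᶠ d in 𝓝[>] (0 : ℝ), ∀ c : EuclideanSpace ℝ (Fin L),
      ‖c‖ = 1 → (∀ i, η ≤ c i) → ∃ Y, IsLatticeLayer d c Y ∧
      (1 - θ) * ∏ i, (2 * Real.pi * c i) ≤
        Y.ncard * (((1 + θ) ^ 2 * (d / 2)) ^ L * ZLattice.covolume Λ) := by
  have hpi := Real.pi_pos
  obtain ⟨ρ, hρ0, hρ⟩ := IsZLattice.exists_norm_sub_le Λ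
  -- linear maps close to the identity have determinant close to `1`
  obtain ⟨β, hβ, hdet⟩ : ∃ β > 0, ∀ S : EuclideanSpace ℝ (Fin L) →L[ℝ] EuclideanSpace ℝ (Fin L),
      ‖S - 1‖ < β → 1 - θ < S.det := by
    have hcont := (ContinuousLinearMap.continuous_det (𝕜 := ℝ)
      (E := EuclideanSpace ℝ (Fin L))).tendsto 1
    have h1 : (1 : EuclideanSpace ℝ (Fin L) →L[ℝ] EuclideanSpace ℝ (Fin L)).det = 1 := by
      simp [ContinuousLinearMap.det]
    rw [h1] at hcont
    have := hcont.eventually_const_lt (u := 1 - θ) (by linarith)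
    obtain ⟨β, hβ, h⟩ := Metric.eventually_nhds_iff.1 this
    exact ⟨β, hβ, fun S hS => h (by rwa [dist_eq_norm])⟩
  have hsq : 0 < 4 / Real.pi * η * √(θ / (1 + θ)) :=
    mul_pos (by positivity) (Real.sqrt_pos.2 (by positivity))
  filter_upwards [self_mem_nhdsWithin, eventually_mul_lt 1 hsq,
    eventually_mul_lt (L * ((1 + θ) ^ 2 / 2 * ρ / (2 * Real.pi * η))) (lt_min hβ hθ)]
    with d hd0 hd1 hd2 c hc1 hcη
  have hd : 0 < d := hd0
  rw [mul_one] at hd1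
  have hc : ∀ i, 0 < c i := fun i => hη.trans_le (hcη i)
  have hpc : ∀ i, 0 < 2 * Real.pi * c i := fun i => by have := hc i; positivity
  set τ := (1 + θ) ^ 2 * (d / 2) with hτdef
  have hτ : 0 < τ := by positivity
  -- `τ w_i` is a vector of `τ Λ` near the period `2 π c_i e_i`, and `S = 1 + N` is the linear map
  -- close to the identity that moves these periods to the `τ w_i`
  choose w hwΛ hw using fun i : Fin L =>
    hρ ((2 * Real.pi * c i / τ) • EuclideanSpace.single i (1 : ℝ))
  let v : Fin L → EuclideanSpace ℝ (Fin L) := fun i =>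
    (τ / (2 * Real.pi * c i)) • (w i - (2 * Real.pi * c i / τ) • EuclideanSpace.single i (1 : ℝ))
  have hv : ∀ i, ‖v i‖ ≤ τ * ρ / (2 * Real.pi * η) := by
    intro i
    have h0 := hpc i
    rw [norm_smul, Real.norm_eq_abs, abs_of_pos (div_pos hτ h0),
      ← div_mul_eq_mul_div τ (2 * Real.pi * η) ρ]
    refine mul_le_mul ?_ (hw i) (norm_nonneg _) (by positivity)
    exact div_le_div_of_nonneg_left hτ.le (by positivity)
      (mul_le_mul_of_nonneg_left (hcη i) (by positivity))
  let N : EuclideanSpace ℝ (Fin L) →L[ℝ] EuclideanSpace ℝ (Fin L) :=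
    ∑ i, (EuclideanSpace.proj i : EuclideanSpace ℝ (Fin L) →L[ℝ] ℝ).smulRight (v i)
  have hN : ∀ x, N x = ∑ i, x i • v i := fun x => by simp [N]
  have hNnorm : ‖N‖ < min β θ := by
    refine lt_of_le_of_lt (N.opNorm_le_bound (M := L * (τ * ρ / (2 * Real.pi * η)))
      (by positivity) fun x => ?_) (lt_of_eq_of_lt ?_ hd2)
    · rw [hN]
      calc ‖∑ i, x i • v i‖ ≤ ∑ i, ‖x i • v i‖ := norm_sum_le _ _
        _ ≤ ∑ _i : Fin L, ‖x‖ * (τ * ρ / (2 * Real.pi * η)) := by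
          refine Finset.sum_le_sum fun i _ => ?_
          rw [norm_smul]
          exact mul_le_mul (PiLp.norm_apply_le x i) (hv i) (norm_nonneg _) (norm_nonneg _)
        _ = _ := by simp; ring
    · rw [hτdef]; ring
  set S : EuclideanSpace ℝ (Fin L) →L[ℝ] EuclideanSpace ℝ (Fin L) := 1 + N with hSdef
  have hSdet : 1 - θ < S.det := hdet S (by
    rw [hSdef, add_sub_cancel_left]; exact hNnorm.trans_le (min_le_left _ _))
  have hSper : ∀ i, S (periodBasis c hc i) = τ • w i := by
    intro i
    have h0 := (hpc i).ne'
    rw [hSdef, _root_.add_apply, hN, periodBasis_apply, Finset.sum_eq_single i]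
    · simp only [v, one_apply_eq_self, PiLp.smul_apply, PiLp.single_apply, if_true,
        smul_eq_mul, mul_one, smul_sub, smul_smul]
      have e1 : 2 * Real.pi * c i * (τ / (2 * Real.pi * c i)) = τ :=
        mul_div_cancel₀ _ h0
      have e2 : 2 * Real.pi * c i * (τ / (2 * Real.pi * c i) * (2 * Real.pi * c i / τ)) =
        2 * Real.pi * c i := by rw [← mul_assoc, e1, mul_div_cancel₀ _ hτ.ne']
      rw [e1, e2]
      abel
    · intro j _ hj
      simp [hj]
    · simp
  set A : EuclideanSpace ℝ (Fin L) →L[ℝ] EuclideanSpace ℝ (Fin L) := τ⁻¹ • S with hAdef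
  have hAdet : A.det = (τ ^ L)⁻¹ * S.det := by
    simp only [ContinuousLinearMap.det, hAdef, ContinuousLinearMap.toLinearMap_smul,
      LinearMap.det_smul, finrank_euclideanSpace_fin, inv_pow]
  have hSdet0 : 0 < S.det := by linarith
  have hAdet0 : A.det ≠ 0 := by rw [hAdet]; positivity
  let e := A.toContinuousLinearEquivOfDetNeZero hAdet0
  have he : ∀ x, e x = A x := fun x => A.toContinuousLinearEquivOfDetNeZero_apply hAdet0 x
  have hzl : IsZLattice ℝ (ZLattice.comap ℝ Λ e.toLinearMap) := inferInstance
  have hdisc : DiscreteTopology (ZLattice.comap ℝ Λ e.toLinearMap) := inferInstance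
  -- the deformed lattice `S⁻¹ (τ Λ)`
  set Λ' := ZLattice.comap ℝ Λ e.toLinearMap with hΛ'
  have hmem : ∀ x, x ∈ Λ' ↔ A x ∈ Λ := fun x => by
    rw [← he]; rfl
  have hG : Submodule.span ℤ (Set.range (periodBasis c hc)) ≤ Λ' := by
    rw [Submodule.span_le]
    rintro _ ⟨i, rfl⟩
    rw [SetLike.mem_coe, hmem, hAdef, _root_.smul_apply, hSper, smul_smul,
      inv_mul_cancel₀ hτ.ne', one_smul]
    exact hwΛ i
  have hmin : ∀ x ∈ Λ', x ≠ 0 → (1 + θ) * d ≤ ‖x‖ := by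
    intro x hx hx0
    have h3 : A x ≠ 0 := by
      rw [← he]; simpa using hx0
    have h4 := minDist_le Λ ((hmem x).1 hx) h3
    rw [h2, hAdef, _root_.smul_apply, norm_smul, norm_inv, Real.norm_eq_abs,
      abs_of_pos hτ, inv_mul_eq_div, le_div_iff₀ hτ] at h4
    have h5 : ‖S x‖ ≤ (1 + θ) * ‖x‖ := by
      rw [hSdef, _root_.add_apply, add_mul, one_mul]
      refine (norm_add_le _ _).trans ?_
      have h6 : ‖N x‖ ≤ θ * ‖x‖ := (N.le_opNorm x).trans
        (mul_le_mul_of_nonneg_right (hNnorm.le.trans (min_le_right _ _)) (norm_nonneg _))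
      simpa using h6
    have h6 : 2 * τ = (1 + θ) * ((1 + θ) * d) := by rw [hτdef]; ring
    rw [h6] at h4
    exact le_of_mul_le_mul_left (h4.trans h5) (by positivity)
  set Y : Set (EuclideanSpace ℝ (Fin L)) := (Λ' : Set (EuclideanSpace ℝ (Fin L))) ∩ torusBox c
  have hbox : ∀ {x}, x ∈ Y → ∀ i, 0 ≤ x i ∧ x i < 2 * Real.pi * c i := by
    intro x hx i
    rcases hx.2 i with h | h
    · exact h
    · exact absurd h.1 (hc i).ne'
  have hlayer : IsLatticeLayer d c Y := by
    refine ⟨⟨Λ', hdisc, hzl, rfl⟩, fun x hx y hy hxy => ?_⟩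
    -- reduce the difference modulo the period lattice to the centred box
    let k : Fin L → ℤ := fun i => round ((x i - y i) / (2 * Real.pi * c i))
    let p : EuclideanSpace ℝ (Fin L) := ∑ i, k i • periodBasis c hc i
    have hp : p ∈ Λ' := hG (Submodule.sum_mem _ fun i _ =>
      Submodule.smul_mem _ _ (Submodule.subset_span ⟨i, rfl⟩))
    have hpi' : ∀ i, p i = k i * (2 * Real.pi * c i) := by
      intro i
      simp only [p, periodBasis_apply, WithLp.ofLp_sum, Finset.sum_apply]
      rw [Finset.sum_eq_single i]
      · simp
      · intro j _ hj; simp [hj.symm]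
      · simp
    set u := x - y - p
    have hui : ∀ i, u i = x i - y i - k i * (2 * Real.pi * c i) := fun i => by
      simp [u, hpi']
    have huΛ : u ∈ Λ' := Λ'.sub_mem (Λ'.sub_mem hx.1 hy.1) hp
    have hu0 : u ≠ 0 := by
      intro h0
      apply hxy
      ext i
      have h3 : x i - y i - k i * (2 * Real.pi * c i) = 0 := by rw [← hui, h0]; rfl
      have hxi := hbox hx i
      have hyi := hbox hy i
      have h4 : |(k i : ℝ) * (2 * Real.pi * c i)| < 1 * (2 * Real.pi * c i) := by
        rw [← sub_eq_zero.1 h3, abs_lt]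
        constructor <;> linarith
      rw [abs_mul, abs_of_pos (hpc i)] at h4
      have h5 := lt_of_mul_lt_mul_right h4 (hpc i).le
      have h6 : |k i| < 1 := by exact_mod_cast h5
      rw [Int.abs_lt_one_iff.1 h6] at h3
      simp only [Int.cast_zero, zero_mul, sub_zero] at h3
      linarith
    have hround : ∀ i, |u i| ≤ Real.pi * c i := by
      intro i
      have h3 := abs_sub_round ((x i - y i) / (2 * Real.pi * c i))
      have h4 : u i = ((x i - y i) / (2 * Real.pi * c i) - k i) * (2 * Real.pi * c i) := by
        rw [hui, sub_mul, div_mul_cancel₀ _ (hpc i).ne']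
      rw [h4, abs_mul, abs_of_pos (hpc i)]
      calc _ ≤ 1 / 2 * (2 * Real.pi * c i) := mul_le_mul_of_nonneg_right h3 (hpc i).le
        _ = _ := by ring
    have h3 := le_sum_chord_sq hη hθ hd hcη hround (hmin u huΛ hu0) hd1.le
    change d ≤ dist (torusMap c x) (torusMap c y)
    rw [← sq_le_sq₀ hd.le dist_nonneg, torusMap_dist_sq]
    refine h3.trans (le_of_eq (Finset.sum_congr rfl fun i _ => ?_))
    have h4 : u i / (2 * c i) = (x i - y i) / (2 * c i) - k i * Real.pi := by
      have := (hc i).ne'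
      rw [hui]; field_simp
    have h5 : ((-1 : ℝ) ^ k i) ^ 2 = 1 := by
      rw [← zpow_natCast, ← zpow_mul, mul_comm, zpow_mul]; norm_num
    rw [h4, Real.sin_sub_int_mul_pi, mul_pow, h5, one_mul]
  have hfin : Y.Finite := (hlayer.finite_and_ncard_le hd hL hc1 fun i => (hc i).le).1
  refine ⟨Y, hlayer, ?_⟩
  set b := (Module.Free.chooseBasis ℤ Λ).ofZLatticeBasis ℝ
  set D := ZSpan.fundamentalDomain b
  have hP := ZSpan.isAddFundamentalDomain (periodBasis c hc) volume
  rw [fundamentalDomain_periodBasis] at hP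
  have hinv : VAddInvariantMeasure (Submodule.span ℤ (Set.range (periodBasis c hc)))
      (EuclideanSpace ℝ (Fin L)) volume := (inferInstance : VAddInvariantMeasure
        (Submodule.span ℤ (Set.range (periodBasis c hc))).toAddSubgroup _ _)
  have hmv : MeasurableVAdd (Submodule.span ℤ (Set.range (periodBasis c hc)))
      (EuclideanSpace ℝ (Fin L)) := (inferInstance : MeasurableVAdd
        (Submodule.span ℤ (Set.range (periodBasis c hc))).toAddSubgroup _)
  -- the points of the layer represent `Λ'` modulo the periods
  have hcount := measure_fundamentalDomain_le_card_mul volume hP hfin.toFinset (A ⁻¹' D) (by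
    intro z
    obtain ⟨l, hl⟩ : ∃ l, A l = ZSpan.floor b (A z) := ⟨e.symm (ZSpan.floor b (A z)), by
      rw [← he, e.apply_symm_apply]⟩
    have hlΛ : l ∈ Λ' := by
      rw [hmem, hl]
      exact (Module.Basis.ofZLatticeBasis_span ℝ Λ (Module.Free.chooseBasis ℤ Λ)).le
        (ZSpan.floor b (A z)).2
    refine ⟨ZSpan.floor (periodBasis c hc) l, ZSpan.fract (periodBasis c hc) l, ?_, z - l, ?_, ?_⟩
    · rw [Finite.mem_toFinset]
      refine ⟨Λ'.sub_mem hlΛ (hG (ZSpan.floor (periodBasis c hc) l).2), ?_⟩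
      rw [← fundamentalDomain_periodBasis hc]
      exact ZSpan.fract_mem_fundamentalDomain _ _
    · rw [mem_preimage, map_sub, hl]
      exact ZSpan.fract_mem_fundamentalDomain b (A z)
    · rw [Submodule.vadd_def, vadd_eq_add, ZSpan.fract_apply]
      abel)
  rw [volume_torusBox hc, Measure.addHaar_preimage_continuousLinearMap _ hAdet0,
    ← ncard_eq_toFinset_card _ hfin] at hcount
  have hDfin : volume D ≠ ⊤ := (ZSpan.fundamentalDomain_isBounded b).measure_lt_top.ne
  have h3 := ENNReal.toReal_mono (by finiteness) hcount
  rw [ENNReal.toReal_prod, ENNReal.toReal_mul, ENNReal.toReal_mul, ENNReal.toReal_natCast,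
    ENNReal.toReal_ofReal (abs_nonneg _)] at h3
  simp_rw [fun i => ENNReal.toReal_ofReal (hpc i).le] at h3
  have hcov : (volume D).toReal = ZLattice.covolume Λ :=
    (ZLattice.covolume_eq_measure_fundamentalDomain Λ volume
      (ZLattice.isAddFundamentalDomain (Module.Free.chooseBasis ℤ Λ) volume)).symm
  have hdetA : |(LinearMap.det (A : EuclideanSpace ℝ (Fin L) →ₗ[ℝ] EuclideanSpace ℝ (Fin L)))⁻¹| =
      τ ^ L / S.det := by
    have : LinearMap.det (A : EuclideanSpace ℝ (Fin L) →ₗ[ℝ] EuclideanSpace ℝ (Fin L)) = A.det :=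
      rfl
    rw [this, hAdet, mul_inv, inv_inv, abs_of_pos (by positivity), div_eq_mul_inv]
  rw [hcov, hdetA] at h3
  calc (1 - θ) * ∏ i, (2 * Real.pi * c i) ≤ S.det * ∏ i, (2 * Real.pi * c i) :=
        mul_le_mul_of_nonneg_right hSdet.le (Finset.prod_nonneg fun i _ => (hpc i).le)
    _ ≤ S.det * (Y.ncard * (τ ^ L / S.det * ZLattice.covolume Λ)) :=
        mul_le_mul_of_nonneg_left h3 hSdet0.le
    _ = _ := by field_simp

/-- Uniformly in the torus `c`, a largest lattice layer has at least asymptotically `vol (P_c)`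
times the number of points per unit volume of `Λ` scaled to minimum distance `d`. Tori with a small
radius are harmless, since their boxes have small volume. -/
theorem layer_lower_bound {L : ℕ} (hL : 0 < L) (Λ : Submodule ℤ (EuclideanSpace ℝ (Fin L)))
    [DiscreteTopology Λ] [IsZLattice ℝ Λ] (h2 : minDist Λ = 2) {ε : ℝ}
    (hε : 0 < ε) : ∀ᶠ d in 𝓝[>] (0 : ℝ), ∀ c : EuclideanSpace ℝ (Fin L), ‖c‖ = 1 →
      (∀ i, 0 ≤ c i) → ∀ Y, IsLargestLatticeLayer d c Y →
      2 ^ L / ZLattice.covolume Λ * ∏ i, (2 * Real.pi * c i) - ε ≤ d ^ L * Y.ncard := by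
  have hpi := Real.pi_pos
  set V := ZLattice.covolume Λ
  have hV : 0 < V := ZLattice.covolume_pos Λ _
  set B := 2 ^ L / V * ((2 * Real.pi) * (2 * Real.pi) ^ L) with hB
  have hB0 : 0 < B := by positivity
  have h2pi : 1 ≤ 2 * Real.pi := by linarith [Real.pi_gt_three]
  have hprod : ∀ (c : EuclideanSpace ℝ (Fin L)), ‖c‖ = 1 → (∀ i, 0 ≤ c i) → ∀ η, ∀ i, c i ≤ η →
      2 ^ L / V * ∏ i, (2 * Real.pi * c i) ≤ B * η := by
    intro c hc hc0 η i hi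
    have h3 := prod_le_mul_pow (fun i => 2 * Real.pi * c i) i
      (fun j => mul_nonneg (by positivity) (hc0 j))
      (mul_le_mul_of_nonneg_left hi (by positivity : 0 ≤ 2 * Real.pi)) (K := 2 * Real.pi)
      (fun j _ => by nlinarith [coord_le_one hc j]) h2pi
    calc _ ≤ 2 ^ L / V * (2 * Real.pi * η * (2 * Real.pi) ^ L) := by gcongr
      _ = _ := by rw [hB]; ring
  obtain ⟨θ, ⟨hθ0, hθ1⟩, hθ⟩ : ∃ θ : ℝ, (0 < θ ∧ θ < 1) ∧
      1 - ε / B < (1 - θ) / ((1 + θ) ^ 2) ^ L := by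
    have hcont : Tendsto (fun θ : ℝ => (1 - θ) / ((1 + θ) ^ 2) ^ L) (𝓝[>] 0) (𝓝 1) := by
      have : ContinuousAt (fun θ : ℝ => (1 - θ) / ((1 + θ) ^ 2) ^ L) 0 :=
        ContinuousAt.div (by fun_prop) (by fun_prop) (by simp)
      have h := this.tendsto
      simp only [sub_zero, add_zero, one_pow, div_one] at h
      exact h.mono_left nhdsWithin_le_nhds
    have h3 := hcont.eventually_const_lt (u := 1 - ε / B) (by
      have := div_pos hε hB0; linarith)
    obtain ⟨θ, h4, h5⟩ := (h3.and (Ioo_mem_nhdsGT one_pos)).exists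
    exact ⟨θ, h5, h4⟩
  filter_upwards [self_mem_nhdsWithin, exists_large_layer hL Λ h2 (div_pos hε hB0) hθ0 hθ1]
    with d hd0 hlarge c hc hc0 Y hY
  have hd : 0 < d := hd0
  -- a torus with a radius below `ε / B` has a predicted count of at most `ε`
  by_cases hsmall : ∀ i, ε / B ≤ c i
  · obtain ⟨Y', hY', hcount⟩ := hlarge c hc hsmall
    have hle : (Y'.ncard : ℝ) ≤ Y.ncard := by exact_mod_cast hY.2 Y' hY'
    set P := ∏ i, (2 * Real.pi * c i) with hP
    have hP0 : 0 ≤ P := Finset.prod_nonneg fun i _ => mul_nonneg (by positivity) (hc0 i)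
    have hPB : 2 ^ L / V * P ≤ B := by
      have := hprod c hc hc0 1 ⟨0, hL⟩ (coord_le_one hc _)
      linarith
    have h3 : 2 ^ L / V * P * ((1 - θ) / ((1 + θ) ^ 2) ^ L) ≤ d ^ L * Y'.ncard := by
      have : 2 ^ L / V * P * ((1 - θ) / ((1 + θ) ^ 2) ^ L) =
        (1 - θ) * P * (2 ^ L / (V * ((1 + θ) ^ 2) ^ L)) := by field_simp
      rw [this]
      calc _ ≤ Y'.ncard * (((1 + θ) ^ 2 * (d / 2)) ^ L * V) * (2 ^ L / (V * ((1 + θ) ^ 2) ^ L)) :=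
            mul_le_mul_of_nonneg_right hcount (by positivity)
        _ = _ := by rw [mul_pow, div_pow]; field_simp
    have h4 : 2 ^ L / V * P * (1 - ε / B) ≤ 2 ^ L / V * P * ((1 - θ) / ((1 + θ) ^ 2) ^ L) :=
      mul_le_mul_of_nonneg_left hθ.le (by positivity)
    have h5 : 2 ^ L / V * P * (ε / B) ≤ ε := by
      calc _ ≤ B * (ε / B) := mul_le_mul_of_nonneg_right hPB (by positivity)
        _ = ε := by field_simp
    have h6 : d ^ L * (Y'.ncard : ℝ) ≤ d ^ L * Y.ncard := by gcongr
    linarith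
  · push Not at hsmall
    obtain ⟨i, hi⟩ := hsmall
    have h3 := hprod c hc hc0 _ i hi.le
    rw [mul_div_cancel₀ _ hB0.ne'] at h3
    have : 0 ≤ d ^ L * (Y.ncard : ℝ) := by positivity
    linarith

lemma exists_isLatticeLayer {L : ℕ} (d : ℝ) {c : EuclideanSpace ℝ (Fin L)} (hc : ‖c‖ = 1) :
    ∃ Y, IsLatticeLayer d c Y := by
  have hpi := Real.pi_pos
  -- a cubic lattice with period larger than the box meets it in at most one point
  let b := periodBasis (WithLp.toLp 2 fun _ : Fin L => (2 : ℝ)) (fun i => two_pos)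
  refine ⟨_, ⟨Submodule.span ℤ (Set.range b), inferInstance, inferInstance, rfl⟩, ?_⟩
  have hz : ∀ x ∈ (Submodule.span ℤ (Set.range b) : Set (EuclideanSpace ℝ (Fin L))) ∩ torusBox c,
      x = 0 := by
    rintro x ⟨hx, hxc⟩
    have h := (b.mem_span_iff_repr_mem ℤ x).1 hx
    ext i
    obtain ⟨k, hk⟩ := h i
    rw [periodBasis_repr] at hk
    simp only [algebraMap_int_eq, eq_intCast] at hk
    rcases hxc i with ⟨h0, h1⟩ | ⟨-, h0⟩
    · rw [eq_div_iff (by positivity)] at hk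
      have h2 := coord_le_one hc i
      have h3 : (k : ℝ) * (2 * Real.pi * 2) < 1 * (2 * Real.pi * 2) := by nlinarith
      have h4 := lt_of_mul_lt_mul_right h3 (by positivity)
      have h5 : (0 : ℝ) ≤ k := by
        by_contra hneg
        push Not at hneg
        have := mul_neg_of_neg_of_pos hneg (by positivity : 0 < 2 * Real.pi * 2)
        linarith
      have h6 : k = 0 := by
        have h7 : k < 1 := by exact_mod_cast h4
        have h8 : 0 ≤ k := by exact_mod_cast h5
        omega
      rw [← hk, h6]; simp
    · exact h0
  intro x hx y hy hxy
  exact absurd ((hz x hx).trans (hz y hy).symm) hxy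

/-- A largest layer exists because the number of points of a layer is bounded. -/
lemma exists_isLargestLatticeLayer {L : ℕ} (hL : 0 < L) {d : ℝ} (hd : 0 < d)
    {c : EuclideanSpace ℝ (Fin L)} (hc : ‖c‖ = 1) (hc0 : ∀ i, 0 ≤ c i) :
    ∃ Y, IsLargestLatticeLayer d c Y := by
  obtain ⟨Y₀, hY₀⟩ := exists_isLatticeLayer d hc
  let s : Set ℕ := {n | ∃ Y, IsLatticeLayer d c Y ∧ Y.ncard = n}
  have hs : BddAbove s := by
    refine ⟨⌊(2 * Real.pi / (d / (2 * L)) + 1) ^ L⌋₊, ?_⟩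
    rintro n ⟨Y, hY, rfl⟩
    exact Nat.le_floor (hY.finite_and_ncard_le hd hL hc hc0).2
  obtain ⟨Y, hY, hn⟩ := Nat.sSup_mem (s := s) ⟨_, Y₀, hY₀, rfl⟩ hs
  exact ⟨Y, hY, fun Y' hY' => hn ▸ le_csSup hs ⟨Y', hY', rfl⟩⟩

/-! ### Partitions of the sphere and equidistribution -/

lemma measure_frontier_biUnion_eq_zero {X ι : Type*} [TopologicalSpace X] [MeasurableSpace X]
    (μ : Measure X) (s : Finset ι) (B : ι → Set X) (hB : ∀ i ∈ s, μ (frontier (B i)) = 0) :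
    μ (frontier (⋃ i ∈ s, B i)) = 0 := by
  classical
  induction s using Finset.induction_on with
  | empty => simp
  | insert i s hi ih =>
    rw [Finset.set_biUnion_insert]
    refine measure_mono_null ((frontier_union_subset _ _).trans
      (union_subset_union inter_subset_left inter_subset_right)) (measure_union_null ?_ ?_)
    · exact hB i (Finset.mem_insert_self i s)
    · exact ih fun j hj => hB j (Finset.mem_insert_of_mem hj)

lemma measure_frontier_inter_eq_zero {X : Type*} [TopologicalSpace X] [MeasurableSpace X]
    (μ : Measure X) {s t : Set X} (hs : μ (frontier s) = 0) (ht : μ (frontier t) = 0) :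
    μ (frontier (s ∩ t)) = 0 :=
  measure_mono_null ((frontier_inter_subset s t).trans
    (union_subset_union inter_subset_left inter_subset_right)) (measure_union_null hs ht)

/-- A finite measurable partition into (possibly empty) sets of diameter at most `r` with null
boundary. -/
structure IsFinePartition {X : Type*} [PseudoMetricSpace X] [MeasurableSpace X] (μ : Measure X)
    (r : ℝ) {n : ℕ} (A : Fin n → Set X) : Prop where
  measurableSet : ∀ j, MeasurableSet (A j)
  frontier_null : ∀ j, μ (frontier (A j)) = 0
  dist_le : ∀ j, ∀ x ∈ A j, ∀ y ∈ A j, dist x y ≤ r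
  disjoint : Pairwise fun i j => Disjoint (A i) (A j)
  cover : ∀ x, ∃ j, x ∈ A j

lemma exists_isFinePartition {X : Type*} [PseudoMetricSpace X] [CompactSpace X]
    [MeasurableSpace X] [BorelSpace X] (μ : Measure X) [IsFiniteMeasure μ] {r : ℝ} (hr : 0 < r) :
    ∃ (n : ℕ) (A : Fin n → Set X), IsFinePartition μ r A := by
  -- finitely many balls with null boundary cover the space; they are made disjoint
  choose ρ hρ hnull using fun x : X =>
    exists_null_frontier_thickening μ {x} (half_pos hr)
  simp only [Metric.thickening_singleton] at hnull
  obtain ⟨t, ht⟩ := isCompact_univ.elim_finite_subcover (fun x : X => Metric.ball x (ρ x))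
    (fun x => Metric.isOpen_ball) (fun x _ => mem_iUnion.2 ⟨x, Metric.mem_ball_self (hρ x).1⟩)
  let e : Fin t.card ≃ t := t.equivFin.symm
  let B : Fin t.card → Set X := fun j => Metric.ball (e j : X) (ρ (e j))
  have hBU : ∀ s : Finset (Fin t.card), μ (frontier (⋃ i ∈ s, B i)) = 0 := fun s =>
    measure_frontier_biUnion_eq_zero μ s B fun i _ => hnull _
  refine ⟨t.card, fun j => B j ∩ (⋃ i ∈ Finset.Iio j, B i)ᶜ, ?_, ?_, ?_, ?_, ?_⟩
  · intro j
    exact Metric.isOpen_ball.measurableSet.inter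
      (isOpen_biUnion fun i _ => Metric.isOpen_ball).measurableSet.compl
  · intro j
    refine measure_frontier_inter_eq_zero μ (hnull _) ?_
    rw [frontier_compl]
    exact hBU _
  · intro j x hx y hy
    have h1 := Metric.mem_ball.1 hx.1
    have h2 := Metric.mem_ball'.1 hy.1
    have h3 := (hρ (e j : X)).2
    linarith [dist_triangle x (e j : X) y]
  · have key : ∀ i j, i < j → Disjoint (B i ∩ (⋃ k ∈ Finset.Iio i, B k)ᶜ)
        (B j ∩ (⋃ k ∈ Finset.Iio j, B k)ᶜ) := by
      intro i j hij
      rw [Set.disjoint_left]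
      intro x hx hx'
      exact hx'.2 (mem_biUnion (Finset.mem_Iio.2 hij) hx.1)
    intro i j hij
    rcases lt_or_gt_of_ne hij with h | h
    · exact key i j h
    · exact (key j i h).symm
  · intro x
    have hne : {j | x ∈ B j}.Nonempty := by
      obtain ⟨y, hy, hxy⟩ := mem_iUnion₂.1 (ht (mem_univ x))
      exact ⟨e.symm ⟨y, hy⟩, by simpa [B] using hxy⟩
    obtain ⟨j, hj, hmin⟩ := WellFounded.has_min wellFounded_lt _ hne
    refine ⟨j, hj, fun hx => ?_⟩
    obtain ⟨i, hi, hxi⟩ := mem_iUnion₂.1 hx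
    exact hmin i hxi (Finset.mem_Iio.1 hi)

section Sphere

variable {L : ℕ}

/-- The nonnegative part of the unit sphere. -/
def posSphere (L : ℕ) : Set (Metric.sphere (0 : EuclideanSpace ℝ (Fin L)) 1) :=
  {a | ∀ i, 0 ≤ (a : EuclideanSpace ℝ (Fin L)) i}

instance : IsFiniteMeasure (sphereMeasure L) := by
  unfold sphereMeasure; infer_instance

lemma continuous_coord (i : Fin L) : Continuous fun a : Metric.sphere
    (0 : EuclideanSpace ℝ (Fin L)) 1 => (a : EuclideanSpace ℝ (Fin L)) i := by
  fun_prop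

lemma isClosed_posSphere : IsClosed (posSphere L) := by
  have : posSphere L = ⋂ i, {a : Metric.sphere (0 : EuclideanSpace ℝ (Fin L)) 1 |
      0 ≤ (a : EuclideanSpace ℝ (Fin L)) i} := by
    ext a; simp [posSphere]
  rw [this]
  exact isClosed_iInter fun i => isClosed_le continuous_const (continuous_coord i)

lemma sphereMeasure_coord_eq_zero (i : Fin L) :
    sphereMeasure L {a | (a : EuclideanSpace ℝ (Fin L)) i = 0} = 0 := by
  rw [sphereMeasure, Measure.toSphere_apply' _
    (isClosed_eq (continuous_coord i) continuous_const).measurableSet]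
  let H : Submodule ℝ (EuclideanSpace ℝ (Fin L)) :=
    LinearMap.ker (EuclideanSpace.proj i : EuclideanSpace ℝ (Fin L) →L[ℝ] ℝ).toLinearMap
  have hH : H ≠ ⊤ := by
    intro h
    have : EuclideanSpace.single i (1 : ℝ) ∈ H := h ▸ Submodule.mem_top
    simp [H] at this
  have : Ioo (0 : ℝ) 1 • (Subtype.val '' {a : Metric.sphere (0 : EuclideanSpace ℝ (Fin L)) 1 |
      (a : EuclideanSpace ℝ (Fin L)) i = 0}) ⊆ H := by
    rintro _ ⟨r, -, _, ⟨a, ha, rfl⟩, rfl⟩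
    simp only [mem_ofPred_eq] at ha
    simp [H, ha]
  rw [measure_mono_null this (Measure.addHaar_submodule _ H hH), mul_zero]

lemma sphereMeasure_frontier_posSphere : sphereMeasure L (frontier (posSphere L)) = 0 := by
  refine measure_mono_null (t := ⋃ i, {a | (a : EuclideanSpace ℝ (Fin L)) i = 0}) ?_
    (measure_iUnion_null fun i => sphereMeasure_coord_eq_zero i)
  intro a ha
  rw [isClosed_posSphere.frontier_eq] at ha
  by_contra hcon
  simp only [mem_iUnion, mem_ofPred_eq, not_exists] at hcon
  apply ha.2
  refine mem_interior.2 ⟨⋂ i, {a | 0 < (a : EuclideanSpace ℝ (Fin L)) i}, ?_, ?_, ?_⟩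
  · intro b hb i
    exact (mem_iInter.1 hb i).le
  · exact isOpen_iInter_of_finite fun i => isOpen_lt continuous_const (continuous_coord i)
  · exact mem_iInter.2 fun i => lt_of_le_of_ne (ha.1 i) (Ne.symm (hcon i))

lemma isPosRegion_posSphere : IsPosRegion (posSphere L) :=
  ⟨fun _ ha => ha, sphereMeasure_frontier_posSphere⟩

lemma IsPosRegion.inter_posSphere {A : Set (Metric.sphere (0 : EuclideanSpace ℝ (Fin L)) 1)}
    (hA : sphereMeasure L (frontier A) = 0) : IsPosRegion (A ∩ posSphere L) :=
  ⟨fun _ ha => ha.2, measure_frontier_inter_eq_zero _ hA sphereMeasure_frontier_posSphere⟩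

lemma sphereArea_nonneg (n : ℕ) : 0 ≤ sphereArea n := by
  unfold sphereArea
  have : 0 < Real.Gamma ((n : ℝ) / 2 + 1) := Real.Gamma_pos_of_pos (by positivity)
  have := Real.pi_pos
  positivity

lemma capArea_nonneg (n : ℕ) {d : ℝ} (hd : 0 ≤ d) : 0 ≤ capArea n d := by
  refine mul_nonneg (sphereArea_nonneg _) (intervalIntegral.integral_nonneg
    (Real.arcsin_nonneg.2 (by linarith)) fun x hx => pow_nonneg (Real.sin_nonneg_of_nonneg_of_le_pi
      hx.1 (hx.2.trans ((Real.arcsin_le_pi_div_two _).trans (by linarith [Real.pi_pos])))) _)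

lemma IsSphericalCode.posPart_finite {d : ℝ} {C : Set (EuclideanSpace ℝ (Fin L))}
    (hC : IsSphericalCode d C) : (posPart C).Finite :=
  hC.finite.subset fun _ h => h.1

lemma IsSphericalCode.posPart_eq {d : ℝ} {C : Set (EuclideanSpace ℝ (Fin L))}
    (hC : IsSphericalCode d C) : posPart C = C ∩ Subtype.val '' posSphere L := by
  ext c
  constructor
  · rintro ⟨h1, h2⟩
    exact ⟨h1, ⟨c, by simpa using hC.norm_eq c h1⟩, h2, rfl⟩
  · rintro ⟨h1, a, ha, rfl⟩
    exact ⟨h1, ha⟩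

/-- Equidistribution, upper half: if a family of codes has density at most `δ`, then sums of a
nonnegative continuous function over the codewords are at most the corresponding integral. -/
lemma HasDensityAtMost.sum_le {C : ℝ → Set (EuclideanSpace ℝ (Fin L))} {δ : ℝ}
    (hC : HasDensityAtMost C δ) (hδ : 0 ≤ δ) (hcode : ∀ᶠ d in 𝓝[>] (0 : ℝ), IsSphericalCode d (C d))
    {f : EuclideanSpace ℝ (Fin L) → ℝ} (hf : Continuous f)
    (hf0 : ∀ a ∈ posSphere L, 0 ≤ f a) {ε : ℝ} (hε : 0 < ε) :
    ∀ᶠ d in 𝓝[>] (0 : ℝ), capArea L d * ∑ᶠ c ∈ posPart (C d), f c ≤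
      δ * ∫ a in posSphere L, f a ∂sphereMeasure L + ε := by
  classical
  set σ := sphereMeasure L
  let F : Metric.sphere (0 : EuclideanSpace ℝ (Fin L)) 1 → ℝ := fun a => f a
  have hF : Continuous F := hf.comp continuous_subtype_val
  -- on cells of diameter less than `r` the function varies by at most `ε₁`; it is replaced by its
  -- supremum `M j` on each of them
  set ε₁ := ε / (2 * (δ * σ.real univ + 1)) with hε₁
  have hσ0 : 0 ≤ δ * σ.real univ := mul_nonneg hδ measureReal_nonneg
  have hε₁0 : 0 < ε₁ := by positivity
  obtain ⟨r, hr, hFr⟩ := Metric.uniformContinuous_iff.1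
    (CompactSpace.uniformContinuous_of_continuous hF) ε₁ hε₁0
  obtain ⟨n, A, hA⟩ := exists_isFinePartition σ (half_pos hr)
  let A' : Fin n → Set _ := fun j => A j ∩ posSphere L
  have hA'm : ∀ j, MeasurableSet (A' j) := fun j =>
    (hA.measurableSet j).inter isClosed_posSphere.measurableSet
  let M : Fin n → ℝ := fun j => sSup (F '' A' j)
  have hbdd : ∀ j, BddAbove (F '' A' j) := fun j =>
    (isCompact_univ.image hF).bddAbove.mono (image_mono (subset_univ _))
  have hM : ∀ j, ∀ a ∈ A' j, F a ≤ M j := fun j a ha => le_csSup (hbdd j) ⟨a, ha, rfl⟩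
  have hM0 : ∀ j, 0 ≤ M j := fun j => Real.sSup_nonneg (by
    rintro _ ⟨a, ha, rfl⟩; exact hf0 a ha.2)
  have hM' : ∀ j, ∀ a ∈ A' j, M j ≤ F a + ε₁ := by
    intro j a ha
    refine csSup_le ⟨_, a, ha, rfl⟩ ?_
    rintro _ ⟨b, hb, rfl⟩
    have h1 := hFr (lt_of_le_of_lt (hA.dist_le j b hb.1 a ha.1) (half_lt_self hr))
    rw [Real.dist_eq] at h1
    linarith [(abs_lt.1 h1).2]
  have hint : ∀ s, IntegrableOn F s σ := fun s =>
    (hF.integrable_of_hasCompactSupport (HasCompactSupport.of_compactSpace F)).integrableOn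
  -- Riemann sum against the integral
  have hsum : ∑ j, M j * σ.real (A' j) ≤ ∫ a in posSphere L, F a ∂σ + ε₁ * σ.real univ := by
    have h1 : ∀ j, M j * σ.real (A' j) ≤ ∫ a in A' j, F a ∂σ + ε₁ * σ.real (A' j) := by
      intro j
      have h2 : ∫ _ in A' j, M j ∂σ ≤ ∫ a in A' j, (F a + ε₁) ∂σ :=
        setIntegral_mono_on (integrableOn_const (measure_ne_top _ _))
          ((hint _).add (integrableOn_const (measure_ne_top _ _))) (hA'm j) (hM' j)
      rw [integral_add (hint _) (integrableOn_const (measure_ne_top _ _))] at h2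
      simpa [mul_comm] using h2
    have hdisj : Pairwise fun i j => Disjoint (A' i) (A' j) := fun i j hij =>
      (hA.disjoint hij).mono inter_subset_left inter_subset_left
    have hU : ⋃ j, A' j = posSphere L := by
      ext a
      simp only [A', mem_iUnion, mem_inter_iff]
      constructor
      · rintro ⟨j, -, h⟩; exact h
      · intro h
        obtain ⟨j, hj⟩ := hA.cover a
        exact ⟨j, hj, h⟩
    calc ∑ j, M j * σ.real (A' j) ≤ ∑ j, (∫ a in A' j, F a ∂σ + ε₁ * σ.real (A' j)) :=
          Finset.sum_le_sum fun j _ => h1 j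
      _ = ∫ a in posSphere L, F a ∂σ + ε₁ * σ.real (posSphere L) := by
          rw [Finset.sum_add_distrib, ← Finset.mul_sum, ← hU,
            integral_iUnion_fintype hA'm hdisj fun j => hint _,
            measureReal_iUnion_fintype hdisj hA'm]
      _ ≤ _ := by
          gcongr
          exacts [measure_ne_top _ _, subset_univ _]
  set ε₂ := ε / (2 * (∑ j, M j + 1)) with hε₂
  have hSM : 0 ≤ ∑ j, M j := Finset.sum_nonneg fun j _ => hM0 j
  have hε₂0 : 0 < ε₂ := by positivity
  have hall : ∀ᶠ d in 𝓝[>] (0 : ℝ), ∀ j, capAreaIn d (C d) (A' j) ≤ δ * σ.real (A' j) + ε₂ :=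
    eventually_all.2 fun j => hC (A' j) (IsPosRegion.inter_posSphere (hA.frontier_null j)) ε₂ hε₂0
  filter_upwards [self_mem_nhdsWithin, hcode, hall] with d hd0 hd hdj
  have hcap : 0 ≤ capArea L d := capArea_nonneg L (le_of_lt hd0)
  have hcount : ∑ᶠ c ∈ posPart (C d), f c ≤
      ∑ j, M j * ((C d ∩ Subtype.val '' A' j).ncard : ℝ) := by
    rw [finsum_mem_eq_finite_toFinset_sum _ hd.posPart_finite]
    have h1 : ∀ j, ((C d ∩ Subtype.val '' A' j).ncard : ℝ) =
        ∑ c ∈ hd.posPart_finite.toFinset, if c ∈ Subtype.val '' A' j then (1 : ℝ) else 0 := by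
      intro j
      rw [Finset.sum_boole, ← ncard_coe_finset]
      congr 2
      ext c
      simp only [Finset.coe_filter, Finite.mem_toFinset, mem_ofPred_eq, mem_inter_iff]
      constructor
      · rintro ⟨h1, h2⟩
        refine ⟨?_, h2⟩
        obtain ⟨a, ha, rfl⟩ := h2
        exact ⟨h1, ha.2⟩
      · rintro ⟨h1, h2⟩
        exact ⟨h1.1, h2⟩
    simp_rw [h1, Finset.mul_sum]
    rw [Finset.sum_comm]
    refine Finset.sum_le_sum fun c hc => ?_
    rw [Finite.mem_toFinset, hd.posPart_eq] at hc
    obtain ⟨-, a, ha, rfl⟩ := hc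
    obtain ⟨j, hj⟩ := hA.cover a
    have h2 : a ∈ A' j := ⟨hj, ha⟩
    calc f a ≤ M j := hM j a h2
      _ = M j * (if (a : EuclideanSpace ℝ (Fin L)) ∈ Subtype.val '' A' j then (1 : ℝ) else 0) := by
          rw [if_pos ⟨a, h2, rfl⟩, mul_one]
      _ ≤ _ := Finset.single_le_sum (f := fun j => M j *
            (if (a : EuclideanSpace ℝ (Fin L)) ∈ Subtype.val '' A' j then (1 : ℝ) else 0))
            (fun j _ => mul_nonneg (hM0 j) (by split_ifs <;> norm_num)) (Finset.mem_univ j)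
  calc capArea L d * ∑ᶠ c ∈ posPart (C d), f c
      ≤ capArea L d * ∑ j, M j * ((C d ∩ Subtype.val '' A' j).ncard : ℝ) := by gcongr
    _ = ∑ j, M j * capAreaIn d (C d) (A' j) := by
        rw [Finset.mul_sum]
        exact Finset.sum_congr rfl fun j _ => by rw [capAreaIn]; ring
    _ ≤ ∑ j, M j * (δ * σ.real (A' j) + ε₂) :=
        Finset.sum_le_sum fun j _ => mul_le_mul_of_nonneg_left (hdj j) (hM0 j)
    _ = δ * ∑ j, M j * σ.real (A' j) + (∑ j, M j) * ε₂ := by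
        simp only [mul_add, Finset.sum_add_distrib, Finset.mul_sum, Finset.sum_mul]
        congr 1
        exact Finset.sum_congr rfl fun j _ => by ring
    _ ≤ δ * (∫ a in posSphere L, F a ∂σ + ε₁ * σ.real univ) + (∑ j, M j) * ε₂ := by gcongr
    _ ≤ _ := by
        have h1 : δ * σ.real univ * ε₁ ≤ ε / 2 := by
          rw [hε₁, mul_div_assoc', div_le_iff₀ (by positivity)]
          nlinarith
        have h2 : (∑ j, M j) * ε₂ ≤ ε / 2 := by
          rw [hε₂, mul_div_assoc', div_le_iff₀ (by positivity)]
          nlinarith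
        have h3 : δ * (∫ a in posSphere L, F a ∂σ + ε₁ * σ.real univ) =
          δ * ∫ a in posSphere L, F a ∂σ + δ * σ.real univ * ε₁ := by ring
        rw [h3]
        linarith

lemma HasDensity.hasDensityAtMost {C : ℝ → Set (EuclideanSpace ℝ (Fin L))} {δ : ℝ}
    (hC : HasDensity C δ) : HasDensityAtMost C δ := fun A hA ε hε => by
  filter_upwards [(hC A hA).eventually_lt_const (lt_add_of_pos_right _ hε)] with d hd
  exact hd.le

/-- Equidistribution: if a family of codes has density `δ`, then sums of a continuous function
with values in `[0, 1]` over the codewords converge to the corresponding integral. -/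
lemma HasDensity.tendsto_sum {C : ℝ → Set (EuclideanSpace ℝ (Fin L))} {δ : ℝ}
    (hC : HasDensity C δ) (hδ : 0 ≤ δ) (hcode : ∀ᶠ d in 𝓝[>] (0 : ℝ), IsSphericalCode d (C d))
    {f : EuclideanSpace ℝ (Fin L) → ℝ} (hf : Continuous f)
    (hf0 : ∀ a ∈ posSphere L, 0 ≤ f a) (hf1 : ∀ a ∈ posSphere L, f a ≤ 1) :
    Tendsto (fun d => capArea L d * ∑ᶠ c ∈ posPart (C d), f c) (𝓝[>] 0)
      (𝓝 (δ * ∫ a in posSphere L, f a ∂sphereMeasure L)) := by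
  have hint : IntegrableOn (fun a : Metric.sphere (0 : EuclideanSpace ℝ (Fin L)) 1 => f a)
      (posSphere L) (sphereMeasure L) :=
    ((hf.comp continuous_subtype_val).integrable_of_hasCompactSupport
      (HasCompactSupport.of_compactSpace _)).integrableOn
  have htot := hC _ (isPosRegion_posSphere (L := L))
  rw [Metric.tendsto_nhds]
  intro ε hε
  rw [Metric.tendsto_nhds] at htot
  filter_upwards [hcode, hC.hasDensityAtMost.sum_le hδ hcode hf hf0 (half_pos hε),
    hC.hasDensityAtMost.sum_le hδ hcode (f := fun a => 1 - f a) (continuous_const.sub hf)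
      (fun a ha => by linarith [hf1 a ha]) (half_pos (half_pos hε)),
    htot _ (half_pos (half_pos hε))] with d hd h1 h2 h3
  rw [finsum_mem_eq_finite_toFinset_sum _ hd.posPart_finite] at h1 h2 ⊢
  rw [Finset.sum_sub_distrib] at h2
  rw [integral_sub (integrable_const _) hint] at h2
  simp only [Finset.sum_const, nsmul_eq_mul, mul_one, integral_const, smul_eq_mul,
    measureReal_restrict_apply_univ] at h2
  have e : (hd.posPart_finite.toFinset.card : ℝ) =
      ((C d ∩ Subtype.val '' posSphere L).ncard : ℝ) := by
    rw [← hd.posPart_eq, ncard_eq_toFinset_card _ hd.posPart_finite]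
  rw [Real.dist_eq, abs_lt, capAreaIn] at h3
  rw [Real.dist_eq, abs_lt]
  rw [e, mul_sub, mul_sub] at h2
  change _ ≤ δ * (sphereMeasure L (posSphere L)).toReal - _ + _ at h2
  constructor <;> linarith

end Sphere

/-! ### Asymptotics of caps and the area of the sphere foliated by tori -/

lemma sphereArea_eq (n : ℕ) : sphereArea n = n * ballVol n := by
  rw [sphereArea, ballVol, mul_div_assoc]

/-- A small cap of angular radius `arcsin (d / 2)` is asymptotically a flat ball of
radius `d / 2`. -/
lemma tendsto_capArea_div {n : ℕ} (hn : 2 ≤ n) :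
    Tendsto (fun d => capArea n d / d ^ (n - 1)) (𝓝[>] 0) (𝓝 (ballVol (n - 1) / 2 ^ (n - 1))) := by
  obtain ⟨k, rfl⟩ : ∃ k, n = k + 2 := ⟨n - 2, by omega⟩
  have e1 : k + 2 - 1 = k + 1 := rfl
  have e2 : k + 2 - 2 = k := rfl
  set F : ℝ → ℝ := fun θ => ∫ x in (0 : ℝ)..θ, Real.sin x ^ k with hF
  -- on `[0, θ]` the integrand lies between `((1 - θ²) x)^k` and `x^k`
  have hbound : ∀ θ ∈ Ioo (0 : ℝ) 1, (1 - θ ^ 2) ^ k / (k + 1) ≤ F θ / θ ^ (k + 1) ∧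
      F θ / θ ^ (k + 1) ≤ 1 / (k + 1) := by
    rintro θ ⟨h0, h1⟩
    have hp : 0 < θ ^ (k + 1) := by positivity
    have hi : ∀ c : ℝ, ∫ x in (0 : ℝ)..θ, c * x ^ k = c * (θ ^ (k + 1) / (k + 1)) := by
      intro c
      rw [intervalIntegral.integral_const_mul, integral_pow]
      simp
    constructor
    · rw [le_div_iff₀ hp, div_mul_eq_mul_div, mul_div_assoc, ← hi]
      refine intervalIntegral.integral_mono_on h0.le
        (by apply Continuous.intervalIntegrable; fun_prop)
        (by apply Continuous.intervalIntegrable; fun_prop) fun x hx => ?_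
      rw [← mul_pow]
      have h3 := mul_one_sub_le_abs_sin (t := x) (s := θ ^ 2)
        (pow_le_pow_left₀ hx.1 hx.2 2)
      have h4 : 0 ≤ Real.sin x := Real.sin_nonneg_of_nonneg_of_le_pi hx.1
        (by linarith [hx.2, Real.pi_gt_three])
      rw [abs_of_nonneg hx.1, abs_of_nonneg h4, mul_comm] at h3
      refine pow_le_pow_left₀ (mul_nonneg ?_ hx.1) h3 k
      nlinarith
    · rw [div_le_iff₀ hp, div_mul_eq_mul_div, mul_div_assoc, ← hi]
      refine intervalIntegral.integral_mono_on h0.le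
        (by apply Continuous.intervalIntegrable; fun_prop)
        (by apply Continuous.intervalIntegrable; fun_prop) fun x hx => ?_
      rw [one_mul]
      exact pow_le_pow_left₀ (Real.sin_nonneg_of_nonneg_of_le_pi hx.1
        (by linarith [hx.2, Real.pi_gt_three])) (Real.sin_le hx.1) k
  have hFlim : Tendsto (fun θ => F θ / θ ^ (k + 1)) (𝓝[>] 0) (𝓝 (1 / ((k : ℝ) + 1))) := by
    have hl : Tendsto (fun θ : ℝ => (1 - θ ^ 2) ^ k / ((k : ℝ) + 1)) (𝓝[>] 0)
        (𝓝 (1 / ((k : ℝ) + 1))) := by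
      have : Continuous (fun θ : ℝ => (1 - θ ^ 2) ^ k / ((k : ℝ) + 1)) := by fun_prop
      have := this.tendsto 0
      simp only [ne_eq, OfNat.ofNat_ne_zero, not_false_eq_true, zero_pow, sub_zero, one_pow] at this
      exact this.mono_left nhdsWithin_le_nhds
    refine tendsto_of_tendsto_of_tendsto_of_le_of_le' hl tendsto_const_nhds ?_ ?_
    · filter_upwards [Ioo_mem_nhdsGT one_pos] with θ hθ using (hbound θ hθ).1
    · filter_upwards [Ioo_mem_nhdsGT one_pos] with θ hθ using (hbound θ hθ).2
  have harc : Tendsto (fun d : ℝ => Real.arcsin (d / 2) / d) (𝓝[>] 0) (𝓝 (1 / 2)) := by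
    have h1 : HasDerivAt (fun d : ℝ => Real.arcsin (d / 2)) (1 / 2) 0 := by
      have h2 : HasDerivAt Real.arcsin 1 ((0 : ℝ) / 2) := by
        have := Real.hasDerivAt_arcsin (x := (0 : ℝ) / 2) (by norm_num) (by norm_num)
        simpa using this
      have h3 : HasDerivAt (fun d : ℝ => d / 2) (1 / 2) 0 := (hasDerivAt_id 0).div_const 2
      have h4 := h2.comp 0 h3
      rw [one_mul] at h4
      exact h4
    have h2 := h1.tendsto_slope.mono_left (nhdsWithin_mono 0 (fun x hx => ne_of_gt hx) :
      𝓝[>] (0 : ℝ) ≤ 𝓝[≠] 0)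
    refine h2.congr fun d => ?_
    simp [slope_def_field]
  have harc0 : Tendsto (fun d : ℝ => Real.arcsin (d / 2)) (𝓝[>] 0) (𝓝[>] 0) := by
    refine tendsto_nhdsWithin_iff.2 ⟨?_, ?_⟩
    · have : Continuous fun d : ℝ => Real.arcsin (d / 2) := by fun_prop
      have := this.tendsto 0
      simp only [zero_div, Real.arcsin_zero] at this
      exact this.mono_left nhdsWithin_le_nhds
    · filter_upwards [self_mem_nhdsWithin] with d hd
      exact Real.arcsin_pos.2 (half_pos hd)
  have h := ((hFlim.comp harc0).mul (harc.pow (k + 1))).const_mul (sphereArea (k + 1))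
  rw [e1]
  have hlim : sphereArea (k + 1) * (1 / ((k : ℝ) + 1) * (1 / 2) ^ (k + 1)) =
      ballVol (k + 1) / 2 ^ (k + 1) := by
    rw [sphereArea_eq, div_pow, one_pow]; push_cast; field_simp
  rw [hlim] at h
  refine h.congr' ?_
  filter_upwards [self_mem_nhdsWithin, harc0.eventually self_mem_nhdsWithin] with d hd hd'
  have hd0 : d ≠ 0 := ne_of_gt hd
  have hd1 : Real.arcsin (d / 2) ≠ 0 := ne_of_gt hd'
  simp only [Function.comp_apply, capArea, e1, e2, div_pow, hF]
  field_simp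

lemma integral_Ioi_pow_mul_exp_neg_sq (q : ℕ) :
    ∫ x in Ioi (0 : ℝ), x ^ q * Real.exp (-x ^ 2) = Real.Gamma ((q + 1) / 2) / 2 := by
  have h := integral_rpow_mul_exp_neg_rpow (p := 2) (q := q) two_pos
    (by linarith [(Nat.cast_nonneg q : (0 : ℝ) ≤ q)])
  rw [div_mul_eq_mul_div, one_mul] at h
  rw [← h]
  refine setIntegral_congr_fun measurableSet_Ioi fun x _ => ?_
  simp

/-- Integrating `∏ x_i exp (-|x|²)` over the nonnegative orthant in Cartesian and in polar
coordinates gives `(2π)^L ∫ ∏ a_i = S_(2L)`, the area of `S^(2L-1)` as a union of flat tori. -/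
lemma two_pi_pow_mul_integral_posSphere {L : ℕ} (hL : 0 < L) :
    (2 * Real.pi) ^ L * ∫ a in posSphere L, ∏ i, (a : EuclideanSpace ℝ (Fin L)) i
      ∂sphereMeasure L = sphereArea (2 * L) := by
  classical
  have hne : Nontrivial (EuclideanSpace ℝ (Fin L)) := by
    have : Nonempty (Fin L) := ⟨⟨0, hL⟩⟩
    infer_instance
  have hdim : Module.finrank ℝ (EuclideanSpace ℝ (Fin L)) = L := finrank_euclideanSpace_fin
  set I := ∫ a in posSphere L, ∏ i, (a : EuclideanSpace ℝ (Fin L)) i ∂sphereMeasure L with hI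
  let h : ℝ → ℝ := fun t => (Ioi (0 : ℝ)).indicator (fun t => t * Real.exp (-t ^ 2)) t
  let G : EuclideanSpace ℝ (Fin L) → ℝ := fun x => ∏ i, h (x i)
  have hcart : ∫ x, G x = (1 / 2) ^ L := by
    rw [← (EuclideanSpace.volume_preserving_symm_measurableEquiv_toLp (Fin L)).symm.integral_comp
      (MeasurableEquiv.measurableEmbedding _)]
    have h1 := integral_fintype_prod_volume_eq_prod (fun _ : Fin L => h)
    have h2 : ∫ t, h t = 1 / 2 := by
      have h3 := integral_Ioi_pow_mul_exp_neg_sq 1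
      simp only [h]
      rw [integral_indicator measurableSet_Ioi]
      simpa using h3
    simp only [h2, Finset.prod_const, Finset.card_univ, Fintype.card_fin] at h1
    rw [← h1]
    rfl
  -- polar coordinates: at distance `r` on the ray through `a`, the integrand is the product of a
  -- function of `a` and a function of `r`
  have hpol : ∫ x, G x = I * (Real.Gamma L / 2) := by
    have hnull : volume ({(0 : EuclideanSpace ℝ (Fin L))} : Set _) = 0 := measure_singleton 0
    let g : Metric.sphere (0 : EuclideanSpace ℝ (Fin L)) 1 → ℝ := fun a =>
      ∏ i, (Ioi (0 : ℝ)).indicator id ((a : EuclideanSpace ℝ (Fin L)) i)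
    let k : ℝ → ℝ := fun r => r ^ L * Real.exp (-r ^ 2)
    have hsplit : ∀ (a : Metric.sphere (0 : EuclideanSpace ℝ (Fin L)) 1) (r : ℝ), 0 < r →
        G (r • (a : EuclideanSpace ℝ (Fin L))) = g a * k r := by
      intro a r hr
      by_cases hpos : ∀ i, 0 < (a : EuclideanSpace ℝ (Fin L)) i
      · have h1 : ∑ i, (a : EuclideanSpace ℝ (Fin L)) i ^ 2 = 1 := by
          have h2 : ‖(a : EuclideanSpace ℝ (Fin L))‖ = 1 := by simp
          have h3 := EuclideanSpace.norm_sq_eq (a : EuclideanSpace ℝ (Fin L))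
          rw [h2] at h3
          simpa using h3.symm
        have h4 : ∀ i, h ((r • (a : EuclideanSpace ℝ (Fin L))) i) =
            (a : EuclideanSpace ℝ (Fin L)) i * r *
              Real.exp (-r ^ 2 * (a : EuclideanSpace ℝ (Fin L)) i ^ 2) := by
          intro i
          have : r * (a : EuclideanSpace ℝ (Fin L)) i ∈ Ioi (0 : ℝ) := mul_pos hr (hpos i)
          simp only [h, PiLp.smul_apply, smul_eq_mul]
          rw [indicator_of_mem this]
          ring_nf
        have h5 : ∀ i, (Ioi (0 : ℝ)).indicator id ((a : EuclideanSpace ℝ (Fin L)) i) =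
            (a : EuclideanSpace ℝ (Fin L)) i := fun i =>
          indicator_of_mem (mem_Ioi.2 (hpos i)) id
        simp only [G, g, k, h4, h5, Finset.prod_mul_distrib]
        rw [← Real.exp_sum, ← Finset.mul_sum, h1]
        simp
        ring
      · push Not at hpos
        obtain ⟨i, hi⟩ := hpos
        have h1 : G (r • (a : EuclideanSpace ℝ (Fin L))) = 0 := by
          refine Finset.prod_eq_zero (Finset.mem_univ i) ?_
          refine indicator_of_notMem ?_ _
          simp only [mem_Ioi, not_lt, PiLp.smul_apply, smul_eq_mul]
          exact mul_nonpos_of_nonneg_of_nonpos hr.le hi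
        have h2 : g a = 0 := by
          refine Finset.prod_eq_zero (Finset.mem_univ i) ?_
          exact indicator_of_notMem (by simpa using hi) _
        rw [h1, h2, zero_mul]
    have hg : ∫ a, g a ∂sphereMeasure L = I := by
      rw [hI, ← integral_indicator isClosed_posSphere.measurableSet]
      refine integral_congr_ae (Eventually.of_forall fun a => ?_)
      by_cases ha : a ∈ posSphere L
      · rw [indicator_of_mem ha]
        refine Finset.prod_congr rfl fun i _ => ?_
        rcases (ha i).lt_or_eq with h1 | h1
        · exact indicator_of_mem (mem_Ioi.2 h1) id
        · rw [← h1]; simp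
      · rw [indicator_of_notMem ha]
        simp only [posSphere, mem_ofPred_eq, not_forall, not_le] at ha
        obtain ⟨i, hi⟩ := ha
        exact Finset.prod_eq_zero (Finset.mem_univ i)
          (indicator_of_notMem (by simpa using hi.le) _)
    have hk : ∫ r : Ioi (0 : ℝ), k r ∂Measure.volumeIoiPow (L - 1) = Real.Gamma L / 2 := by
      simp only [Measure.volumeIoiPow, ENNReal.ofReal]
      rw [integral_withDensity_eq_integral_smul (measurable_subtype_coe.pow_const _).real_toNNReal,
        integral_subtype_comap measurableSet_Ioi fun a ↦ Real.toNNReal (a ^ (L - 1)) • k a]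
      have h1 := integral_Ioi_pow_mul_exp_neg_sq (2 * L - 1)
      have h2 : ((((2 * L - 1 : ℕ) : ℝ) + 1) / 2) = L := by
        rw [Nat.cast_sub (by omega)]; push_cast; ring
      rw [h2] at h1
      rw [← h1]
      refine setIntegral_congr_fun measurableSet_Ioi fun x hx => ?_
      simp only [k]
      rw [NNReal.smul_def, Real.coe_toNNReal _ (pow_nonneg (le_of_lt hx) _), smul_eq_mul,
        ← mul_assoc, ← pow_add]
      congr 2
      omega
    calc ∫ x, G x = ∫ x : ({(0)}ᶜ : Set (EuclideanSpace ℝ (Fin L))), G x.1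
          ∂((volume : Measure (EuclideanSpace ℝ (Fin L))).comap (↑)) := by
          rw [integral_subtype_comap (measurableSet_singleton _).compl fun x ↦ G x,
            restrict_compl_singleton]
      _ = ∫ p, g p.1 * k p.2 ∂(sphereMeasure L).prod (.volumeIoiPow (L - 1)) := by
          have h1 := (volume : Measure (EuclideanSpace ℝ (Fin L))
            ).measurePreserving_homeomorphUnitSphereProd.integral_comp
            (Homeomorph.measurableEmbedding _) (fun p => g p.1 * k p.2)
          rw [hdim] at h1
          rw [sphereMeasure, ← h1]
          refine integral_congr_ae (Eventually.of_forall fun x => ?_)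
          simp only
          rw [← hsplit _ _ (homeomorphUnitSphereProd _ x).2.2]
          congr 1
          have := (homeomorphUnitSphereProd (EuclideanSpace ℝ (Fin L))).symm_apply_apply x
          conv_lhs => rw [← this]
          rfl
      _ = _ := by
          rw [integral_prod_mul (fun a => g a) (fun r : Ioi (0 : ℝ) => k r), hg, hk]
  have hpi := Real.pi_pos
  rw [hcart] at hpol
  have hG : 0 < Real.Gamma L := Real.Gamma_pos_of_pos (by exact_mod_cast hL)
  have hIval : I = 2 * (1 / 2) ^ L / Real.Gamma L := by
    rw [eq_div_iff hG.ne', hpol]; ring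
  rw [hIval, sphereArea]
  have h1 : ((2 * L : ℕ) : ℝ) / 2 = L := by push_cast; ring
  have hL' : (L : ℝ) ≠ 0 := by exact_mod_cast hL.ne'
  rw [h1, Real.Gamma_add_one hL', Real.rpow_natCast]
  push_cast
  rw [mul_pow, one_div, inv_pow]
  field_simp

/-! ### The Cartesian product lattice -/

section Product

variable {ι κ : Type*} [Fintype ι] [Fintype κ]

lemma euclidean_sum_norm_sq (x : EuclideanSpace ℝ (ι ⊕ κ)) :
    ‖x‖ ^ 2 = ‖(WithLp.toLp 2 fun i => x (Sum.inl i) : EuclideanSpace ℝ ι)‖ ^ 2 +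
      ‖(WithLp.toLp 2 fun j => x (Sum.inr j) : EuclideanSpace ℝ κ)‖ ^ 2 := by
  simp [EuclideanSpace.norm_sq_eq]

/-- A nonzero vector of the product has a nonzero component, which is no longer than the vector. -/
lemma minDist_prodLattice [Nonempty ι] (Λ : Submodule ℤ (EuclideanSpace ℝ ι))
    [DiscreteTopology Λ] [IsZLattice ℝ Λ] (Λ' : Submodule ℤ (EuclideanSpace ℝ κ))
    (h : minDist Λ' = minDist Λ) : minDist (prodLattice Λ Λ') = minDist Λ := by
  have hin : ∀ y ∈ Λ, y ≠ 0 → minDist (prodLattice Λ Λ') ≤ ‖y‖ := by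
    intro y hy hy0
    let x : EuclideanSpace ℝ (ι ⊕ κ) := WithLp.toLp 2 (Sum.elim y 0)
    have hx : x ∈ prodLattice Λ Λ' := ⟨hy, Λ'.zero_mem⟩
    have hn : ‖x‖ = ‖y‖ := by
      rw [← sq_eq_sq₀ (norm_nonneg _) (norm_nonneg _), euclidean_sum_norm_sq]
      simp [x, EuclideanSpace.norm_sq_eq]
    rw [← hn]
    refine minDist_le _ hx fun h0 => hy0 ?_
    rw [← norm_eq_zero, ← hn, h0, norm_zero]
  obtain ⟨y, hy, hy0⟩ := exists_ne_zero_mem Λ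
  apply le_antisymm
  · refine le_csInf ⟨_, y, hy, hy0, rfl⟩ ?_
    rintro _ ⟨y, hy, hy0, rfl⟩
    exact hin y hy hy0
  · refine le_csInf ⟨_, (WithLp.toLp 2 (Sum.elim y 0) : EuclideanSpace ℝ (ι ⊕ κ)),
      ⟨hy, Λ'.zero_mem⟩, fun h0 => hy0 ?_, rfl⟩ ?_
    · ext i
      have := congrArg (fun z : EuclideanSpace ℝ (ι ⊕ κ) => z (Sum.inl i)) h0
      simpa using this
    · rintro _ ⟨x, hx, hx0, rfl⟩
      have hsq := euclidean_sum_norm_sq x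
      set a := (WithLp.toLp 2 fun i => x (Sum.inl i) : EuclideanSpace ℝ ι)
      set b := (WithLp.toLp 2 fun j => x (Sum.inr j) : EuclideanSpace ℝ κ)
      by_cases ha : a = 0
      · have hb : b ≠ 0 := by
          rintro hb
          apply hx0
          rw [← norm_eq_zero, ← sq_eq_zero_iff, hsq, ha, hb]
          simp
        calc minDist Λ = minDist Λ' := h.symm
          _ ≤ ‖b‖ := minDist_le _ hx.2 hb
          _ ≤ ‖x‖ := by
            rw [← sq_le_sq₀ (norm_nonneg _) (norm_nonneg _), hsq]
            exact le_add_of_nonneg_left (sq_nonneg _)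
      · calc minDist Λ ≤ ‖a‖ := minDist_le _ hx.1 ha
          _ ≤ ‖x‖ := by
            rw [← sq_le_sq₀ (norm_nonneg _) (norm_nonneg _), hsq]
            exact le_add_of_nonneg_right (sq_nonneg _)

lemma existsUnique_add_mem_fundamentalDomain {E : Type*} [NormedAddCommGroup E]
    [NormedSpace ℝ E] [FiniteDimensional ℝ E] (Λ : Submodule ℤ E) [DiscreteTopology Λ]
    [IsZLattice ℝ Λ] (x : E) : ∃! v : E, v ∈ Λ ∧
      v + x ∈ ZSpan.fundamentalDomain ((Module.Free.chooseBasis ℤ Λ).ofZLatticeBasis ℝ) := by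
  set b := (Module.Free.chooseBasis ℤ Λ).ofZLatticeBasis ℝ
  have hspan : Submodule.span ℤ (Set.range b) = Λ :=
    Module.Basis.ofZLatticeBasis_span ℝ Λ (Module.Free.chooseBasis ℤ Λ)
  obtain ⟨v, hv, huniq⟩ := ZSpan.exist_unique_vadd_mem_fundamentalDomain b x
  refine ⟨v, ⟨hspan.le v.2, hv⟩, fun w hw => ?_⟩
  exact congrArg Subtype.val (huniq ⟨w, hspan.ge hw.1⟩ hw.2)

/-- The product of fundamental domains is a fundamental domain of the product lattice. -/
lemma covolume_prodLattice (Λ : Submodule ℤ (EuclideanSpace ℝ ι)) [DiscreteTopology Λ]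
    [IsZLattice ℝ Λ] (Λ' : Submodule ℤ (EuclideanSpace ℝ κ)) [DiscreteTopology Λ']
    [IsZLattice ℝ Λ'] :
    ZLattice.covolume (prodLattice Λ Λ') = ZLattice.covolume Λ * ZLattice.covolume Λ' := by
  set D := ZSpan.fundamentalDomain ((Module.Free.chooseBasis ℤ Λ).ofZLatticeBasis ℝ)
  set D' := ZSpan.fundamentalDomain ((Module.Free.chooseBasis ℤ Λ').ofZLatticeBasis ℝ)
  have hDm : MeasurableSet D := ZSpan.fundamentalDomain_measurableSet _
  have hDm' : MeasurableSet D' := ZSpan.fundamentalDomain_measurableSet _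
  rw [ZLattice.covolume_eq_measure_fundamentalDomain Λ volume
      (ZLattice.isAddFundamentalDomain (Module.Free.chooseBasis ℤ Λ) volume),
    ZLattice.covolume_eq_measure_fundamentalDomain Λ' volume
      (ZLattice.isAddFundamentalDomain (Module.Free.chooseBasis ℤ Λ') volume)]
  let T : Set (EuclideanSpace ℝ (ι ⊕ κ)) := {x | WithLp.toLp 2 (fun i => x (Sum.inl i)) ∈ D ∧
    WithLp.toLp 2 (fun j => x (Sum.inr j)) ∈ D'}
  have hmeas : MeasurableSet T :=
    (hDm.preimage (f := fun x : EuclideanSpace ℝ (ι ⊕ κ) =>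
      (WithLp.toLp 2 (fun i => x (Sum.inl i)) : EuclideanSpace ℝ ι))
      (by apply Continuous.measurable; fun_prop)).inter
    (hDm'.preimage (f := fun x : EuclideanSpace ℝ (ι ⊕ κ) =>
      (WithLp.toLp 2 (fun j => x (Sum.inr j)) : EuclideanSpace ℝ κ))
      (by apply Continuous.measurable; fun_prop))
  have hT : volume T = volume D * volume D' := by
    have h1 := EuclideanSpace.volume_preserving_symm_measurableEquiv_toLp ι
    have h2 := EuclideanSpace.volume_preserving_symm_measurableEquiv_toLp κ
    have h3 := EuclideanSpace.volume_preserving_symm_measurableEquiv_toLp (ι ⊕ κ)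
    have h4 := volume_measurePreserving_sumPiEquivProdPi (fun _ : ι ⊕ κ => ℝ)
    let P : Set (ι → ℝ) := (MeasurableEquiv.toLp 2 (ι → ℝ)) ⁻¹' D
    let P' : Set (κ → ℝ) := (MeasurableEquiv.toLp 2 (κ → ℝ)) ⁻¹' D'
    have hP : volume P = volume D := h1.symm.measure_preimage hDm.nullMeasurableSet
    have hP' : volume P' = volume D' := h2.symm.measure_preimage hDm'.nullMeasurableSet
    have hPm : MeasurableSet P := (MeasurableEquiv.measurable _) hDm
    have hPm' : MeasurableSet P' := (MeasurableEquiv.measurable _) hDm'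
    rw [← hP, ← hP', ← Measure.prod_prod, ← Measure.volume_eq_prod,
      ← h4.measure_preimage (hPm.prod hPm').nullMeasurableSet,
      ← h3.measure_preimage ((MeasurableEquiv.measurable _) (hPm.prod hPm')).nullMeasurableSet]
    rfl
  have hcount : Countable (prodLattice Λ Λ') := by
    let f : prodLattice Λ Λ' → Λ × Λ' := fun x => (⟨_, x.2.1⟩, ⟨_, x.2.2⟩)
    refine Function.Injective.countable (f := f) fun x y hxy => Subtype.ext ?_
    have h1 := congrArg (fun z => (z.1 : EuclideanSpace ℝ ι)) hxy
    have h2 := congrArg (fun z => (z.2 : EuclideanSpace ℝ κ)) hxy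
    ext (i | j)
    · exact congrArg (fun z : EuclideanSpace ℝ ι => z i) h1
    · exact congrArg (fun z : EuclideanSpace ℝ κ => z j) h2
  have hfund : IsAddFundamentalDomain (prodLattice Λ Λ') T volume := by
    refine IsAddFundamentalDomain.mk' hmeas.nullMeasurableSet fun x => ?_
    obtain ⟨v, ⟨hv, hvD⟩, hvu⟩ := existsUnique_add_mem_fundamentalDomain Λ
      (WithLp.toLp 2 (fun i => x (Sum.inl i)))
    obtain ⟨w, ⟨hw, hwD⟩, hwu⟩ := existsUnique_add_mem_fundamentalDomain Λ'
      (WithLp.toLp 2 (fun j => x (Sum.inr j)))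
    refine ⟨⟨WithLp.toLp 2 (Sum.elim v w), hv, hw⟩, ⟨hvD, hwD⟩, ?_⟩
    rintro ⟨g, hg⟩ ⟨hg1, hg2⟩
    have e1 := hvu _ ⟨hg.1, hg1⟩
    have e2 := hwu _ ⟨hg.2, hg2⟩
    apply Subtype.ext
    ext (i | j)
    · exact congrArg (fun z : EuclideanSpace ℝ ι => z i) e1
    · exact congrArg (fun z : EuclideanSpace ℝ κ => z j) e2
  have hinv : VAddInvariantMeasure (prodLattice Λ Λ') (EuclideanSpace ℝ (ι ⊕ κ)) volume :=
    (inferInstance : VAddInvariantMeasure (prodLattice Λ Λ').toAddSubgroup _ _)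
  have hmv : MeasurableVAdd (prodLattice Λ Λ') (EuclideanSpace ℝ (ι ⊕ κ)) :=
    (inferInstance : MeasurableVAdd (prodLattice Λ Λ').toAddSubgroup _)
  rw [ZLattice.covolume, hfund.covolume_eq_volume, hT, ENNReal.toReal_mul]
  rfl

end Product

lemma latticeDensity_eq_of_minDist {ι : Type*} [Fintype ι] {Λ : Submodule ℤ (EuclideanSpace ℝ ι)}
    (h : minDist Λ = 2) :
    latticeDensity Λ = ballVol (Fintype.card ι) / ZLattice.covolume Λ := by
  rw [latticeDensity, h]; simp

lemma latticeDensity_prodLattice {L M : ℕ} (hL : 0 < L)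
    (ΛL : Submodule ℤ (EuclideanSpace ℝ (Fin L))) [DiscreteTopology ΛL] [IsZLattice ℝ ΛL]
    (ΛM : Submodule ℤ (EuclideanSpace ℝ (Fin M))) [DiscreteTopology ΛM] [IsZLattice ℝ ΛM]
    (hL2 : minDist ΛL = 2) (hM2 : minDist ΛM = 2) :
    latticeDensity (prodLattice ΛL ΛM) =
      ballVol (L + M) / (ZLattice.covolume ΛL * ZLattice.covolume ΛM) := by
  have : Nonempty (Fin L) := ⟨⟨0, hL⟩⟩
  rw [latticeDensity_eq_of_minDist ((minDist_prodLattice ΛL ΛM (by rw [hL2, hM2])).trans hL2),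
    covolume_prodLattice, Fintype.card_sum, Fintype.card_fin, Fintype.card_fin]

/-! ### Density of torus layer codes -/

lemma ncard_biUnion_finset {ι α : Type*} (s : Finset ι) (t : ι → Set α)
    (hfin : ∀ i ∈ s, (t i).Finite) (hdisj : (s : Set ι).PairwiseDisjoint t) :
    (⋃ i ∈ s, t i).ncard = ∑ i ∈ s, (t i).ncard := by
  classical
  induction s using Finset.induction_on with
  | empty => simp
  | insert i s hi ih =>
    have hf : (⋃ j ∈ s, t j).Finite :=
      Set.Finite.biUnion' (s.finite_toSet) fun j hj => hfin j (Finset.mem_insert_of_mem hj)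
    rw [Finset.set_biUnion_insert, Finset.sum_insert hi, ncard_union_eq ?_
      (hfin i (Finset.mem_insert_self i s)) hf, ih]
    · exact fun j hj => hfin j (Finset.mem_insert_of_mem hj)
    · exact hdisj.subset (by simp)
    · rw [Set.disjoint_iUnion₂_right]
      intro j hj
      exact hdisj (by simp) (by simp [hj]) (by rintro rfl; exact hi hj)

lemma torusMap_radius {L : ℕ} (c u : EuclideanSpace ℝ (Fin L)) (i : Fin L) :
    torusMap c u (i, 0) ^ 2 + torusMap c u (i, 1) ^ 2 = c i ^ 2 := by
  simp only [torusMap, if_true, one_ne_zero, if_false]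
  linear_combination c i ^ 2 * Real.sin_sq_add_cos_sq (u i / c i)

/-- The layers of a torus layer code are disjoint, and the torus map is injective on each. -/
lemma ncard_layeredCode {L : ℕ} (hL : 0 < L) {d : ℝ} (hd : 0 < d)
    {C : Set (EuclideanSpace ℝ (Fin L))} (hC : IsSphericalCode d C)
    {Y : EuclideanSpace ℝ (Fin L) → Set (EuclideanSpace ℝ (Fin L))}
    (hY : ∀ c ∈ posPart C, IsLatticeLayer d c (Y c)) :
    (layeredCode C Y).ncard = ∑ c ∈ hC.posPart_finite.toFinset, (Y c).ncard := by
  have hfin : ∀ c ∈ posPart C, (Y c).Finite := fun c hc =>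
    ((hY c hc).finite_and_ncard_le hd hL (hC.norm_eq c hc.1) hc.2).1
  have h1 : layeredCode C Y = ⋃ c ∈ hC.posPart_finite.toFinset, torusMap c '' Y c := by
    simp [layeredCode]
  rw [h1, ncard_biUnion_finset]
  · refine Finset.sum_congr rfl fun c hc => InjOn.ncard_image fun x hx y hy hxy => ?_
    by_contra hne
    have h2 := (hY c (by simpa using hc)).2 hx hy hne
    simp only [hxy, dist_self] at h2
    linarith
  · intro c hc
    exact (hfin c (by simpa using hc)).image _
  · intro c hc c' hc' hne
    refine Set.disjoint_left.2 ?_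
    rintro _ ⟨x, -, rfl⟩ ⟨y, -, hxy⟩
    apply hne
    have hc0 : c ∈ posPart C := by simpa using hc
    have hc0' : c' ∈ posPart C := by simpa using hc'
    ext i
    have h3 := torusMap_radius c x i
    rw [← hxy, torusMap_radius] at h3
    exact ((sq_eq_sq₀ (hc0'.2 i) (hc0.2 i)).1 h3).symm

section Asymptotics

variable {L : ℕ}

lemma prod_coord_nonneg {a : Metric.sphere (0 : EuclideanSpace ℝ (Fin L)) 1}
    (ha : a ∈ posSphere L) : 0 ≤ ∏ i, (a : EuclideanSpace ℝ (Fin L)) i :=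
  Finset.prod_nonneg fun i _ => ha i

lemma prod_coord_le_one {a : Metric.sphere (0 : EuclideanSpace ℝ (Fin L)) 1}
    (ha : a ∈ posSphere L) : ∏ i, (a : EuclideanSpace ℝ (Fin L)) i ≤ 1 :=
  Finset.prod_le_one (fun i _ => ha i) fun i _ => coord_le_one (by simp) i

/-- The comparison of caps in dimensions `2 L` and `L`. -/
lemma tendsto_capArea_ratio (hL : 2 ≤ L) :
    Tendsto (fun d => capArea (2 * L) d / (d ^ L * capArea L d)) (𝓝[>] 0)
      (𝓝 (ballVol (2 * L - 1) / (ballVol (L - 1) * 2 ^ L))) := by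
  have h1 := tendsto_capArea_div (n := 2 * L) (by omega)
  have h2 := tendsto_capArea_div hL
  have hb := ballVol_pos (L - 1)
  have h3 := h1.div h2 (by positivity)
  have e : 2 * L - 1 = L + (L - 1) := by omega
  have hlim : ballVol (2 * L - 1) / 2 ^ (2 * L - 1) / (ballVol (L - 1) / 2 ^ (L - 1)) =
      ballVol (2 * L - 1) / (ballVol (L - 1) * 2 ^ L) := by
    have : (2 : ℝ) ^ (2 * L - 1) = 2 ^ L * 2 ^ (L - 1) := by rw [e, pow_add]
    rw [this]
    field_simp
  rw [hlim] at h3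
  refine h3.congr' ?_
  filter_upwards [self_mem_nhdsWithin] with d hd
  have hd0 : d ≠ 0 := ne_of_gt hd
  have : d ^ (2 * L - 1) = d ^ L * d ^ (L - 1) := by rw [e, pow_add]
  simp only [Pi.div_apply]
  rw [this, div_div_div_eq, mul_comm (d ^ L), mul_assoc, mul_comm (capArea (2 * L) d),
    mul_div_mul_left _ _ (pow_ne_zero _ hd0)]

lemma eventually_capArea_pos (hL : 2 ≤ L) : ∀ᶠ d in 𝓝[>] (0 : ℝ), 0 < capArea L d := by
  have hb := ballVol_pos (L - 1)
  filter_upwards [(tendsto_capArea_div hL).eventually_const_lt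
    (by positivity : (0 : ℝ) < ballVol (L - 1) / 2 ^ (L - 1)), self_mem_nhdsWithin] with d h hd
  exact (div_pos_iff_of_pos_right (pow_pos hd _)).1 h

/-- The density of a torus layer code in terms of the weighted count of its layers. -/
lemma sphericalDensity_layeredCode (hL : 0 < L) {d : ℝ} (hd : 0 < d) (hcap : 0 < capArea L d)
    {C : Set (EuclideanSpace ℝ (Fin L))} (hC : IsSphericalCode d C)
    {Y : EuclideanSpace ℝ (Fin L) → Set (EuclideanSpace ℝ (Fin L))}
    (hY : ∀ c ∈ posPart C, IsLatticeLayer d c (Y c)) :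
    sphericalDensity (2 * L) d (layeredCode C Y) =
      capArea (2 * L) d / (d ^ L * capArea L d) / sphereArea (2 * L) *
        (capArea L d * ∑ᶠ c ∈ posPart C, d ^ L * ((Y c).ncard : ℝ)) := by
  rw [sphericalDensity, ncard_layeredCode hL hd hC hY,
    finsum_mem_eq_finite_toFinset_sum _ hC.posPart_finite, ← Finset.mul_sum]
  push_cast
  field_simp

/-- Integrating the predicted size of the layers over the nonnegative part of the sphere yields the
density of the product lattice. -/
lemma density_constant_eq (hL : 2 ≤ L)
    (ΛL : Submodule ℤ (EuclideanSpace ℝ (Fin L))) [DiscreteTopology ΛL] [IsZLattice ℝ ΛL]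
    (ΛM : Submodule ℤ (EuclideanSpace ℝ (Fin (L - 1)))) [DiscreteTopology ΛM] [IsZLattice ℝ ΛM]
    (hL2 : minDist ΛL = 2) (hM2 : minDist ΛM = 2) :
    ballVol (2 * L - 1) / (ballVol (L - 1) * 2 ^ L) / sphereArea (2 * L) *
      (latticeDensity ΛM * ∫ a in posSphere L, 2 ^ L / ZLattice.covolume ΛL *
        ∏ i, (2 * Real.pi * (a : EuclideanSpace ℝ (Fin L)) i) ∂sphereMeasure L) =
      latticeDensity (prodLattice ΛL ΛM) := by
  have hS : 0 < sphereArea (2 * L) := by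
    rw [sphereArea_eq]
    have := ballVol_pos (2 * L)
    have : (0 : ℝ) < (2 * L : ℕ) := by exact_mod_cast (by omega)
    positivity
  have hb := ballVol_pos (L - 1)
  have hVL := ZLattice.covolume_pos ΛL volume
  have hVM := ZLattice.covolume_pos ΛM volume
  have hI := two_pi_pow_mul_integral_posSphere (L := L) (by omega)
  have e : 2 * L - 1 = L + (L - 1) := by omega
  rw [latticeDensity_prodLattice (by omega) ΛL ΛM hL2 hM2, ← e,
    latticeDensity_eq_of_minDist hM2, Fintype.card_fin, integral_const_mul]
  simp only [Finset.prod_mul_distrib (f := fun _ : Fin L => 2 * Real.pi), Finset.prod_const,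
    Finset.card_univ, Fintype.card_fin]
  rw [integral_const_mul, hI]
  field_simp

/-- The asymptotic upper bound: the uniform bound `layer_upper_bound` on the layers is summed over
the code by `HasDensityAtMost.sum_le`. -/
theorem eventually_sphericalDensity_le (hL : 2 ≤ L)
    (ΛL : Submodule ℤ (EuclideanSpace ℝ (Fin L))) [DiscreteTopology ΛL] [IsZLattice ℝ ΛL]
    (ΛM : Submodule ℤ (EuclideanSpace ℝ (Fin (L - 1)))) [DiscreteTopology ΛM] [IsZLattice ℝ ΛM]
    (hΛL : IsDensest ΛL) (hL2 : minDist ΛL = 2) (hM2 : minDist ΛM = 2)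
    {C : ℝ → Set (EuclideanSpace ℝ (Fin L))} {X : ℝ → Set (EuclideanSpace ℝ (Fin L × Fin 2))}
    (hX : ∀ᶠ d in 𝓝[>] (0 : ℝ), IsLatticeTLSC d (C d) (X d))
    (hC : HasDensityAtMost C (latticeDensity ΛM)) {ε : ℝ} (hε : 0 < ε) :
    ∀ᶠ d in 𝓝[>] (0 : ℝ), sphericalDensity (2 * L) d (X d) ≤
      latticeDensity (prodLattice ΛL ΛM) + ε := by
  set δ := latticeDensity ΛM
  have hδ : 0 < δ := by
    rw [show δ = _ from latticeDensity_eq_of_minDist hM2]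
    exact div_pos (ballVol_pos _) (ZLattice.covolume_pos ΛM volume)
  set R₀ := ballVol (2 * L - 1) / (ballVol (L - 1) * 2 ^ L) / sphereArea (2 * L)
  have hR : Tendsto (fun d => capArea (2 * L) d / (d ^ L * capArea L d) / sphereArea (2 * L))
    (𝓝[>] 0) (𝓝 R₀) := (tendsto_capArea_ratio hL).div_const _
  set V := ZLattice.covolume ΛL
  have hV : 0 < V := ZLattice.covolume_pos ΛL volume
  let f : EuclideanSpace ℝ (Fin L) → ℝ := fun a => 2 ^ L / V * ∏ i, (2 * Real.pi * a i)
  set T₀ := δ * ∫ a in posSphere L, f a ∂sphereMeasure L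
  have hconst : R₀ * T₀ = latticeDensity (prodLattice ΛL ΛM) :=
    density_constant_eq hL ΛL ΛM hL2 hM2
  have hf : Continuous f := by fun_prop
  have hf0 : ∀ a ∈ posSphere L, 0 ≤ f a := fun a ha => mul_nonneg (by positivity)
    (Finset.prod_nonneg fun i _ => mul_nonneg (by positivity) (ha i))
  -- slack `s` in the weighted count, small compared with `ε`
  obtain ⟨s, hs0, hs⟩ : ∃ s > 0, R₀ * (T₀ + s) < R₀ * T₀ + ε := by
    have h1 : Tendsto (fun s : ℝ => R₀ * (T₀ + s)) (𝓝[>] 0) (𝓝 (R₀ * (T₀ + 0))) :=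
      ((continuous_const.mul (continuous_const.add continuous_id)).tendsto 0).mono_left
        nhdsWithin_le_nhds
    rw [add_zero] at h1
    obtain ⟨s, h2, h3⟩ := ((h1.eventually_lt_const (lt_add_of_pos_right _ hε)).and
      self_mem_nhdsWithin).exists
    exact ⟨s, h3, h2⟩
  set σ₀ := (sphereMeasure L).real (posSphere L)
  have hσ₀ : 0 ≤ σ₀ := measureReal_nonneg
  set s₁ := s / (2 * (δ * σ₀ + 1))
  have hs₁ : 0 < s₁ := by positivity
  have hcode : ∀ᶠ d in 𝓝[>] (0 : ℝ), IsSphericalCode d (C d) := hX.mono fun d h => h.1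
  have hsum := hC.sum_le hδ.le hcode (f := fun a => f a + s₁) (hf.add continuous_const)
    (fun a ha => add_nonneg (hf0 a ha) hs₁.le) (half_pos hs0)
  have hint : ∫ a in posSphere L, (f a + s₁) ∂sphereMeasure L =
      ∫ a in posSphere L, f a ∂sphereMeasure L + s₁ * σ₀ := by
    rw [integral_add _ (integrable_const _)]
    · simp [σ₀, mul_comm]
    · exact ((hf.comp continuous_subtype_val).integrable_of_hasCompactSupport
        (HasCompactSupport.of_compactSpace _)).integrableOn
  have hslack : δ * (∫ a in posSphere L, (f a + s₁) ∂sphereMeasure L) + s / 2 ≤ T₀ + s := by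
    have : δ * σ₀ * s₁ ≤ s / 2 := by
      rw [mul_div_assoc', div_le_iff₀ (by positivity)]
      nlinarith
    rw [hint, mul_add]
    linarith
  filter_upwards [self_mem_nhdsWithin, hX, hsum, eventually_capArea_pos hL,
    eventually_capArea_pos (L := 2 * L) (by omega),
    layer_upper_bound (by omega) ΛL hΛL hL2 hs₁,
    (hR.mul_const (T₀ + s)).eventually_lt_const hs] with d hd0 hXd hsd hcap hcap2 hlay hlt
  have hd : 0 < d := hd0
  obtain ⟨hCd, Y, hY, hXY⟩ := hXd
  rw [hXY, sphericalDensity_layeredCode (by omega) hd hcap hCd hY, ← hconst]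
  refine le_trans (mul_le_mul_of_nonneg_left ?_ ?_) hlt.le
  · refine le_trans (mul_le_mul_of_nonneg_left ?_ hcap.le) (hsd.trans hslack)
    rw [finsum_mem_eq_finite_toFinset_sum _ hCd.posPart_finite,
      finsum_mem_eq_finite_toFinset_sum _ hCd.posPart_finite]
    refine Finset.sum_le_sum fun c hc => ?_
    have hc' : c ∈ posPart (C d) := by simpa using hc
    exact hlay c (hCd.norm_eq c hc'.1) hc'.2 _ (hY c hc')
  · exact div_nonneg (div_nonneg hcap2.le (by positivity)) (sphereArea_nonneg _)

/-- The limit: the lower bound comes from `layer_lower_bound`, summed over the code by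
`HasDensity.tendsto_sum`. -/
theorem tendsto_sphericalDensity (hL : 2 ≤ L)
    (ΛL : Submodule ℤ (EuclideanSpace ℝ (Fin L))) [DiscreteTopology ΛL] [IsZLattice ℝ ΛL]
    (ΛM : Submodule ℤ (EuclideanSpace ℝ (Fin (L - 1)))) [DiscreteTopology ΛM] [IsZLattice ℝ ΛM]
    (hΛL : IsDensest ΛL) (hL2 : minDist ΛL = 2) (hM2 : minDist ΛM = 2)
    {C : ℝ → Set (EuclideanSpace ℝ (Fin L))} {X : ℝ → Set (EuclideanSpace ℝ (Fin L × Fin 2))}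
    (hX : ∀ᶠ d in 𝓝[>] (0 : ℝ), IsLargestLatticeTLSC d (C d) (X d))
    (hC : HasDensity C (latticeDensity ΛM)) :
    Tendsto (fun d => sphericalDensity (2 * L) d (X d)) (𝓝[>] (0 : ℝ))
      (𝓝 (latticeDensity (prodLattice ΛL ΛM))) := by
  set δ := latticeDensity ΛM
  have hδ : 0 < δ := by
    rw [show δ = _ from latticeDensity_eq_of_minDist hM2]
    exact div_pos (ballVol_pos _) (ZLattice.covolume_pos ΛM volume)
  have hX' : ∀ᶠ d in 𝓝[>] (0 : ℝ), IsLatticeTLSC d (C d) (X d) := hX.mono fun d h =>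
    ⟨h.1, h.2.choose, fun c hc => (h.2.choose_spec.1 c hc).1, h.2.choose_spec.2⟩
  rw [Metric.tendsto_nhds]
  intro ε hε
  set R₀ := ballVol (2 * L - 1) / (ballVol (L - 1) * 2 ^ L) / sphereArea (2 * L)
  have hR : Tendsto (fun d => capArea (2 * L) d / (d ^ L * capArea L d) / sphereArea (2 * L))
    (𝓝[>] 0) (𝓝 R₀) := (tendsto_capArea_ratio hL).div_const _
  set V := ZLattice.covolume ΛL
  have hV : 0 < V := ZLattice.covolume_pos ΛL volume
  let p : EuclideanSpace ℝ (Fin L) → ℝ := fun a => ∏ i, a i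
  set κ := 2 ^ L / V * (2 * Real.pi) ^ L
  have hκ : ∀ a : EuclideanSpace ℝ (Fin L),
      2 ^ L / V * ∏ i, (2 * Real.pi * a i) = κ * p a := by
    intro a
    simp only [κ, p, Finset.prod_mul_distrib, Finset.prod_const, Finset.card_univ,
      Fintype.card_fin]
    ring
  set A₀ := δ * ∫ a in posSphere L, p a ∂sphereMeasure L
  have hconst : R₀ * (κ * A₀) = latticeDensity (prodLattice ΛL ΛM) := by
    rw [← density_constant_eq hL ΛL ΛM hL2 hM2]
    rw [show ZLattice.covolume ΛL volume = V from rfl]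
    simp_rw [hκ]
    rw [integral_const_mul]
    simp only [A₀]
    ring
  have hcode : ∀ᶠ d in 𝓝[>] (0 : ℝ), IsSphericalCode d (C d) := hX.mono fun d h => h.1
  have hA := hC.tendsto_sum hδ.le hcode (f := p) (by fun_prop)
    (fun a ha => prod_coord_nonneg ha) (fun a ha => prod_coord_le_one ha)
  set N₀ := δ * (sphereMeasure L (posSphere L)).toReal
  have hN := hC _ (isPosRegion_posSphere (L := L))
  -- loss `s` per layer, small compared with `ε`
  obtain ⟨s, hs0, hs⟩ : ∃ s > 0, R₀ * (κ * A₀) - ε < R₀ * (κ * A₀ - s * N₀) := by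
    have h1 : Tendsto (fun s : ℝ => R₀ * (κ * A₀ - s * N₀)) (𝓝[>] 0)
        (𝓝 (R₀ * (κ * A₀ - 0 * N₀))) := by
      have : Continuous fun s : ℝ => R₀ * (κ * A₀ - s * N₀) := by fun_prop
      exact (this.tendsto 0).mono_left nhdsWithin_le_nhds
    rw [zero_mul, sub_zero] at h1
    obtain ⟨s, h2, h3⟩ := ((h1.eventually_const_lt (sub_lt_self _ hε)).and
      self_mem_nhdsWithin).exists
    exact ⟨s, h3, h2⟩
  have hlim := hR.mul ((hA.const_mul κ).sub (hN.const_mul s))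
  filter_upwards [self_mem_nhdsWithin, hX, eventually_capArea_pos hL,
    eventually_capArea_pos (L := 2 * L) (by omega),
    layer_lower_bound (by omega) ΛL hL2 hs0, hlim.eventually_const_lt hs,
    eventually_sphericalDensity_le hL ΛL ΛM hΛL hL2 hM2 hX' hC.hasDensityAtMost (half_pos hε)]
    with d hd0 hXd hcap hcap2 hlay hlt hup
  have hd : 0 < d := hd0
  obtain ⟨hCd, Y, hY, hXY⟩ := hXd
  have hlow : R₀ * (κ * A₀) - ε < sphericalDensity (2 * L) d (X d) := by
    refine hlt.trans_le ?_
    rw [hXY, sphericalDensity_layeredCode (by omega) hd hcap hCd fun c hc => (hY c hc).1]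
    refine mul_le_mul_of_nonneg_left ?_
      (div_nonneg (div_nonneg hcap2.le (by positivity)) (sphereArea_nonneg _))
    have h1 : capAreaIn d (C d) (posSphere L) =
        capArea L d * ∑ _c ∈ hCd.posPart_finite.toFinset, (1 : ℝ) := by
      rw [capAreaIn, ← hCd.posPart_eq, ncard_eq_toFinset_card _ hCd.posPart_finite]
      simp
    rw [h1, finsum_mem_eq_finite_toFinset_sum _ hCd.posPart_finite,
      finsum_mem_eq_finite_toFinset_sum _ hCd.posPart_finite, mul_left_comm κ, mul_left_comm s,
      ← mul_sub, Finset.mul_sum, Finset.mul_sum, ← Finset.sum_sub_distrib]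
    refine mul_le_mul_of_nonneg_left (Finset.sum_le_sum fun c hc => ?_) hcap.le
    have hc' : c ∈ posPart (C d) := by simpa using hc
    rw [← hκ, mul_one]
    exact hlay c (hCd.norm_eq c hc'.1) hc'.2 _ (hY c hc')
  rw [hconst] at hlow
  rw [Real.dist_eq, abs_lt]
  constructor <;> linarith

end Asymptotics

/-! ### Gnomonic charts of the sphere -/

section Gnomonic

variable {M : ℕ}

/-- The point `(1, v)` of the affine hyperplane tangent to the unit sphere of `ℝ × ℝᴹ`. -/
def tangentPoint (v : EuclideanSpace ℝ (Fin M)) : EuclideanSpace ℝ (Fin (M + 1)) :=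
  WithLp.toLp 2 (Fin.cons 1 fun i => v i)

lemma tangentPoint_zero (v : EuclideanSpace ℝ (Fin M)) : tangentPoint v 0 = 1 := rfl

lemma tangentPoint_succ (v : EuclideanSpace ℝ (Fin M)) (i : Fin M) :
    tangentPoint v i.succ = v i := rfl

lemma norm_tangentPoint_sq (v : EuclideanSpace ℝ (Fin M)) :
    ‖tangentPoint v‖ ^ 2 = 1 + ‖v‖ ^ 2 := by
  rw [EuclideanSpace.real_norm_sq_eq, EuclideanSpace.real_norm_sq_eq, Fin.sum_univ_succ]
  simp [tangentPoint_zero, tangentPoint_succ]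

lemma norm_tangentPoint_sub (v w : EuclideanSpace ℝ (Fin M)) :
    ‖tangentPoint v - tangentPoint w‖ = ‖v - w‖ := by
  rw [← sq_eq_sq₀ (norm_nonneg _) (norm_nonneg _), EuclideanSpace.real_norm_sq_eq,
    EuclideanSpace.real_norm_sq_eq, Fin.sum_univ_succ]
  simp [tangentPoint_zero, tangentPoint_succ]

lemma one_le_norm_tangentPoint (v : EuclideanSpace ℝ (Fin M)) : 1 ≤ ‖tangentPoint v‖ := by
  have := norm_tangentPoint_sq v
  nlinarith [norm_nonneg (tangentPoint v), sq_nonneg ‖v‖]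

lemma tangentPoint_inv_smul {x : EuclideanSpace ℝ (Fin (M + 1))} (hx : 0 < x 0) :
    tangentPoint ((x 0)⁻¹ • WithLp.toLp 2 (fun i : Fin M => x i.succ)) = (x 0)⁻¹ • x := by
  ext i
  refine Fin.cases ?_ (fun i => ?_) i
  · simp [tangentPoint_zero, hx.ne']
  · simp [tangentPoint_succ]

lemma continuous_tangentPoint : Continuous (tangentPoint (M := M)) := by
  have : Isometry (tangentPoint (M := M)) :=
    Isometry.of_dist_eq fun v w => by rw [dist_eq_norm, dist_eq_norm, norm_tangentPoint_sub]
  exact this.continuous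

/-- Radial projection contracts distances between points of norm between `1` and `K` of the
tangent hyperplane by a factor which is close to one for `K` close to one. -/
lemma norm_normalize_sub_ge {v w : EuclideanSpace ℝ (Fin M)} {K θ : ℝ}
    (hv : ‖tangentPoint v‖ ≤ K) (hw : ‖tangentPoint w‖ ≤ K) (hθ : 0 ≤ θ)
    (hK : θ ^ 2 * K ^ 2 ≤ 2 - K ^ 2) :
    θ * ‖v - w‖ ≤
      ‖‖tangentPoint v‖⁻¹ • tangentPoint v - ‖tangentPoint w‖⁻¹ • tangentPoint w‖ := by
  have hv1 := one_le_norm_tangentPoint v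
  have hw1 := one_le_norm_tangentPoint w
  have hv2 := norm_tangentPoint_sq v
  have hw2 := norm_tangentPoint_sq w
  have hab := norm_tangentPoint_sub v w
  set a := tangentPoint v
  set b := tangentPoint w
  set D := ‖v - w‖
  have hK1 : 1 ≤ K := hv1.trans hv
  -- law of cosines for the directions of `a` and `b`
  have h1 : ‖‖a‖⁻¹ • a - ‖b‖⁻¹ • b‖ ^ 2 * (‖a‖ * ‖b‖) = D ^ 2 - (‖a‖ - ‖b‖) ^ 2 := by
    have e1 := norm_sub_sq_real a b
    have e2 := norm_sub_sq_real (‖a‖⁻¹ • a) (‖b‖⁻¹ • b)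
    rw [hab] at e1
    rw [inner_smul_left, inner_smul_right, norm_smul, norm_smul, norm_inv, norm_norm, norm_inv,
      norm_norm, inv_mul_cancel₀ (by positivity), inv_mul_cancel₀ (by positivity)] at e2
    rw [e2, e1]
    simp only [conj_trivial]
    field_simp
    ring
  have h2 : (‖a‖ - ‖b‖) ^ 2 ≤ (K ^ 2 - 1) * D ^ 2 := by
    have e1 : |‖v‖ - ‖w‖| ≤ D := abs_norm_sub_norm_le v w
    have e2 : (‖a‖ - ‖b‖) * (‖a‖ + ‖b‖) = (‖v‖ - ‖w‖) * (‖v‖ + ‖w‖) := by nlinarith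
    have e3 : (‖v‖ - ‖w‖) ^ 2 ≤ D ^ 2 := sq_le_sq.2 (by rwa [abs_of_nonneg (norm_nonneg (v - w))])
    have e4 : (‖v‖ + ‖w‖) ^ 2 ≤ 4 * (K ^ 2 - 1) := by
      nlinarith [sq_nonneg (‖v‖ - ‖w‖), pow_le_pow_left₀ (norm_nonneg a) hv 2,
        pow_le_pow_left₀ (norm_nonneg b) hw 2]
    have e5 : 4 ≤ (‖a‖ + ‖b‖) ^ 2 := by nlinarith
    have e6 : (‖a‖ - ‖b‖) ^ 2 * (‖a‖ + ‖b‖) ^ 2 ≤ D ^ 2 * (4 * (K ^ 2 - 1)) := by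
      rw [← mul_pow, e2, mul_pow]
      exact mul_le_mul e3 e4 (sq_nonneg _) (sq_nonneg _)
    nlinarith [mul_le_mul_of_nonneg_left e5 (sq_nonneg (‖a‖ - ‖b‖))]
  have h3 : ‖a‖ * ‖b‖ ≤ K ^ 2 := by
    rw [sq]; exact mul_le_mul hv hw (norm_nonneg _) (by linarith)
  refine (pow_le_pow_iff_left₀ (by positivity) (norm_nonneg _) two_ne_zero).1 ?_
  set S := ‖‖a‖⁻¹ • a - ‖b‖⁻¹ • b‖
  have h4 : (2 - K ^ 2) * D ^ 2 ≤ S ^ 2 * K ^ 2 := by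
    nlinarith [mul_le_mul_of_nonneg_left h3 (sq_nonneg S)]
  have h5 : (θ * D) ^ 2 * K ^ 2 ≤ S ^ 2 * K ^ 2 := by
    nlinarith [mul_le_mul_of_nonneg_right hK (sq_nonneg D)]
  exact le_of_mul_le_mul_right h5 (by positivity)

/-- The part below height `a` of the cone with apex at the origin and section `V` at height `1`. -/
def coneBelow (a : ℝ) (V : Set (EuclideanSpace ℝ (Fin M))) : Set (EuclideanSpace ℝ (Fin (M + 1))) :=
  {x | x 0 ∈ Ioo 0 a ∧ (x 0)⁻¹ • WithLp.toLp 2 (fun i : Fin M => x i.succ) ∈ V}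

lemma volume_coneBelow {a : ℝ} (ha : 0 ≤ a) {V : Set (EuclideanSpace ℝ (Fin M))}
    (hV : MeasurableSet V) :
    volume (coneBelow a V) = ENNReal.ofReal (a ^ (M + 1) / (M + 1)) * volume V := by
  let V' : Set (Fin M → ℝ) := WithLp.toLp 2 ⁻¹' V
  have hV' : MeasurableSet V' := hV.preimage (WithLp.measurable_toLp 2 _)
  have hVV' : volume V' = volume V :=
    (PiLp.volume_preserving_toLp (Fin M)).measure_preimage hV.nullMeasurableSet
  let Q : Set (ℝ × (Fin M → ℝ)) := {q | q.1 ∈ Ioo 0 a ∧ (q.1)⁻¹ • q.2 ∈ V'}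
  have hQ : MeasurableSet Q := by
    refine (measurableSet_Ioo.preimage measurable_fst).inter (hV'.preimage ?_)
    exact (measurable_fst.inv).smul measurable_snd
  have h1 : volume (coneBelow a V) = volume Q := by
    have e1 := (MeasureTheory.volume_preserving_piFinSuccAbove (fun _ : Fin (M + 1) => ℝ) 0).comp
      (PiLp.volume_preserving_ofLp (Fin (M + 1)))
    rw [← e1.measure_preimage hQ.nullMeasurableSet]
    congr 1
  rw [h1, Measure.volume_eq_prod, Measure.prod_apply hQ]
  have h2 : ∀ s : ℝ, volume (Prod.mk s ⁻¹' Q) =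
      (Ioo 0 a).indicator (fun s => ENNReal.ofReal (s ^ M) * volume V) s := by
    intro s
    by_cases hs : s ∈ Ioo 0 a
    · rw [indicator_of_mem hs]
      have : Prod.mk s ⁻¹' Q = s • V' := by
        ext w
        rw [mem_smul_set_iff_inv_smul_mem₀ hs.1.ne']
        simp only [Q, mem_preimage, mem_ofPred_eq]
        exact and_iff_right hs
      rw [this, Measure.addHaar_smul, hVV']
      simp [abs_of_pos hs.1]
    · rw [indicator_of_notMem hs]
      have : Prod.mk s ⁻¹' Q = ∅ := by
        ext w
        simp only [Q, mem_preimage, mem_ofPred_eq, mem_empty_iff_false, iff_false]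
        exact fun h => hs h.1
      rw [this, measure_empty]
  simp_rw [h2]
  rw [lintegral_indicator measurableSet_Ioo, lintegral_mul_const _ (by fun_prop)]
  congr 1
  rw [← ofReal_integral_eq_lintegral_ofReal]
  · rw [← integral_Ioc_eq_integral_Ioo, ← intervalIntegral.integral_of_le ha, integral_pow]
    simp
  · exact ((continuous_pow M).integrableOn_Icc (a := 0) (b := a)).mono_set Ioo_subset_Icc_self
  · exact (ae_restrict_mem measurableSet_Ioo).mono fun s hs => pow_nonneg hs.1.le _

/-- Near every point of the sphere there is a chart which almost preserves distances (from below)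
and areas: the inverse of a gnomonic projection. The size of the charts is uniform. -/
lemma exists_gnomonic_chart (M : ℕ) {ε : ℝ} (hε : 0 < ε) (hε1 : ε < 1) :
    ∃ r > 0, ∀ p : Metric.sphere (0 : EuclideanSpace ℝ (Fin (M + 1))) 1,
      ∃ g : EuclideanSpace ℝ (Fin M) → Metric.sphere (0 : EuclideanSpace ℝ (Fin (M + 1))) 1,
        Continuous g ∧ Bornology.IsBounded (g ⁻¹' Metric.ball p r) ∧
        (∀ v ∈ g ⁻¹' Metric.ball p r, ∀ w ∈ g ⁻¹' Metric.ball p r,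
          (1 - ε) * ‖v - w‖ ≤ dist (g v) (g w)) ∧
        ∀ B ⊆ Metric.ball p r, MeasurableSet B →
          sphereMeasure (M + 1) B ≤ volume (g ⁻¹' B) ∧
          ENNReal.ofReal (1 - ε) * volume (g ⁻¹' B) ≤ sphereMeasure (M + 1) B := by
  -- over the ball of radius `r` the points of the tangent hyperplane have norm at most `(1 - r)⁻¹`
  obtain ⟨r, hr0, hr1, hrM, hrK⟩ : ∃ r : ℝ, 0 < r ∧ r < 1 ∧ 1 - ε ≤ (1 - r) ^ (M + 1) ∧
      (1 - ε) ^ 2 * ((1 - r)⁻¹) ^ 2 ≤ 2 - ((1 - r)⁻¹) ^ 2 := by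
    have c1 : Tendsto (fun r : ℝ => (1 - r) ^ (M + 1)) (𝓝 0) (𝓝 1) := by
      have : Continuous fun r : ℝ => (1 - r) ^ (M + 1) := by fun_prop
      simpa using this.tendsto 0
    have c2 : Tendsto (fun r : ℝ => (1 - r)⁻¹) (𝓝 0) (𝓝 1) := by
      have h : Tendsto (fun r : ℝ => 1 - r) (𝓝 0) (𝓝 (1 - 0)) := tendsto_const_nhds.sub tendsto_id
      simpa using h.inv₀ (by norm_num)
    have c3 : Tendsto (fun r : ℝ => 2 - ((1 - r)⁻¹) ^ 2 - (1 - ε) ^ 2 * ((1 - r)⁻¹) ^ 2) (𝓝 0)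
        (𝓝 (2 - 1 ^ 2 - (1 - ε) ^ 2 * 1 ^ 2)) :=
      ((c2.pow 2).const_sub 2).sub ((c2.pow 2).const_mul _)
    have h3 : 0 < 2 - 1 ^ 2 - (1 - ε) ^ 2 * (1 : ℝ) ^ 2 := by nlinarith
    have h := (((c1.eventually_const_lt (show 1 - ε < 1 by linarith)).and
      (c3.eventually_const_lt h3)).and (gt_mem_nhds (show (0 : ℝ) < 1 by norm_num)))
    obtain ⟨r, ⟨⟨a1, a2⟩, a3⟩, a4⟩ :=
      ((h.filter_mono nhdsWithin_le_nhds).and (self_mem_nhdsWithin (s := Ioi (0 : ℝ)))).exists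
    exact ⟨r, a4, a3, a1.le, by linarith⟩
  refine ⟨r, hr0, fun p => ?_⟩
  have hp : ‖(p : EuclideanSpace ℝ (Fin (M + 1)))‖ = 1 := by simp
  set K := (1 - r)⁻¹ with hKdef
  have hr' : 0 < 1 - r := by linarith
  have hK : 0 < K := inv_pos.2 hr'
  -- an isometry moves the base point of the gnomonic projection to `p`
  obtain ⟨O, hO⟩ : ∃ O : EuclideanSpace ℝ (Fin (M + 1)) ≃ₗᵢ[ℝ] EuclideanSpace ℝ (Fin (M + 1)),
      O (EuclideanSpace.single 0 1) = p := by
    refine ⟨Submodule.reflection (ℝ ∙ (EuclideanSpace.single 0 1 - (p : EuclideanSpace ℝ _)))ᗮ, ?_⟩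
    exact Submodule.reflection_sub (by simp [hp])
  let h : EuclideanSpace ℝ (Fin M) → EuclideanSpace ℝ (Fin (M + 1)) := fun v =>
    ‖tangentPoint v‖⁻¹ • tangentPoint v
  have hN0 : ∀ v : EuclideanSpace ℝ (Fin M), 0 < ‖tangentPoint v‖ := fun v =>
    one_pos.trans_le (one_le_norm_tangentPoint v)
  have hh1 : ∀ v, ‖h v‖ = 1 := fun v => by
    simp only [h, norm_smul, norm_inv, norm_norm]
    exact inv_mul_cancel₀ (hN0 v).ne'
  have hhc : Continuous h :=
    (continuous_tangentPoint.norm.inv₀ fun v => (hN0 v).ne').smul continuous_tangentPoint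
  let g : EuclideanSpace ℝ (Fin M) → Metric.sphere (0 : EuclideanSpace ℝ (Fin (M + 1))) 1 :=
    fun v => ⟨O (h v), by simp [hh1]⟩
  have hgK : ∀ v ∈ g ⁻¹' Metric.ball p r, ‖tangentPoint v‖ ≤ K := by
    intro v hv
    have e1 : ‖h v - EuclideanSpace.single 0 1‖ < r := by
      have : dist (O (h v)) (p : EuclideanSpace ℝ (Fin (M + 1))) < r := hv
      rwa [← hO, O.dist_map, dist_eq_norm] at this
    have e2 := (euclidean_abs_le_norm (h v - EuclideanSpace.single 0 1) 0).trans_lt e1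
    have e3 : (h v - EuclideanSpace.single 0 1 : EuclideanSpace ℝ (Fin (M + 1))) 0 =
        ‖tangentPoint v‖⁻¹ - 1 := by
      simp [h, tangentPoint_zero]
    rw [e3] at e2
    have e4 : 1 - r ≤ ‖tangentPoint v‖⁻¹ := by linarith [(abs_lt.1 e2).1]
    have := inv_anti₀ hr' e4
    rwa [inv_inv] at this
  refine ⟨g, Continuous.subtype_mk (O.continuous.comp hhc) _, ?_, ?_, ?_⟩
  · rw [isBounded_iff_forall_norm_le]
    refine ⟨K, fun v hv => le_trans ?_ (hgK v hv)⟩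
    refine (pow_le_pow_iff_left₀ (norm_nonneg _) (hN0 v).le two_ne_zero).1 ?_
    linarith [norm_tangentPoint_sq v]
  · intro v hv w hw
    have e1 : dist (g v) (g w) = ‖h v - h w‖ := by
      rw [← dist_eq_norm, ← O.dist_map]; rfl
    rw [e1]
    exact norm_normalize_sub_ge (hgK v hv) (hgK w hw) (by linarith) hrK
  · intro B hB hBm
    have hEm : MeasurableSet (g ⁻¹' B) :=
      hBm.preimage (Continuous.subtype_mk (O.continuous.comp hhc) _).measurable
    -- the cone over `B`, whose volume defines the area of `B`, lies between two flat cones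
    set cone := Ioo (0 : ℝ) 1 • (Subtype.val '' B : Set (EuclideanSpace ℝ (Fin (M + 1))))
    have hσ : sphereMeasure (M + 1) B = (M + 1 : ℕ) * volume (O ⁻¹' cone) := by
      rw [sphereMeasure, Measure.toSphere_apply' _ hBm, finrank_euclideanSpace, Fintype.card_fin,
        O.measurePreserving.measure_preimage_emb O.toHomeomorph.measurableEmbedding]
    -- in coordinates the chart is the inverse of the gnomonic projection
    have hsurj : ∀ x : EuclideanSpace ℝ (Fin (M + 1)), 0 < x 0 →
        h ((x 0)⁻¹ • WithLp.toLp 2 (fun i : Fin M => x i.succ)) = ‖x‖⁻¹ • x := by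
      intro x hx
      simp only [h, tangentPoint_inv_smul hx, norm_smul, norm_inv,
        Real.norm_of_nonneg hx.le, mul_inv, inv_inv, smul_smul]
      congr 1
      field_simp
    have hsub1 : O ⁻¹' cone ⊆ coneBelow 1 (g ⁻¹' B) := by
      rintro x ⟨t, ht, _, ⟨b, hb, rfl⟩, hx⟩
      simp only at hx
      set y := O.symm b with hy
      have hy1 : ‖y‖ = 1 := by rw [hy, O.symm.norm_map]; simp
      have hxy : x = t • y := by
        rw [hy, ← map_smul, hx, O.symm_apply_apply]
      have e1 : ‖y - EuclideanSpace.single 0 1‖ < r := by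
        have : dist (b : EuclideanSpace ℝ (Fin (M + 1))) p < r := hB hb
        rwa [← O.symm.dist_map, ← hO, O.symm_apply_apply, dist_eq_norm] at this
      have e2 := (euclidean_abs_le_norm (y - EuclideanSpace.single 0 1) 0).trans_lt e1
      have e3 : (y - EuclideanSpace.single 0 1 : EuclideanSpace ℝ (Fin (M + 1))) 0 = y 0 - 1 := by
        simp
      rw [e3] at e2
      have e4 : 0 < y 0 := by linarith [(abs_lt.1 e2).1]
      have e5 : y 0 ≤ 1 := (le_abs_self _).trans ((euclidean_abs_le_norm y 0).trans hy1.le)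
      have hx0 : x 0 = t * y 0 := by rw [hxy]; simp
      have hx0pos : 0 < x 0 := by rw [hx0]; exact mul_pos ht.1 e4
      refine ⟨⟨hx0pos, ?_⟩, ?_⟩
      · rw [hx0]; nlinarith [ht.1, ht.2]
      · have : g ((x 0)⁻¹ • WithLp.toLp 2 (fun i : Fin M => x i.succ)) = b := by
          apply Subtype.ext
          change O (h _) = _
          rw [hsurj x hx0pos, hxy, norm_smul, hy1, mul_one, smul_smul, Real.norm_of_nonneg ht.1.le,
            inv_mul_cancel₀ ht.1.ne', one_smul, hy, O.apply_symm_apply]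
        rw [mem_preimage, this]
        exact hb
    have hsub2 : coneBelow (1 - r) (g ⁻¹' B) ⊆ O ⁻¹' cone := by
      rintro x ⟨hx, hxB⟩
      set v := (x 0)⁻¹ • WithLp.toLp 2 (fun i : Fin M => x i.succ)
      have hxv : x = (x 0 * ‖tangentPoint v‖) • h v := by
        have e : tangentPoint v = (x 0)⁻¹ • x := tangentPoint_inv_smul hx.1
        simp only [h, smul_smul, mul_assoc, mul_inv_cancel₀ (hN0 v).ne', mul_one]
        rw [e, smul_smul, mul_inv_cancel₀ hx.1.ne', one_smul]
      refine ⟨x 0 * ‖tangentPoint v‖, ⟨mul_pos hx.1 (hN0 v), ?_⟩, O (h v), ⟨g v, hxB, rfl⟩, ?_⟩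
      · calc x 0 * ‖tangentPoint v‖ < (1 - r) * ‖tangentPoint v‖ :=
              mul_lt_mul_of_pos_right hx.2 (hN0 v)
          _ ≤ (1 - r) * K := mul_le_mul_of_nonneg_left (hgK v (hB hxB)) hr'.le
          _ = 1 := mul_inv_cancel₀ hr'.ne'
      · simp only
        rw [← map_smul, ← hxv]
    have hM : ((M + 1 : ℕ) : ENNReal) = ENNReal.ofReal (M + 1) := by
      rw [← ENNReal.ofReal_natCast]; push_cast; rfl
    have hmul : ∀ a : ℝ, ((M + 1 : ℕ) : ENNReal) * (ENNReal.ofReal (a ^ (M + 1) / (M + 1)) *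
        volume (g ⁻¹' B)) = ENNReal.ofReal (a ^ (M + 1)) * volume (g ⁻¹' B) := by
      intro a
      rw [← mul_assoc, hM, ← ENNReal.ofReal_mul (by positivity)]
      congr 2
      field_simp
    constructor
    · have := mul_le_mul_right (measure_mono (μ := volume) hsub1) ((M + 1 : ℕ) : ENNReal)
      rw [volume_coneBelow zero_le_one hEm, hmul] at this
      rw [hσ]
      simpa using this
    · have := mul_le_mul_right (measure_mono (μ := volume) hsub2) ((M + 1 : ℕ) : ENNReal)
      rw [volume_coneBelow hr'.le hEm, hmul] at this
      rw [hσ]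
      refine le_trans ?_ this
      gcongr

end Gnomonic

/-! ### Codes of prescribed density: small cells -/

/-- A set with null boundary is exhausted up to `η` by an open set with null boundary which keeps a
positive distance to the complement. -/
lemma exists_isOpen_subset_measureReal_le {X : Type*} [PseudoMetricSpace X] [CompactSpace X]
    [MeasurableSpace X] [BorelSpace X] (μ : Measure X) [IsFiniteMeasure μ] {A : Set X}
    (hA : μ (frontier A) = 0) {η : ℝ} (hη : 0 < η) :
    ∃ U, IsOpen U ∧ μ (frontier U) = 0 ∧ closure U ⊆ A ∧ μ.real A ≤ μ.real U + η ∧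
      ∃ s > 0, ∀ x ∈ U, ∀ y, dist x y < s → y ∈ A := by
  obtain ⟨K, hKA, hK, hKμ⟩ := isOpen_interior.measurableSet.exists_isCompact_lt_add
    (measure_ne_top μ (interior A)) (ENNReal.ofReal_pos.2 hη).ne'
  obtain ⟨t, ht, hKt⟩ := hK.exists_cthickening_subset_open isOpen_interior hKA
  obtain ⟨s, hs, hnull⟩ := exists_null_frontier_thickening μ K ht
  have hsub : Metric.cthickening t K ⊆ A := hKt.trans interior_subset
  refine ⟨Metric.thickening s K, Metric.isOpen_thickening, hnull, ?_, ?_, t - s, sub_pos.2 hs.2, ?_⟩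
  · exact (Metric.closure_thickening_subset_cthickening s K).trans
      ((Metric.cthickening_mono hs.2.le K).trans hsub)
  · have h1 : μ A = μ (interior A) := by
      refine le_antisymm ?_ (measure_mono interior_subset)
      have : A ⊆ interior A ∪ frontier A := by
        rw [← closure_eq_interior_union_frontier]; exact subset_closure
      exact (measure_mono this).trans ((measure_union_le _ _).trans (by rw [hA, add_zero]))
    have h2 : μ A ≤ μ (Metric.thickening s K) + ENNReal.ofReal η := by
      rw [h1]
      refine hKμ.le.trans ?_
      gcongr
      exact Metric.self_subset_thickening hs.1 K
    have h3 := ENNReal.toReal_mono (by finiteness) h2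
    rwa [ENNReal.toReal_add (by finiteness) (by finiteness), ENNReal.toReal_ofReal hη.le] at h3
  · intro x hx y hxy
    obtain ⟨z, hz, hxz⟩ := Metric.mem_thickening_iff.1 hx
    refine hsub (Metric.thickening_subset_cthickening t K (Metric.mem_thickening_iff.2 ⟨z, hz, ?_⟩))
    linarith [dist_triangle y x z, dist_comm x y]

lemma finite_inter_inv_smul {E : Type*} [NormedAddCommGroup E] [NormedSpace ℝ E]
    [FiniteDimensional ℝ E] (Λ : Submodule ℤ E) [DiscreteTopology Λ] {W : Set E}
    (hW : Bornology.IsBounded W) {a : ℝ} (ha : a ≠ 0) : (W ∩ a⁻¹ • (Λ : Set E)).Finite := by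
  have h : (a • W ∩ (Λ : Set E)).Finite := by
    refine Metric.finite_isBounded_inter_isClosed (K := a • W) (s := (Λ : Set E))
      DiscreteTopology.isDiscrete (hW.smul₀ a) ?_
    exact AddSubgroup.isClosed_of_discrete (H := Λ.toAddSubgroup)
  refine (h.image fun x => a⁻¹ • x).subset ?_
  rintro x ⟨hx, y, hy, rfl⟩
  refine ⟨y, ⟨⟨a⁻¹ • y, hx, by simp [smul_smul, ha]⟩, hy⟩, rfl⟩

/-- A scaled lattice, transported by a chart which contracts distances by a factor of at least
`1 - ε`, gives codes in a region `U` of the sphere with almost the density of the lattice. -/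
lemma exists_code_of_chart {M : ℕ} (hM : 1 ≤ M) (Λ : Submodule ℤ (EuclideanSpace ℝ (Fin M)))
    [DiscreteTopology Λ] [IsZLattice ℝ Λ] (h2 : minDist Λ = 2) {ε : ℝ} (hε : 0 < ε)
    (hε2 : 2 * ε < 1)
    {g : EuclideanSpace ℝ (Fin M) → Metric.sphere (0 : EuclideanSpace ℝ (Fin (M + 1))) 1}
    (hg : Continuous g) {U : Set (Metric.sphere (0 : EuclideanSpace ℝ (Fin (M + 1))) 1)}
    (hU : IsOpen U) (hbdd : Bornology.IsBounded (g ⁻¹' U))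
    (hnull : volume (frontier (g ⁻¹' U)) = 0)
    (hdist : ∀ v ∈ g ⁻¹' U, ∀ w ∈ g ⁻¹' U, (1 - ε) * ‖v - w‖ ≤ dist (g v) (g w)) :
    ∃ S : ℝ → Set (Metric.sphere (0 : EuclideanSpace ℝ (Fin (M + 1))) 1),
      (∀ᶠ d in 𝓝[>] (0 : ℝ), (S d).Finite ∧ S d ⊆ U ∧ (S d).Pairwise fun x y => d < dist x y) ∧
      Tendsto (fun d => capArea (M + 1) d * (S d).ncard) (𝓝[>] 0)
        (𝓝 (latticeDensity Λ * (1 - 2 * ε) ^ M * volume.real (g ⁻¹' U))) := by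
  -- scaling `Λ` by `1 / n` with `n ≤ a / d` gives minimum distance at least `d / (1 - 2 ε)`, so
  -- that the chart keeps it above `d`
  set a := 2 * (1 - 2 * ε) with ha
  have ha0 : 0 < a := by rw [ha]; linarith
  let n : ℝ → ℕ := fun d => ⌊a * d⁻¹⌋₊
  let W := g ⁻¹' U
  let P : ℝ → Set (EuclideanSpace ℝ (Fin M)) := fun d =>
    W ∩ ((n d : ℝ))⁻¹ • (Λ : Set (EuclideanSpace ℝ (Fin M)))
  have hn1 : Tendsto (fun d => d * (n d : ℝ)) (𝓝[>] 0) (𝓝 a) := by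
    have := (tendsto_nat_floor_mul_div_atTop ha0.le).comp (tendsto_inv_nhdsGT_zero (𝕜 := ℝ))
    refine this.congr fun d => ?_
    simp [n, mul_comm]
  have hn2 : Tendsto n (𝓝[>] 0) atTop :=
    tendsto_nat_floor_atTop.comp ((tendsto_inv_nhdsGT_zero (𝕜 := ℝ)).const_mul_atTop ha0)
  have hsep : ∀ d, 0 < d → 1 ≤ n d → ∀ v ∈ P d, ∀ w ∈ P d, v ≠ w → d < dist (g v) (g w) := by
    intro d hd hnd v hv w hw hvw
    have hn0 : (0 : ℝ) < n d := by exact_mod_cast hnd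
    have h3 : 2 * (n d : ℝ)⁻¹ ≤ ‖v - w‖ := by
      obtain ⟨-, x, hx, rfl⟩ := hv
      obtain ⟨-, y, hy, rfl⟩ := hw
      have hxy : x - y ≠ 0 := fun h => hvw (by rw [sub_eq_zero.1 h])
      have h4 := minDist_le Λ (Λ.sub_mem hx hy) hxy
      simp only [← smul_sub, norm_smul, norm_inv, Real.norm_natCast]
      rw [mul_comm]
      exact mul_le_mul_of_nonneg_left (h2 ▸ h4) (inv_nonneg.2 hn0.le)
    have h5 : (n d : ℝ) ≤ a * d⁻¹ := Nat.floor_le (by positivity)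
    have h6 : d * n d ≤ a := by
      calc d * n d ≤ d * (a * d⁻¹) := mul_le_mul_of_nonneg_left h5 hd.le
        _ = a := by field_simp
    refine lt_of_lt_of_le ?_ (hdist v hv.1 w hw.1)
    refine lt_of_lt_of_le ?_ (mul_le_mul_of_nonneg_left h3 (by linarith))
    rw [← mul_assoc, ← div_eq_mul_inv, lt_div_iff₀ hn0]
    linarith
  have hn3 : ∀ᶠ d in 𝓝[>] (0 : ℝ), 1 ≤ n d := hn2.eventually_ge_atTop 1
  refine ⟨fun d => g '' P d, ?_, ?_⟩
  · filter_upwards [self_mem_nhdsWithin, hn3] with d hd hnd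
    refine ⟨(finite_inter_inv_smul Λ hbdd (by positivity)).image g, ?_, ?_⟩
    · rintro _ ⟨v, hv, rfl⟩; exact hv.1
    · rintro _ ⟨v, hv, rfl⟩ _ ⟨w, hw, rfl⟩ hvw
      exact hsep d hd hnd v hv w hw fun h => hvw (by rw [h])
  · have hcount := (ZLattice.covolume.tendsto_card_div_pow' Λ hbdd
      (hU.preimage hg).measurableSet hnull).comp hn2
    have hcap := tendsto_capArea_div (n := M + 1) (by omega)
    have hlim := (hcap.mul (hn1.pow M)).mul hcount
    have e : ballVol (M + 1 - 1) / 2 ^ (M + 1 - 1) * a ^ M *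
        (volume.real (g ⁻¹' U) / ZLattice.covolume Λ) =
        latticeDensity Λ * (1 - 2 * ε) ^ M * volume.real (g ⁻¹' U) := by
      rw [latticeDensity, h2, ha, mul_pow, Fintype.card_fin, Nat.add_sub_cancel]
      field_simp
      simp
    rw [e] at hlim
    refine hlim.congr' ?_
    filter_upwards [self_mem_nhdsWithin, hn3] with d hd hnd
    have hd0 : (0 : ℝ) < d := hd
    have hn0 : (0 : ℝ) < n d := by exact_mod_cast hnd
    have hinj : InjOn g (P d) := by
      intro v hv w hw hvw
      by_contra hne
      have := hsep d hd hnd v hv w hw hne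
      rw [hvw, dist_self] at this
      linarith
    rw [hinj.ncard_image]
    simp only [Function.comp, finrank_euclideanSpace, Fintype.card_fin, Nat.add_sub_cancel]
    rw [Nat.card_coe_set_eq]
    change _ * _ * (((P d).ncard : ℝ) / _) = _
    rw [mul_pow]
    field_simp

/-! ### Codes of prescribed density: existence -/

/-- A code of minimum distance greater than `d` whose density in the cells of some partition of
the sphere into pieces of diameter at most `ε` is `δ`, up to a total error of at most `ε`. -/
def IsAlmostUniform {L : ℕ} (δ ε d : ℝ) (C : Set (EuclideanSpace ℝ (Fin L))) : Prop :=
  IsSphericalCode d C ∧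
    ∃ (n : ℕ) (A : Fin n → Set (Metric.sphere (0 : EuclideanSpace ℝ (Fin L)) 1)),
      IsFinePartition (sphereMeasure L) ε A ∧
      ∑ j, |capAreaIn d C (A j) - δ * (sphereMeasure L).real (A j)| ≤ ε

lemma IsFinePartition.mono {X : Type*} [PseudoMetricSpace X] [MeasurableSpace X] {μ : Measure X}
    {r s : ℝ} {n : ℕ} {A : Fin n → Set X} (h : IsFinePartition μ r A) (hrs : r ≤ s) :
    IsFinePartition μ s A where
  measurableSet := h.measurableSet
  frontier_null := h.frontier_null
  dist_le j x hx y hy := (h.dist_le j x hx y hy).trans hrs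
  disjoint := h.disjoint
  cover := h.cover

lemma IsFinePartition.sum_measureReal {X : Type*} [PseudoMetricSpace X] [MeasurableSpace X]
    {μ : Measure X} [IsFiniteMeasure μ] {r : ℝ} {n : ℕ} {A : Fin n → Set X}
    (h : IsFinePartition μ r A) : ∑ j, μ.real (A j) = μ.real univ := by
  rw [← measureReal_iUnion_fintype h.disjoint h.measurableSet]
  congr 1
  exact eq_univ_of_forall fun x => mem_iUnion.2 (h.cover x)

lemma IsAlmostUniform.mono {L : ℕ} {δ ε ε' d : ℝ} {C : Set (EuclideanSpace ℝ (Fin L))}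
    (h : IsAlmostUniform δ ε d C) (hε : ε ≤ ε') : IsAlmostUniform δ ε' d C := by
  obtain ⟨h1, n, A, h2, h3⟩ := h
  exact ⟨h1, n, A, h2.mono hε, h3.trans hε⟩

/-- Codes in disjoint cells whose points keep distance more than `d` to the other cells can be
glued. -/
lemma IsSphericalCode.iUnion_image_val {L n : ℕ} {d : ℝ}
    {S A : Fin n → Set (Metric.sphere (0 : EuclideanSpace ℝ (Fin L)) 1)}
    (hfin : ∀ j, (S j).Finite) (hS : ∀ j, (S j).Pairwise fun x y => d < dist x y)
    (hdist : ∀ j, ∀ x ∈ S j, ∀ y, dist x y ≤ d → y ∈ A j) (hSA : ∀ j, S j ⊆ A j)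
    (hA : Pairwise fun i j => Disjoint (A i) (A j)) :
    IsSphericalCode d (⋃ j, Subtype.val '' S j) where
  finite := finite_iUnion fun j => (hfin j).image _
  norm_eq c hc := by
    obtain ⟨j, a, -, rfl⟩ := mem_iUnion.1 hc
    simp
  lt_dist := by
    intro b hb c hc hbc
    obtain ⟨i, x, hx, rfl⟩ := mem_iUnion.1 hb
    obtain ⟨j, y, hy, rfl⟩ := mem_iUnion.1 hc
    have hxy : x ≠ y := fun h => hbc (by rw [h])
    rcases eq_or_ne i j with rfl | hij
    · exact hS i hx hy hxy
    · by_contra hle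
      exact disjoint_left.1 (hA hij) (hdist i x hx y (not_lt.1 hle)) (hSA j hy)

lemma capAreaIn_iUnion_image_val {L n : ℕ} {d : ℝ}
    {S A : Fin n → Set (Metric.sphere (0 : EuclideanSpace ℝ (Fin L)) 1)} (hSA : ∀ j, S j ⊆ A j)
    (hA : Pairwise fun i j => Disjoint (A i) (A j)) (j : Fin n) :
    capAreaIn d (⋃ j, Subtype.val '' S j) (A j) = capArea L d * (S j).ncard := by
  have : (⋃ j, Subtype.val '' S j) ∩ Subtype.val '' A j = Subtype.val '' S j := by
    rw [← image_iUnion, ← image_inter Subtype.val_injective]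
    congr 1
    ext x
    constructor
    · rintro ⟨hx, hxj⟩
      obtain ⟨i, hi⟩ := mem_iUnion.1 hx
      rcases eq_or_ne i j with rfl | hij
      · exact hi
      · exact absurd hxj (disjoint_left.1 (hA hij) (hSA i hi))
    · exact fun hx => ⟨mem_iUnion.2 ⟨j, hx⟩, hSA j hx⟩
  rw [capAreaIn, this, ncard_image_of_injective _ Subtype.val_injective]

/-- Almost uniform codes are glued from scaled lattices in gnomonic charts over small cells. -/
lemma eventually_exists_isAlmostUniform {M : ℕ} (hM : 1 ≤ M)
    (Λ : Submodule ℤ (EuclideanSpace ℝ (Fin M))) [DiscreteTopology Λ] [IsZLattice ℝ Λ]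
    (h2 : minDist Λ = 2) {ε : ℝ} (hε : 0 < ε) :
    ∀ᶠ d in 𝓝[>] (0 : ℝ), ∃ C : Set (EuclideanSpace ℝ (Fin (M + 1))),
      IsAlmostUniform (latticeDensity Λ) ε d C := by
  set σ := sphereMeasure (M + 1)
  set δ := latticeDensity Λ with hδdef
  have hδ : 0 ≤ δ := by
    rw [hδdef, latticeDensity, h2]
    have := ballVol_pos (Fintype.card (Fin M))
    have := ZLattice.covolume_pos Λ volume
    positivity
  -- `η` bounds the distortion of the charts, `κ` below the part of the cells left empty
  obtain ⟨η, hη0, hη1, hη⟩ : ∃ η : ℝ, 0 < η ∧ 2 * η < 1 ∧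
      δ * (1 - (1 - 2 * η) ^ M) * σ.real univ ≤ ε / 3 := by
    have c : Tendsto (fun η : ℝ => δ * (1 - (1 - 2 * η) ^ M) * σ.real univ) (𝓝 0) (𝓝 0) := by
      have : Continuous fun η : ℝ => δ * (1 - (1 - 2 * η) ^ M) * σ.real univ := by fun_prop
      simpa using this.tendsto 0
    have h := (c.eventually_lt_const (show 0 < ε / 3 by positivity)).and
      (gt_mem_nhds (show (0 : ℝ) < 1 / 2 by norm_num))
    obtain ⟨η, ⟨h1, h2⟩, h3⟩ :=
      ((h.filter_mono nhdsWithin_le_nhds).and (self_mem_nhdsWithin (s := Ioi (0 : ℝ)))).exists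
    exact ⟨η, h3, by linarith, h1.le⟩
  set q := (1 - 2 * η) ^ M with hq
  have hq0 : 0 ≤ q := pow_nonneg (by linarith) M
  have hq1 : q ≤ 1 - η := by
    calc q ≤ (1 - 2 * η) ^ 1 := pow_le_pow_of_le_one (by linarith) (by linarith) hM
      _ ≤ 1 - η := by rw [pow_one]; linarith
  obtain ⟨r, hr, hchart⟩ := exists_gnomonic_chart M hη0 (by linarith)
  obtain ⟨n, A, hA⟩ := exists_isFinePartition σ (lt_min (half_pos hr) hε)
  have hAr : ∀ j, ∃ p, A j ⊆ Metric.ball p r := by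
    intro j
    rcases (A j).eq_empty_or_nonempty with h | ⟨p, hp⟩
    · exact ⟨⟨EuclideanSpace.single 0 1, by simp⟩, by simp [h]⟩
    · refine ⟨p, fun x hx => ?_⟩
      rw [Metric.mem_ball]
      linarith [hA.dist_le j x hx p hp, min_le_left (r / 2) ε]
  choose p hp using hAr
  choose g hgc hgb hgd hgm using fun j => hchart (p j)
  set κ := ε / (3 * (n + 1) * (δ + 1)) with hκ
  have hκ0 : 0 < κ := by positivity
  choose U hUo hUn hUA hUσ s hs0 hs using fun j =>
    exists_isOpen_subset_measureReal_le σ (hA.frontier_null j) hκ0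
  have hUA' : ∀ j, U j ⊆ A j := fun j => subset_closure.trans (hUA j)
  have hvol : ∀ j, σ.real (U j) ≤ volume.real (g j ⁻¹' U j) ∧
      (1 - η) * volume.real (g j ⁻¹' U j) ≤ σ.real (U j) := by
    intro j
    obtain ⟨h3, h4⟩ := hgm j (U j) ((hUA' j).trans (hp j)) (hUo j).measurableSet
    have hfin : volume (g j ⁻¹' U j) ≠ ⊤ :=
      ((hgb j).subset (preimage_mono ((hUA' j).trans (hp j)))).measure_lt_top.ne
    refine ⟨ENNReal.toReal_mono hfin h3, ?_⟩
    have h5 := ENNReal.toReal_mono (measure_ne_top σ _) h4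
    rwa [ENNReal.toReal_mul, ENNReal.toReal_ofReal (by linarith)] at h5
  have hfr : ∀ j, volume (frontier (g j ⁻¹' U j)) = 0 := by
    intro j
    refine measure_mono_null ((hgc j).frontier_preimage_subset (U j)) ?_
    have h3 := (hgm j (frontier (U j)) ((frontier_subset_closure.trans (hUA j)).trans (hp j))
      isClosed_frontier.measurableSet).2
    rw [hUn j, nonpos_iff_eq_zero, mul_eq_zero] at h3
    exact h3.resolve_left (ENNReal.ofReal_pos.2 (by linarith)).ne'
  choose S hS hSlim using fun j => exists_code_of_chart hM Λ h2 hη0 hη1 (hgc j) (hUo j)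
    ((hgb j).subset (preimage_mono ((hUA' j).trans (hp j)))) (hfr j)
    fun v hv w hw => hgd j v (hp j (hUA' j hv)) w (hp j (hUA' j hw))
  have hlim : ∀ᶠ d in 𝓝[>] (0 : ℝ), ∀ j, |capArea (M + 1) d * (S j d).ncard -
      δ * q * volume.real (g j ⁻¹' U j)| ≤ κ := by
    refine eventually_all.2 fun j => ?_
    filter_upwards [Metric.tendsto_nhds.1 (hSlim j) κ hκ0] with d hd
    exact (Real.dist_eq _ _ ▸ hd).le
  have hds : ∀ᶠ d in 𝓝[>] (0 : ℝ), ∀ j, d < s j :=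
    eventually_all.2 fun j => (gt_mem_nhds (hs0 j)).filter_mono nhdsWithin_le_nhds
  filter_upwards [eventually_all.2 hS, hlim, hds] with d hSd hlimd hdsd
  have hSA : ∀ j, S j d ⊆ A j := fun j => (hSd j).2.1.trans (hUA' j)
  refine ⟨⋃ j, Subtype.val '' S j d, ?_, n, A, hA.mono (min_le_right _ _), ?_⟩
  · exact IsSphericalCode.iUnion_image_val (fun j => (hSd j).1) (fun j => (hSd j).2.2)
      (fun j x hx y hxy => hs j x ((hSd j).2.1 hx) y (hxy.trans_lt (hdsd j))) hSA hA.disjoint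
  · have hterm : ∀ j, |capAreaIn d (⋃ j, Subtype.val '' S j d) (A j) - δ * σ.real (A j)| ≤
        δ * (1 - q) * σ.real (A j) + (δ + 1) * κ := by
      intro j
      rw [capAreaIn_iUnion_image_val hSA hA.disjoint]
      obtain ⟨h3, h4⟩ := hvol j
      have h5 : σ.real (U j) ≤ σ.real (A j) := measureReal_mono (hUA' j)
      have h6 : q * volume.real (g j ⁻¹' U j) ≤ σ.real (A j) :=
        (mul_le_mul_of_nonneg_right hq1 measureReal_nonneg).trans (h4.trans h5)
      have h7 : q * (σ.real (A j) - κ) ≤ q * volume.real (g j ⁻¹' U j) :=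
        mul_le_mul_of_nonneg_left (by linarith [hUσ j]) hq0
      have h8 : q * κ ≤ κ := mul_le_of_le_one_left hκ0.le (by linarith)
      have h9 := mul_le_mul_of_nonneg_left h6 hδ
      have h10 : δ * (q * σ.real (A j) - κ) ≤ δ * (q * volume.real (g j ⁻¹' U j)) :=
        mul_le_mul_of_nonneg_left (by linarith) hδ
      have h11 : 0 ≤ δ * (1 - q) * σ.real (A j) :=
        mul_nonneg (mul_nonneg hδ (by linarith)) measureReal_nonneg
      have h12 : 0 ≤ δ * κ := mul_nonneg hδ hκ0.le
      have h13 := abs_le.1 (hlimd j)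
      rw [abs_le]
      constructor <;> nlinarith
    calc ∑ j, |capAreaIn d (⋃ j, Subtype.val '' S j d) (A j) - δ * σ.real (A j)|
        ≤ ∑ j, (δ * (1 - q) * σ.real (A j) + (δ + 1) * κ) := Finset.sum_le_sum fun j _ => hterm j
      _ = δ * (1 - q) * σ.real univ + n * ((δ + 1) * κ) := by
          rw [Finset.sum_add_distrib, ← Finset.mul_sum, hA.sum_measureReal]
          simp
      _ ≤ ε / 3 + ε / 3 := by
          refine add_le_add hη ?_
          have : ((n : ℝ) + 1) * ((δ + 1) * κ) = ε / 3 := by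
            rw [hκ]; field_simp
          nlinarith [mul_pos (show 0 < δ + 1 by linarith) hκ0]
      _ ≤ ε := by linarith

/-- The cells meeting a set lie in a thickening of it, so an almost uniform code has at most the
expected number of points in the set. -/
lemma IsAlmostUniform.capAreaIn_le {L : ℕ} {δ ε d : ℝ} {C : Set (EuclideanSpace ℝ (Fin L))}
    (h : IsAlmostUniform δ ε d C) (hδ : 0 ≤ δ) (hd : 0 ≤ d)
    (B : Set (Metric.sphere (0 : EuclideanSpace ℝ (Fin L)) 1)) :
    capAreaIn d C B ≤ δ * (sphereMeasure L).real (Metric.cthickening ε B) + ε := by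
  classical
  obtain ⟨hC, n, A, hA, hsum⟩ := h
  set σ := sphereMeasure L
  let J : Finset (Fin n) := Finset.univ.filter fun j => (A j ∩ B).Nonempty
  have hcap := capArea_nonneg L hd
  have h1 : capAreaIn d C B ≤ ∑ j ∈ J, capAreaIn d C (A j) := by
    simp only [capAreaIn]
    rw [← Finset.mul_sum]
    refine mul_le_mul_of_nonneg_left ?_ hcap
    have hsub : C ∩ Subtype.val '' B ⊆ ⋃ j ∈ J, C ∩ Subtype.val '' A j := by
      rintro _ ⟨hc, a, ha, rfl⟩
      obtain ⟨j, hj⟩ := hA.cover a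
      exact mem_biUnion (show j ∈ (J : Set (Fin n)) by
        simpa [J] using ⟨a, hj, ha⟩) ⟨hc, a, hj, rfl⟩
    have hfin : ∀ j ∈ J, (C ∩ Subtype.val '' A j).Finite := fun j _ =>
      hC.finite.subset inter_subset_left
    have h2 := ncard_le_ncard hsub (Set.Finite.biUnion' J.finite_toSet hfin)
    rw [ncard_biUnion_finset J _ hfin] at h2
    · exact_mod_cast h2
    · intro i _ j _ hij
      refine Disjoint.mono inter_subset_right inter_subset_right ?_
      exact (disjoint_image_iff Subtype.val_injective).2 (hA.disjoint hij)
  have h2 : ∑ j ∈ J, capAreaIn d C (A j) ≤ ∑ j ∈ J, δ * σ.real (A j) + ε := by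
    have : ∑ j ∈ J, (capAreaIn d C (A j) - δ * σ.real (A j)) ≤ ε :=
      ((Finset.sum_le_sum fun j _ => le_abs_self _).trans
        (Finset.sum_le_univ_sum_of_nonneg fun j => abs_nonneg _)).trans hsum
    rw [Finset.sum_sub_distrib] at this
    linarith
  have h3 : ∑ j ∈ J, σ.real (A j) ≤ σ.real (Metric.cthickening ε B) := by
    rw [← measureReal_biUnion_finset (fun i _ j _ hij => hA.disjoint hij)
      fun j _ => hA.measurableSet j]
    refine measureReal_mono (iUnion₂_subset fun j hj x hx => ?_)
    obtain ⟨y, hyA, hyB⟩ := (Finset.mem_filter.1 hj).2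
    exact Metric.mem_cthickening_of_dist_le x y ε B hyB (hA.dist_le j x hx y hyA)
  rw [← Finset.mul_sum] at h2
  linarith [mul_le_mul_of_nonneg_left h3 hδ]

lemma IsAlmostUniform.le_capAreaIn_univ {L : ℕ} {δ ε d : ℝ} {C : Set (EuclideanSpace ℝ (Fin L))}
    (h : IsAlmostUniform δ ε d C) :
    δ * (sphereMeasure L).real univ - ε ≤ capAreaIn d C univ := by
  obtain ⟨hC, n, A, hA, hsum⟩ := h
  have h1 : capAreaIn d C univ = ∑ j, capAreaIn d C (A j) := by
    simp only [capAreaIn]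
    rw [← Finset.mul_sum]
    congr 1
    have hU : C ∩ Subtype.val '' (univ : Set (Metric.sphere (0 : EuclideanSpace ℝ (Fin L)) 1)) =
        ⋃ j ∈ Finset.univ, C ∩ Subtype.val '' A j := by
      have : (⋃ j, A j) = univ := eq_univ_of_forall fun x => mem_iUnion.2 (hA.cover x)
      rw [← this, image_iUnion, inter_iUnion]
      simp
    rw [hU, ncard_biUnion_finset]
    · push_cast; rfl
    · exact fun j _ => hC.finite.subset inter_subset_left
    · intro i _ j _ hij
      refine Disjoint.mono inter_subset_right inter_subset_right ?_
      exact (disjoint_image_iff Subtype.val_injective).2 (hA.disjoint hij)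
  have h2 := (abs_le.1 ((Finset.abs_sum_le_sum_abs _ _).trans hsum)).1
  rw [Finset.sum_sub_distrib, ← Finset.mul_sum, hA.sum_measureReal, ← h1] at h2
  linarith

/-- The area of a thickening of a set with null boundary tends to the area of the set. -/
lemma eventually_capAreaIn_le {L : ℕ} {δ : ℝ} (hδ : 0 ≤ δ)
    {C : ℝ → Set (EuclideanSpace ℝ (Fin L))}
    (h : ∀ ε > 0, ∀ᶠ d in 𝓝[>] (0 : ℝ), IsAlmostUniform δ ε d (C d))
    {B : Set (Metric.sphere (0 : EuclideanSpace ℝ (Fin L)) 1)}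
    (hB : sphereMeasure L (frontier B) = 0) {ε : ℝ} (hε : 0 < ε) :
    ∀ᶠ d in 𝓝[>] (0 : ℝ), capAreaIn d (C d) B ≤ δ * (sphereMeasure L).real B + ε := by
  set σ := sphereMeasure L
  have hcl : σ.real (closure B) = σ.real B := by
    refine le_antisymm ?_ (measureReal_mono subset_closure)
    rw [closure_eq_self_union_frontier]
    refine (measureReal_union_le _ _).trans ?_
    simp [Measure.real, hB]
  have hlim : Tendsto (fun s => δ * σ.real (Metric.cthickening s B) + s) (𝓝 0)
      (𝓝 (δ * σ.real B + 0)) := by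
    rw [← hcl]
    exact (((ENNReal.tendsto_toReal (measure_ne_top σ _)).comp (tendsto_measure_cthickening
      ⟨1, one_pos, measure_ne_top σ _⟩)).const_mul δ).add tendsto_id
  rw [add_zero] at hlim
  obtain ⟨s, h1, h2⟩ := (((hlim.eventually_lt_const (lt_add_of_pos_right _ hε)).filter_mono
    nhdsWithin_le_nhds).and (self_mem_nhdsWithin (s := Ioi (0 : ℝ)))).exists
  filter_upwards [self_mem_nhdsWithin, h s h2] with d hd hCd
  exact (hCd.capAreaIn_le hδ (le_of_lt hd) B).trans h1.le

/-- The upper bound on a region and on its complement and the total count give the density. -/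
lemma hasDensity_of_isAlmostUniform {L : ℕ} {δ : ℝ} (hδ : 0 ≤ δ)
    {C : ℝ → Set (EuclideanSpace ℝ (Fin L))}
    (h : ∀ ε > 0, ∀ᶠ d in 𝓝[>] (0 : ℝ), IsAlmostUniform δ ε d (C d)) : HasDensity C δ := by
  intro A hA
  have hAc : sphereMeasure L (frontier Aᶜ) = 0 := by rw [frontier_compl]; exact hA.2
  rw [Metric.tendsto_nhds]
  intro ε hε
  filter_upwards [self_mem_nhdsWithin, eventually_capAreaIn_le hδ h hA.2 (half_pos hε),
    eventually_capAreaIn_le hδ h hAc (half_pos (half_pos hε)),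
    h _ (half_pos (half_pos (half_pos hε)))] with d hd h1 h2 h3
  have h4 := h3.le_capAreaIn_univ
  have h5 : capAreaIn d (C d) univ = capAreaIn d (C d) A + capAreaIn d (C d) Aᶜ := by
    simp only [capAreaIn]
    rw [← mul_add, ← Nat.cast_add, ← ncard_union_eq ?_ (h3.1.finite.subset inter_subset_left)
      (h3.1.finite.subset inter_subset_left), ← inter_union_distrib_left, ← image_union,
      union_compl_self]
    refine Disjoint.mono inter_subset_right inter_subset_right ?_
    exact (disjoint_image_iff Subtype.val_injective).2 disjoint_compl_right
  have h6 : (sphereMeasure L).real univ ≥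
      (sphereMeasure L).real A + (sphereMeasure L).real Aᶜ := by
    have hn : NullMeasurableSet A (sphereMeasure L) := nullMeasurableSet_of_null_frontier hA.2
    exact (measureReal_add_measureReal_compl₀ hn).le
  have h7 := mul_le_mul_of_nonneg_left h6 hδ
  change dist _ (δ * (sphereMeasure L).real A) < ε
  rw [Real.dist_eq, abs_lt]
  constructor <;> linarith

/-- Diagonal choice: the almost uniform codes can be chosen with error tending to zero. -/
lemma exists_hasDensity {L : ℕ} {δ : ℝ} (hδ : 0 ≤ δ)
    (h : ∀ ε > 0, ∀ᶠ d in 𝓝[>] (0 : ℝ), ∃ C : Set (EuclideanSpace ℝ (Fin L)),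
      IsAlmostUniform δ ε d C) :
    ∃ C : ℝ → Set (EuclideanSpace ℝ (Fin L)),
      (∀ d, IsSphericalCode d (C d)) ∧ HasDensity C δ := by
  classical
  -- the error for `d` is `1 / (m + 1)`, with `m ≤ 1 / d` largest such that a code exists; where
  -- there is none, the empty code is used
  let Q : ℝ → ℕ → Prop := fun d n => ∃ C : Set (EuclideanSpace ℝ (Fin L)),
    IsAlmostUniform δ (1 / ((n : ℝ) + 1)) d C
  let m : ℝ → ℕ := fun d => Nat.findGreatest (Q d) ⌊d⁻¹⌋₊
  have hchoose : ∀ d, ∃ C : Set (EuclideanSpace ℝ (Fin L)), IsSphericalCode d C ∧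
      (Q d (m d) → IsAlmostUniform δ (1 / ((m d : ℝ) + 1)) d C) := by
    intro d
    by_cases hQ : Q d (m d)
    · obtain ⟨C, hC⟩ := hQ
      exact ⟨C, hC.1, fun _ => hC⟩
    · exact ⟨∅, ⟨finite_empty, by simp, by simp⟩, fun h' => absurd h' hQ⟩
  choose C hC hCQ using hchoose
  refine ⟨C, hC, hasDensity_of_isAlmostUniform hδ fun ε hε => ?_⟩
  obtain ⟨k, hk⟩ := exists_nat_one_div_lt hε
  have hfl : ∀ᶠ d in 𝓝[>] (0 : ℝ), k ≤ ⌊d⁻¹⌋₊ :=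
    (tendsto_nat_floor_atTop.comp (tendsto_inv_nhdsGT_zero (𝕜 := ℝ))).eventually_ge_atTop k
  filter_upwards [hfl, h (1 / ((k : ℝ) + 1)) (by positivity)] with d hd hQ
  have h1 : k ≤ m d := Nat.le_findGreatest hd hQ
  have h2 : Q d (m d) := Nat.findGreatest_spec hd hQ
  refine (hCQ d h2).mono (le_trans ?_ hk.le)
  gcongr

lemma exists_isLargestLatticeTLSC {L : ℕ} (hL : 0 < L) {d : ℝ} (hd : 0 < d)
    {C : Set (EuclideanSpace ℝ (Fin L))} (hC : IsSphericalCode d C) :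
    ∃ X, IsLargestLatticeTLSC d C X := by
  have : ∀ c, ∃ Y, c ∈ posPart C → IsLargestLatticeLayer d c Y := by
    intro c
    by_cases hc : c ∈ posPart C
    · obtain ⟨Y, hY⟩ := exists_isLargestLatticeLayer hL hd (hC.norm_eq c hc.1) hc.2
      exact ⟨Y, fun _ => hY⟩
    · exact ⟨∅, fun h => absurd h hc⟩
  choose Y hY using this
  exact ⟨_, hC, Y, hY, rfl⟩

end TorusLayer

end

theorem mainTheorem1 (L : ℕ) (hL : 2 ≤ L)
    (ΛL : Submodule ℤ (EuclideanSpace ℝ (Fin L))) [DiscreteTopology ΛL] [IsZLattice ℝ ΛL]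
    (ΛM : Submodule ℤ (EuclideanSpace ℝ (Fin (L - 1)))) [DiscreteTopology ΛM] [IsZLattice ℝ ΛM]
    (hΛL : TorusLayer.IsDensest ΛL) (hL2 : TorusLayer.minDist ΛL = 2)
    (hΛM : TorusLayer.IsDensest ΛM) (hM2 : TorusLayer.minDist ΛM = 2) :
    -- the density of the Cartesian product lattice
    TorusLayer.latticeDensity (TorusLayer.prodLattice ΛL ΛM) =
        TorusLayer.ballVol (2 * L - 1) / (ZLattice.covolume ΛL * ZLattice.covolume ΛM) ∧
    -- asymptotic upper bound
    (∀ (C : ℝ → Set (EuclideanSpace ℝ (Fin L)))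
        (X : ℝ → Set (EuclideanSpace ℝ (Fin L × Fin 2))),
      (∀ d ∈ Ioc 0 (Real.sqrt 2), TorusLayer.IsLatticeTLSC d (C d) (X d)) →
      TorusLayer.HasDensityAtMost C (TorusLayer.latticeDensity ΛM) →
      ∀ ε > 0, ∀ᶠ d in 𝓝[>] (0 : ℝ), TorusLayer.sphericalDensity (2 * L) d (X d) ≤
        TorusLayer.latticeDensity (TorusLayer.prodLattice ΛL ΛM) + ε) ∧
    -- convergence
    (∀ (C : ℝ → Set (EuclideanSpace ℝ (Fin L)))
        (X : ℝ → Set (EuclideanSpace ℝ (Fin L × Fin 2))),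
      (∀ d ∈ Ioc 0 (Real.sqrt 2), TorusLayer.IsLargestLatticeTLSC d (C d) (X d)) →
      TorusLayer.HasDensity C (TorusLayer.latticeDensity ΛM) →
      Tendsto (fun d => TorusLayer.sphericalDensity (2 * L) d (X d)) (𝓝[>] (0 : ℝ))
        (𝓝 (TorusLayer.latticeDensity (TorusLayer.prodLattice ΛL ΛM)))) ∧
    -- such families of codes exist
    (∃ (C : ℝ → Set (EuclideanSpace ℝ (Fin L)))
        (X : ℝ → Set (EuclideanSpace ℝ (Fin L × Fin 2))),
      (∀ d ∈ Ioc 0 (Real.sqrt 2), TorusLayer.IsLargestLatticeTLSC d (C d) (X d)) ∧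
      TorusLayer.HasDensity C (TorusLayer.latticeDensity ΛM)) := by
  have hsqrt : Ioc 0 (Real.sqrt 2) ∈ 𝓝[>] (0 : ℝ) := Ioc_mem_nhdsGT (by positivity)
  refine ⟨?_, fun C X hX hC ε hε => ?_, fun C X hX hC => ?_, ?_⟩
  · rw [TorusLayer.latticeDensity_prodLattice (by omega) ΛL ΛM hL2 hM2,
      show L + (L - 1) = 2 * L - 1 by omega]
  · exact TorusLayer.eventually_sphericalDensity_le hL ΛL ΛM hΛL hL2 hM2
      (Filter.mem_of_superset hsqrt hX) hC hε
  · exact TorusLayer.tendsto_sphericalDensity hL ΛL ΛM hΛL hL2 hM2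
      (Filter.mem_of_superset hsqrt hX) hC
  · have hδ : 0 ≤ TorusLayer.latticeDensity ΛM := by
      rw [TorusLayer.latticeDensity_eq_of_minDist hM2]
      exact div_nonneg (TorusLayer.ballVol_pos _).le (ZLattice.covolume_pos ΛM volume).le
    have hcode : ∀ (M : ℕ) (Λ : Submodule ℤ (EuclideanSpace ℝ (Fin M))) [DiscreteTopology Λ]
        [IsZLattice ℝ Λ], L = M + 1 → TorusLayer.minDist Λ = 2 → ∀ ε > 0, ∀ᶠ d in 𝓝[>] (0 : ℝ),
        ∃ C : Set (EuclideanSpace ℝ (Fin L)),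
          TorusLayer.IsAlmostUniform (TorusLayer.latticeDensity Λ) ε d C := by
      rintro M Λ _ _ rfl h2 ε hε
      exact TorusLayer.eventually_exists_isAlmostUniform (by omega) Λ h2 hε
    obtain ⟨C, hC, hdens⟩ := TorusLayer.exists_hasDensity hδ (hcode (L - 1) ΛM (by omega) hM2)
    have hX : ∀ d, ∃ X, 0 < d → TorusLayer.IsLargestLatticeTLSC d (C d) X := by
      intro d
      by_cases hd : 0 < d
      · obtain ⟨X, hX⟩ := TorusLayer.exists_isLargestLatticeTLSC (by omega) hd (hC d)
        exact ⟨X, fun _ => hX⟩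
      · exact ⟨∅, fun h => absurd h hd⟩
    choose X hX using hX
    exact ⟨C, X, fun d hd => hX d hd.1, hdens⟩
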